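/- Let $\alpha\in(0,1)$, $\beta\in(0,1)\cup(1,2]$, $r>0$, $T>0$, $\kappa>0$, $\theta<1$, $c>0$, $K>0$. For $N\ge 1$ let $0=t_0<t_1<\dots<t_N=T$ be a graded or quasi-graded mesh with steps $\tau_n=t_n-t_{n-1}$ and scale $\tau=T/N^r$, i.e. for $1\le n\le N$ $$c^{-1}\,T(n/N)^r\le t_n\le c\,T(n/N)^r,\qquad c^{-1}\,\tau n^{r-1}\le \tau_n\le c\,\tau n^{r-1},$$ and suppose that the steps satisfy $\kappa\,\Gamma(2-\alpha)\,\tau_n^{\alpha}\le\theta$ for $1\le n\le N$. Let $$\mathrm D_\tau^\alpha v^n=\sum_{k=1}^n a^{(n)}_{n-k}(v^k-v^{k-1}),\qquad a^{(n)}_{n-k}=\frac1{\tau_k}\int_{t_{k-1}}^{t_k}\frac{(t_n-s)^{-\alpha}}{\Gamma(1-\alpha)}\,ds$$ be the L1 discretization of the Caputo derivative $\partial_t^\alpha u(t)=\frac1{\Gamma(1-\alpha)}\int_0^t (t-s)^{-\alpha}u'(s)\,ds$. Let $u$ be a function on $[0,T]$ with values in a real Banach space $X$ (e.g. $L^2(\Omega)$),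 continuous on $[0,T]$ and twice differentiable on $(0,T)$, with $\|\partial_t^m u(t)\|\le K t^{\beta-m}$ for $0<t<T$ and $m=1,2$, and let $\mathtt T_\tau^n=\mathrm D_\tau^\alpha u(t_n)-\partial_t^\alpha u(t_n)$ be its temporal truncation error. Let $(\mathtt T_h^n)$ be real numbers (the spatial truncation errors) and $\mathcal E^0,\dots,\mathcal E^N\ge0$ (the errors at the time levels) be such that $$\mathrm D_\tau^\alpha\mathcal E^n\le\kappa\,\mathcal E^n+|\mathtt T_h^n|+\|\mathtt T_\tau^n\|,\qquad 1\le n\le N.$$ Then there is a constant $C$, depending only on $\alpha,\beta,r,T,\kappa,\theta,c,K$, such that for all $1\le n\le N$ $$\mathcal E^n\le C\left(\mathcal E^0+t_n^{\alpha}\max_{1\le j\le n}|\mathtt T_h^j|\right)+C\begin{cases}\tau^{(2-\alpha)/r}\,t_n^{\beta-(2-\alpha)/r}, & r>\frac{2-\alpha}{1+\beta-\alpha},\\[2pt] \tau^{1+\beta-\alpha}\,t_n^{\alpha-1}(1+\ln n), & r=\frac{2-\alpha}{1+\beta-\alpha},\\[2pt] \tau^{1+\beta-\alpha}\,t_n^{\alpha-1},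 & r<\frac{2-\alpha}{1+\beta-\alpha}.\end{cases}$$ In particular, if $\mathcal E^0=0$ and there is no spatial error ($\mathtt T_h^n=0$ for all $n$), then $\mathcal E^n$ is bounded by $C$ times the three-case expression alone. -/

import Mathlib

open Real Set MeasureTheory

noncomputable section

/-- The Gelfand-Shilov function `ω_α(s) = s^(α-1) / Γ(α)`, for `s ≥ 0`. -/
def gelfandShilov (α s : ℝ) : ℝ := s ^ (α - 1) / Real.Gamma α

/-- The time step `τ_k = t_k - t_{k-1}`, for `k ≥ 1`. -/
def timeStep (t : ℕ → ℝ) (k : ℕ) : ℝ := t k - t (k - 1)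

/-- The L1 kernel `a_{n-k}^{(n)} = (1/τ_k) ∫_{t_{k-1}}^{t_k} ω_{1-α}(t_n - s) ds`,
for `1 ≤ k ≤ n`. -/
def l1Kernel (α : ℝ) (t : ℕ → ℝ) (n k : ℕ) : ℝ :=
  (1 / timeStep t k) * ∫ s in (t (k - 1))..(t k), gelfandShilov (1 - α) (t n - s)

/-- The L1 discrete Caputo operator
`D_τ^α v^n = ∑_{k=1}^n a_{n-k}^{(n)} (v^k - v^{k-1})`. -/
def discreteCaputo {X : Type*} [NormedAddCommGroup X] [NormedSpace ℝ X]
    (α : ℝ) (t : ℕ → ℝ) (v : ℕ → X) (n : ℕ) : X :=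
  ∑ k ∈ Finset.Icc 1 n, l1Kernel α t n k • (v k - v (k - 1))

/-- The Caputo derivative `∂_t^α u(t) = ∫_0^t ω_{1-α}(t - s) u'(s) ds`. -/
def caputoDeriv {X : Type*} [NormedAddCommGroup X] [NormedSpace ℝ X]
    (α : ℝ) (u : ℝ → X) (t : ℝ) : X :=
  ∫ s in (0 : ℝ)..t, gelfandShilov (1 - α) (t - s) • deriv u s

/-- The temporal truncation error of the L1 scheme at the `n`-th time level,
`D_τ^α u(t_n) - ∂_t^α u(t_n)`. -/
def temporalTruncation {X : Type*} [NormedAddCommGroup X] [NormedSpace ℝ X]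
    (α : ℝ) (t : ℕ → ℝ) (u : ℝ → X) (n : ℕ) : X :=
  discreteCaputo α t (fun k => u (t k)) n - caputoDeriv α u (t n)

/-- The smallest scale `τ = T / N^r` of a graded mesh. -/
def gradedScale (T r : ℝ) (N : ℕ) : ℝ := T / (N : ℝ) ^ r

/-- `0 = t_0 < t_1 < ⋯ < t_N = T` is a graded or quasi-graded mesh with grading exponent `r`:
`t_n ∼ T (n/N)^r` and `τ_n ∼ τ n^(r-1)` with `τ = T / N^r`, where `∼` means equality up to
factors in `[c⁻¹, c]`. -/
structure IsQuasiGradedMesh (T r c : ℝ) (N : ℕ) (t : ℕ → ℝ) : Prop where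
  start : t 0 = 0
  final : t N = T
  node_lower : ∀ n, 1 ≤ n → n ≤ N → c⁻¹ * (T * ((n : ℝ) / N) ^ r) ≤ t n
  node_upper : ∀ n, 1 ≤ n → n ≤ N → t n ≤ c * (T * ((n : ℝ) / N) ^ r)
  step_lower : ∀ n, 1 ≤ n → n ≤ N →
    c⁻¹ * (gradedScale T r N * (n : ℝ) ^ (r - 1)) ≤ timeStep t n
  step_upper : ∀ n, 1 ≤ n → n ≤ N →
    timeStep t n ≤ c * (gradedScale T r N * (n : ℝ) ^ (r - 1))

/-- `u` is continuous on `[0,T]`, twice differentiable on `(0,T)`, and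
`‖∂_t^m u(t)‖ ≤ K t^(β-m)` for `m = 1, 2`. -/
structure HasWeakSingularity {X : Type*} [NormedAddCommGroup X] [NormedSpace ℝ X]
    (T β K : ℝ) (u : ℝ → X) : Prop where
  cont : ContinuousOn u (Icc 0 T)
  diff_one : DifferentiableOn ℝ u (Ioo 0 T)
  diff_two : DifferentiableOn ℝ (deriv u) (Ioo 0 T)
  bound_one : ∀ t ∈ Ioo 0 T, ‖deriv u t‖ ≤ K * t ^ (β - 1)
  bound_two : ∀ t ∈ Ioo 0 T, ‖deriv (deriv u) t‖ ≤ K * t ^ (β - 2)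

/-- The contribution of the initial error and of the spatial truncation errors up to level `n`,
`E^0 + t_n^α max_{1 ≤ j ≤ n} |T_h^j|`; it is `0` if these vanish. -/
def dataError (α : ℝ) (t E Th : ℕ → ℝ) (n : ℕ) : ℝ :=
  E 0 + t n ^ α * ⨆ j : Fin n, |Th (j + 1)|

end

/-!
The quantity to be bounded solves a lower triangular system with an M-matrix: the L1 kernels
`a_{n-k}^{(n)}` are positive and increase with `k`, and the step restriction makes the diagonal
entries exceed `κ`. Hence a comparison principle holds (`nonpos_of_discreteCaputo_le`), and the error
is bounded by any supersolution for the truncation errors. There are three ingredients.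

*Truncation error.* Subtracting constants from the weight `(t_n - s)^(-α)` and from `u'` on each
interval, the quadrature error is at most the oscillation of `u'` times the growth of the weight.
Summed over the mesh (`sum_quadrature_le`, `norm_temporalTruncation_le`), this gives
`τ^(β-α) ((τ / t_n)^(1+α) + (τ / t_n)^((2-α)/r-β+α))`, the first term coming from the initial singularity.

*Responses for `κ = 0`.* The key is a barrier `V` for a unit source up to the node `t_m`, with
`D_τ^α V ≥ 1` up to `t_m`, `D_τ^α V ≥ 0` afterwards, and `V^n ≤ C t_m t_n^(α-1)` (`exists_barrier`).
It is constant up to `t_m` and equal to `s^(α-1) - A s^(α-1-δ)` later. The first power is annihilated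
by the Riemann-Liouville derivative; the second contributes a positive multiple of
`t_m^δ t_n^(-1-δ)` (`le_caputo_decayProfile`), which for small `δ` and large `m` dominates the
quadrature error of `V`, for every grading exponent `r > 0`. Superposition of these barriers bounds the
response to a decreasing source `f` by `C t_n^(α-1) ∑ f_m τ_m` (`le_of_antitone_source`). For
`f_m = (τ / t_m)^p` the sum is a multiple of `∑ m^(r(1-p)-1)`, and the three cases `p < 1`, `p = 1`,
`p > 1` are the three cases of the theorem.

*The reaction term.* A source `t_j^(-q)` with `q < 1` gains the power `t^α` with each application of
the solution operator for `κ = 0`, so that finitely many subtractions leave a bounded source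
(`le_of_rpow_source`). Bounded sources are handled by a discrete Grönwall inequality, whose barrier
is a step function growing geometrically in time (`gronwall_const`); it needs no more than the step
restriction with `θ < 1`.
-/

/-! ### The L1 kernel -/

lemma gelfandShilov_one_sub (α s : ℝ) :
    gelfandShilov (1 - α) s = s ^ (-α) / Real.Gamma (1 - α) := by
  rw [gelfandShilov]; congr 2; ring

lemma gamma_two_sub {α : ℝ} (hα : α < 1) :
    Real.Gamma (2 - α) = (1 - α) * Real.Gamma (1 - α) := by
  rw [← Real.Gamma_add_one (by linarith)]; congr 1; ring

lemma intervalIntegrable_sub_rpow_neg {α : ℝ} (hα : α < 1) (x a b : ℝ) :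
    IntervalIntegrable (fun s => (x - s) ^ (-α)) volume a b := by
  have h := (intervalIntegral.intervalIntegrable_rpow' (a := x - a) (b := x - b) (r := -α)
    (by linarith)).comp_sub_left x
  simpa using h

lemma integral_sub_rpow_neg {α : ℝ} (hα : α < 1) (x a b : ℝ) :
    ∫ s in a..b, (x - s) ^ (-α) = ((x - a) ^ (1 - α) - (x - b) ^ (1 - α)) / (1 - α) := by
  rw [intervalIntegral.integral_comp_sub_left (fun s => s ^ (-α)) x,
    integral_rpow (Or.inl (by linarith))]
  rw [show -α + 1 = 1 - α by ring]

lemma sub_rpow_neg_mono {α x a s : ℝ} (hα : 0 ≤ α) (has : a ≤ s) (hs : s < x) :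
    (x - a) ^ (-α) ≤ (x - s) ^ (-α) :=
  Real.rpow_le_rpow_of_nonpos (by linarith) (by linarith) (by linarith)

lemma integral_sub_rpow_neg_ge {α x a b : ℝ} (h0 : 0 ≤ α) (hα : α < 1) (hab : a ≤ b)
    (hb : b ≤ x) : (b - a) * (x - a) ^ (-α) ≤ ∫ s in a..b, (x - s) ^ (-α) := by
  have h : ∫ _ in a..b, (x - a) ^ (-α) ≤ ∫ s in a..b, (x - s) ^ (-α) := by
    refine intervalIntegral.integral_mono_on_of_le_Ioo hab (by simp)
      (intervalIntegrable_sub_rpow_neg hα x a b) ?_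
    intro s hs
    exact sub_rpow_neg_mono h0 hs.1.le (by linarith [hs.2])
  simpa using h

lemma integral_sub_rpow_neg_le {α x a b : ℝ} (h0 : 0 ≤ α) (hα : α < 1) (hab : a ≤ b)
    (hb : b < x) : ∫ s in a..b, (x - s) ^ (-α) ≤ (b - a) * (x - b) ^ (-α) := by
  have h : ∫ s in a..b, (x - s) ^ (-α) ≤ ∫ _ in a..b, (x - b) ^ (-α) := by
    refine intervalIntegral.integral_mono_on_of_le_Ioo hab
      (intervalIntegrable_sub_rpow_neg hα x a b) (by simp) ?_
    intro s hs
    exact sub_rpow_neg_mono h0 hs.2.le hb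
  simpa using h

lemma l1Kernel_eq_integral (α : ℝ) (t : ℕ → ℝ) (n k : ℕ) :
    l1Kernel α t n k =
      (∫ s in (t (k - 1))..(t k), (t n - s) ^ (-α)) / timeStep t k / Real.Gamma (1 - α) := by
  simp only [l1Kernel, gelfandShilov_one_sub, intervalIntegral.integral_div]
  ring

lemma l1Kernel_eq {α : ℝ} (hα : α < 1) (t : ℕ → ℝ) (n k : ℕ) :
    l1Kernel α t n k = ((t n - t (k - 1)) ^ (1 - α) - (t n - t k) ^ (1 - α)) / timeStep t k
      / Real.Gamma (2 - α) := by
  rw [l1Kernel_eq_integral, integral_sub_rpow_neg hα, gamma_two_sub hα, div_div, div_div, div_div]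
  congr 1
  ring

lemma l1Kernel_self {α : ℝ} (hα : α < 1) (t : ℕ → ℝ) (n : ℕ) (h : 0 < timeStep t n) :
    l1Kernel α t n n = timeStep t n ^ (-α) / Real.Gamma (2 - α) := by
  rw [l1Kernel_eq hα]
  have h1 : t n - t (n - 1) = timeStep t n := rfl
  rw [h1, sub_self, Real.zero_rpow (by linarith), sub_zero]
  congr 1
  rw [div_eq_iff h.ne', show 1 - α = -α + 1 by ring, Real.rpow_add_one h.ne']

/-- A time mesh `0 = t_0 < t_1 < ⋯ < t_N`, without any grading assumption. -/
structure IsTimeMesh (N : ℕ) (t : ℕ → ℝ) : Prop where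
  start : t 0 = 0
  step_pos : ∀ k, 1 ≤ k → k ≤ N → 0 < timeStep t k

namespace IsTimeMesh

variable {N : ℕ} {t : ℕ → ℝ}

lemma lt_of_lt (h : IsTimeMesh N t) {i j : ℕ} (hij : i < j) (hj : j ≤ N) : t i < t j := by
  induction j with
  | zero => omega
  | succ j ih =>
    have h1 := h.step_pos (j + 1) (by omega) hj
    rw [timeStep, Nat.add_sub_cancel] at h1
    rcases Nat.lt_succ_iff_lt_or_eq.mp hij with h2 | h2
    · have := ih h2 (by omega); linarith
    · subst h2; linarith

lemma le_of_le (h : IsTimeMesh N t) {i j : ℕ} (hij : i ≤ j) (hj : j ≤ N) : t i ≤ t j := by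
  rcases hij.lt_or_eq with h1 | h1
  · exact (h.lt_of_lt h1 hj).le
  · rw [h1]

lemma pos (h : IsTimeMesh N t) {j : ℕ} (h1 : 1 ≤ j) (hj : j ≤ N) : 0 < t j := by
  have := h.lt_of_lt (i := 0) (j := j) (by omega) hj
  rwa [h.start] at this

lemma nonneg (h : IsTimeMesh N t) {j : ℕ} (hj : j ≤ N) : 0 ≤ t j := by
  have := h.le_of_le (Nat.zero_le j) hj
  rwa [h.start] at this

lemma mono (h : IsTimeMesh N t) {n : ℕ} (hn : n ≤ N) : IsTimeMesh n t :=
  ⟨h.start, fun k h1 h2 => h.step_pos k h1 (h2.trans hn)⟩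

end IsTimeMesh

section Kernel

variable {α : ℝ} {N : ℕ} {t : ℕ → ℝ}

lemma gamma_one_sub_pos (hα : α ∈ Ioo (0 : ℝ) 1) : 0 < Real.Gamma (1 - α) :=
  Real.Gamma_pos_of_pos (by linarith [hα.2])

lemma gamma_two_sub_pos (hα : α ∈ Ioo (0 : ℝ) 1) : 0 < Real.Gamma (2 - α) :=
  Real.Gamma_pos_of_pos (by linarith [hα.2])

lemma l1Kernel_ge (hα : α ∈ Ioo (0 : ℝ) 1) (ht : IsTimeMesh N t) {n k : ℕ} (hk : 1 ≤ k)
    (hkn : k ≤ n) (hn : n ≤ N) :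
    (t n - t (k - 1)) ^ (-α) / Real.Gamma (1 - α) ≤ l1Kernel α t n k := by
  rw [l1Kernel_eq_integral]
  have h1 := ht.step_pos k hk (hkn.trans hn)
  refine div_le_div_of_nonneg_right ?_ (gamma_one_sub_pos hα).le
  rw [le_div_iff₀ h1, mul_comm]
  exact integral_sub_rpow_neg_ge hα.1.le hα.2 (by rw [timeStep] at h1; linarith)
    (ht.le_of_le hkn hn)

lemma l1Kernel_le (hα : α ∈ Ioo (0 : ℝ) 1) (ht : IsTimeMesh N t) {n k : ℕ} (hk : 1 ≤ k)
    (hkn : k < n) (hn : n ≤ N) :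
    l1Kernel α t n k ≤ (t n - t k) ^ (-α) / Real.Gamma (1 - α) := by
  rw [l1Kernel_eq_integral]
  have h1 := ht.step_pos k hk (hkn.le.trans hn)
  refine div_le_div_of_nonneg_right ?_ (gamma_one_sub_pos hα).le
  rw [div_le_iff₀ h1, mul_comm]
  exact integral_sub_rpow_neg_le hα.1.le hα.2 (by rw [timeStep] at h1; linarith)
    (ht.lt_of_lt hkn hn)

lemma l1Kernel_pos (hα : α ∈ Ioo (0 : ℝ) 1) (ht : IsTimeMesh N t) {n k : ℕ} (hk : 1 ≤ k)
    (hkn : k ≤ n) (hn : n ≤ N) : 0 < l1Kernel α t n k := by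
  refine lt_of_lt_of_le ?_ (l1Kernel_ge hα ht hk hkn hn)
  refine div_pos (Real.rpow_pos_of_pos ?_ _) (gamma_one_sub_pos hα)
  linarith [ht.lt_of_lt (show k - 1 < n by omega) hn]

/-- The kernels `a_{n-k}^{(n)}` increase with `k`, as averages of an increasing function over
successive intervals. -/
lemma l1Kernel_mono (hα : α ∈ Ioo (0 : ℝ) 1) (ht : IsTimeMesh N t) {n k : ℕ} (hk : 1 ≤ k)
    (hkn : k + 1 ≤ n) (hn : n ≤ N) : l1Kernel α t n k ≤ l1Kernel α t n (k + 1) := by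
  have h1 := l1Kernel_le hα ht hk (by omega) hn
  have h2 := l1Kernel_ge hα ht (k := k + 1) (by omega) hkn hn
  rw [Nat.add_sub_cancel] at h2
  exact h1.trans h2

/-! ### The discrete Caputo operator: linearity, comparison and solvability -/

lemma discreteCaputo_sub (α : ℝ) (t : ℕ → ℝ) (v w : ℕ → ℝ) (n : ℕ) :
    discreteCaputo α t (fun k => v k - w k) n
      = discreteCaputo α t v n - discreteCaputo α t w n := by
  simp only [discreteCaputo, smul_eq_mul, ← Finset.sum_sub_distrib]
  exact Finset.sum_congr rfl fun _ _ => by ring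

lemma discreteCaputo_add (α : ℝ) (t : ℕ → ℝ) (v w : ℕ → ℝ) (n : ℕ) :
    discreteCaputo α t (fun k => v k + w k) n
      = discreteCaputo α t v n + discreteCaputo α t w n := by
  simp only [discreteCaputo, smul_eq_mul, ← Finset.sum_add_distrib]
  exact Finset.sum_congr rfl fun _ _ => by ring

lemma discreteCaputo_const_mul (α : ℝ) (t : ℕ → ℝ) (a : ℝ) (v : ℕ → ℝ) (n : ℕ) :
    discreteCaputo α t (fun k => a * v k) n = a * discreteCaputo α t v n := by
  simp only [discreteCaputo, smul_eq_mul, Finset.mul_sum]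
  exact Finset.sum_congr rfl fun _ _ => by ring

lemma discreteCaputo_const (α : ℝ) (t : ℕ → ℝ) (a : ℝ) (n : ℕ) :
    discreteCaputo α t (fun _ => a) n = 0 := by
  simp [discreteCaputo]

lemma discreteCaputo_sum {ι : Type*} (α : ℝ) (t : ℕ → ℝ) (s : Finset ι) (v : ι → ℕ → ℝ) (n : ℕ) :
    discreteCaputo α t (fun k => ∑ i ∈ s, v i k) n = ∑ i ∈ s, discreteCaputo α t (v i) n := by
  simp only [discreteCaputo, smul_eq_mul, ← Finset.sum_sub_distrib, Finset.mul_sum]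
  exact Finset.sum_comm

lemma discreteCaputo_congr (α : ℝ) (t : ℕ → ℝ) {v w : ℕ → ℝ} {n : ℕ}
    (h : ∀ k ≤ n, v k = w k) : discreteCaputo α t v n = discreteCaputo α t w n := by
  refine Finset.sum_congr rfl fun k hk => ?_
  rw [Finset.mem_Icc] at hk
  rw [h k hk.2, h (k - 1) (by omega)]

/-- If the previous values are nonpositive, then summation by parts with the increasing kernels
leaves `D_τ^α z^n ≥ a_0^{(n)} z^n`. -/
lemma l1Kernel_self_mul_le (hα : α ∈ Ioo (0 : ℝ) 1) (ht : IsTimeMesh N t) {n : ℕ} (h1 : 1 ≤ n)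
    (hn : n ≤ N) {z : ℕ → ℝ} (hz : ∀ k < n, z k ≤ 0) :
    l1Kernel α t n n * z n ≤ discreteCaputo α t z n := by
  have key : ∀ j, 1 ≤ j → j ≤ n →
      l1Kernel α t n j * z j ≤ ∑ k ∈ Finset.Icc 1 j, l1Kernel α t n k • (z k - z (k - 1)) := by
    intro j hj
    induction j, hj using Nat.le_induction with
    | base =>
      intro _
      have := mul_nonneg (l1Kernel_pos hα ht le_rfl h1 hn).le (neg_nonneg.2 (hz 0 (by omega)))
      simp only [Finset.Icc_self, Finset.sum_singleton, smul_eq_mul, Nat.sub_self]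
      linarith
    | succ j hj ih =>
      intro hjn
      rw [Finset.sum_Icc_succ_top (by omega), Nat.add_sub_cancel, smul_eq_mul]
      have := ih (by omega)
      have h2 := mul_nonneg (sub_nonneg.2 (l1Kernel_mono hα ht hj hjn hn))
        (neg_nonneg.2 (hz j (by omega)))
      linarith
  exact key n h1 le_rfl

/-- Discrete comparison principle for `D_τ^α - κ`, when `κ` is less than the diagonal entries. -/
lemma nonpos_of_discreteCaputo_le (hα : α ∈ Ioo (0 : ℝ) 1) (ht : IsTimeMesh N t) {κ : ℝ}
    (hκ : ∀ n, 1 ≤ n → n ≤ N → κ < l1Kernel α t n n) {z : ℕ → ℝ} (h0 : z 0 ≤ 0)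
    (hz : ∀ n, 1 ≤ n → n ≤ N → discreteCaputo α t z n ≤ κ * z n) :
    ∀ n ≤ N, z n ≤ 0 := by
  intro n
  induction n using Nat.strong_induction_on with
  | _ n ih =>
    intro hn
    rcases Nat.eq_zero_or_pos n with h | h
    · rw [h]; exact h0
    by_contra! hpos
    have h2 := l1Kernel_self_mul_le hα ht h hn (fun k hk => ih k hk (by omega))
    have h3 := hz n h hn
    have h4 := mul_lt_mul_of_pos_right (hκ n h hn) hpos
    linarith

lemma le_of_discreteCaputo_le (hα : α ∈ Ioo (0 : ℝ) 1) (ht : IsTimeMesh N t)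
    {v w : ℕ → ℝ} (h0 : v 0 ≤ w 0)
    (hz : ∀ n, 1 ≤ n → n ≤ N → discreteCaputo α t v n ≤ discreteCaputo α t w n) :
    ∀ n ≤ N, v n ≤ w n := by
  intro n hn
  have := nonpos_of_discreteCaputo_le (κ := 0) hα ht
    (fun n h1 hn => l1Kernel_pos hα ht h1 le_rfl hn) (z := fun k => v k - w k) (by simpa using h0)
    (fun n h1 hn => by rw [discreteCaputo_sub]; linarith [hz n h1 hn]) n hn
  linarith

/-- The triangular system `D_τ^α w = κ w + f`, `w^0 = 0`, is solvable. -/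
lemma exists_discreteCaputo_eq {κ : ℝ} (hκ : ∀ n, 1 ≤ n → n ≤ N → κ < l1Kernel α t n n)
    (f : ℕ → ℝ) :
    ∃ w : ℕ → ℝ, w 0 = 0 ∧ ∀ n, 1 ≤ n → n ≤ N → discreteCaputo α t w n = κ * w n + f n := by
  induction N with
  | zero => exact ⟨0, rfl, fun n h1 h2 => by omega⟩
  | succ N ih =>
    obtain ⟨w, h0, hw⟩ := ih fun n h1 h2 => hκ n h1 (by omega)
    set S := ∑ k ∈ Finset.Icc 1 N, l1Kernel α t (N + 1) k • (w k - w (k - 1)) with hS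
    set a := l1Kernel α t (N + 1) (N + 1) with ha
    have hak : a - κ ≠ 0 := (sub_pos.2 (hκ (N + 1) (by omega) le_rfl)).ne'
    set x := (f (N + 1) + a * w N - S) / (a - κ) with hx
    set v : ℕ → ℝ := fun k => if k = N + 1 then x else w k with hv
    have hvw : ∀ k ≤ N, v k = w k := fun k hk => if_neg (by omega)
    refine ⟨v, by rw [hvw 0 (by omega), h0], ?_⟩
    intro n h1 hn
    rcases Nat.lt_or_ge N n with h2 | h2
    · obtain rfl : n = N + 1 := by omega
      have hvN : v (N + 1) = x := if_pos rfl
      have hsum : discreteCaputo α t v (N + 1) = S + a * (x - w N) := by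
        rw [discreteCaputo, Finset.sum_Icc_succ_top (by omega), Nat.add_sub_cancel, hvN,
          hvw N le_rfl, smul_eq_mul]
        congr 1
        refine Finset.sum_congr rfl fun k hk => ?_
        rw [Finset.mem_Icc] at hk
        rw [hvw k hk.2, hvw (k - 1) (by omega)]
      rw [hsum, hvN]
      have : x * (a - κ) = f (N + 1) + a * w N - S := by rw [hx, div_mul_cancel₀ _ hak]
      linarith
    · rw [discreteCaputo_congr α t (fun k hk => hvw k (by omega)), hw n h1 h2, hvw n h2]

end Kernel

/-! ### A discrete Grönwall inequality for constant sources -/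

section Gronwall

variable {α κ θ : ℝ} {N : ℕ} {t : ℕ → ℝ}

/-- The step restriction says that the diagonal kernels exceed `κ` by the factor `θ⁻¹`. -/
lemma div_le_l1Kernel_self (hα : α ∈ Ioo (0 : ℝ) 1) (hκ : 0 < κ) (ht : IsTimeMesh N t)
    (hstep : ∀ n, 1 ≤ n → n ≤ N → κ * Real.Gamma (2 - α) * timeStep t n ^ α ≤ θ)
    {n : ℕ} (h1 : 1 ≤ n) (hn : n ≤ N) : 0 < θ ∧ κ / θ ≤ timeStep t n ^ (-α) / Real.Gamma (2 - α) := by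
  have hG := gamma_two_sub_pos hα
  have hp : 0 < timeStep t n ^ α := Real.rpow_pos_of_pos (ht.step_pos n h1 hn) _
  have h := hstep n h1 hn
  have hθ : 0 < θ := lt_of_lt_of_le (by positivity) h
  refine ⟨hθ, ?_⟩
  rw [Real.rpow_neg (ht.step_pos n h1 hn).le, div_le_div_iff₀ hθ hG, inv_mul_eq_div,
    le_div_iff₀ hp]
  exact h

lemma lt_l1Kernel_self (hα : α ∈ Ioo (0 : ℝ) 1) (hκ : 0 < κ) (hθ : θ < 1) (ht : IsTimeMesh N t)
    (hstep : ∀ n, 1 ≤ n → n ≤ N → κ * Real.Gamma (2 - α) * timeStep t n ^ α ≤ θ)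
    {n : ℕ} (h1 : 1 ≤ n) (hn : n ≤ N) : κ < l1Kernel α t n n := by
  obtain ⟨hθ0, h⟩ := div_le_l1Kernel_self hα hκ ht hstep h1 hn
  rw [l1Kernel_self hα.2 t n (ht.step_pos n h1 hn)]
  refine lt_of_lt_of_le ?_ h
  rw [lt_div_iff₀ hθ0]
  nlinarith

/-- If `t_n` exceeds `t_k` by at most a small `η`, then the kernel at `k` is still larger than `κ` by
a fixed factor `lam < θ⁻¹`: either the step `τ_k` is comparable with `η`, and the kernel is huge, or
it is much longer than `η`, and the kernel is close to the diagonal one. -/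
lemma exists_mul_le_l1Kernel (hα : α ∈ Ioo (0 : ℝ) 1) (hκ : 0 < κ) (hθ0 : 0 < θ) {lam : ℝ}
    (hlam0 : 0 < lam) (hlam : lam * θ < 1) :
    ∃ η > 0, ∀ (N : ℕ) (t : ℕ → ℝ), IsTimeMesh N t →
      (∀ n, 1 ≤ n → n ≤ N → κ * Real.Gamma (2 - α) * timeStep t n ^ α ≤ θ) →
      ∀ n k, 1 ≤ k → k ≤ n → n ≤ N → t n - t k ≤ η → κ * lam ≤ l1Kernel α t n k := by
  have hG := gamma_two_sub_pos hα
  have hG1 := gamma_one_sub_pos hα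
  have h1α : 0 < 1 - α := by linarith [hα.2]
  -- `B ^ (1 - α) = (1 - lam θ)⁻¹`
  set B : ℝ := (1 - lam * θ)⁻¹ ^ (1 - α)⁻¹ with hB
  have hb : 0 < 1 - lam * θ := by linarith
  have hB0 : 0 < B := Real.rpow_pos_of_pos (inv_pos.2 hb) _
  have hB1 : B ^ (1 - α) = (1 - lam * θ)⁻¹ := by
    rw [hB, ← Real.rpow_mul (inv_pos.2 hb).le, inv_mul_cancel₀ h1α.ne', Real.rpow_one]
  -- `((1 + B) η) ^ (-α) = κ lam Γ(1 - α)`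
  have hD : 0 < κ * lam * Real.Gamma (1 - α) := by positivity
  set x0 : ℝ := (κ * lam * Real.Gamma (1 - α)) ^ (-α)⁻¹ with hx0
  have hx0p : 0 < x0 := Real.rpow_pos_of_pos hD _
  have hx0e : x0 ^ (-α) = κ * lam * Real.Gamma (1 - α) := by
    rw [hx0, ← Real.rpow_mul hD.le, inv_mul_cancel₀ (neg_ne_zero.2 hα.1.ne'), Real.rpow_one]
  refine ⟨x0 / (1 + B), by positivity, ?_⟩
  intro N t ht hstep n k hk hkn hn hη
  have hτ := ht.step_pos k hk (hkn.trans hn)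
  have hx : 0 ≤ t n - t k := sub_nonneg.2 (ht.le_of_le hkn hn)
  have hsplit : t n - t (k - 1) = (t n - t k) + timeStep t k := by rw [timeStep]; ring
  rcases le_total (timeStep t k) (B * (x0 / (1 + B))) with h | h
  · refine le_trans ?_ (l1Kernel_ge hα ht hk hkn hn)
    rw [le_div_iff₀ hG1, ← hx0e]
    refine Real.rpow_le_rpow_of_nonpos (by linarith) ?_ (by linarith [hα.1])
    have : x0 / (1 + B) + B * (x0 / (1 + B)) = x0 := by field_simp
    linarith
  · obtain ⟨-, hd⟩ := div_le_l1Kernel_self hα hκ ht hstep hk (hkn.trans hn)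
    have hBx : B * (t n - t k) ≤ timeStep t k := le_trans (by gcongr) h
    have h2 : (t n - t k) ^ (1 - α) ≤ (1 - lam * θ) * timeStep t k ^ (1 - α) := by
      have := Real.rpow_le_rpow (by positivity) hBx h1α.le
      rw [Real.mul_rpow hB0.le hx, hB1, inv_mul_le_iff₀ hb] at this
      exact this
    have h3 : timeStep t k ^ (1 - α) ≤ (t n - t (k - 1)) ^ (1 - α) :=
      Real.rpow_le_rpow hτ.le (by linarith) h1α.le
    rw [l1Kernel_eq hα.2]
    calc κ * lam = (lam * θ) * (κ / θ) := by field_simp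
      _ ≤ (lam * θ) * (timeStep t k ^ (-α) / Real.Gamma (2 - α)) := by gcongr
      _ = (lam * θ) * timeStep t k ^ (1 - α) / timeStep t k / Real.Gamma (2 - α) := by
        rw [show 1 - α = -α + 1 by ring, Real.rpow_add_one hτ.ne']
        field_simp
      _ ≤ _ := by
        gcongr
        linarith

/-- Discrete Grönwall inequality. The barrier is `H^j = Lam ^ ⌈t_j / η⌉`, a step function in time:
at level `n`, the jump by which `H` reaches its present value is weighted by a kernel exceeding `κ`
by a fixed factor, and for large `Lam` this jump is almost `H^n`. -/
lemma gronwall_const (α κ θ T : ℝ) (hα : α ∈ Ioo (0 : ℝ) 1) (hκ : 0 < κ) (hθ : θ < 1) :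
    ∃ C > 0, ∀ (N : ℕ) (t : ℕ → ℝ), IsTimeMesh N t → t N ≤ T →
      (∀ n, 1 ≤ n → n ≤ N → κ * Real.Gamma (2 - α) * timeStep t n ^ α ≤ θ) →
      ∀ (z : ℕ → ℝ) (G : ℝ), 0 ≤ G → z 0 ≤ 0 →
      (∀ n, 1 ≤ n → n ≤ N → discreteCaputo α t z n ≤ κ * z n + G) → ∀ n ≤ N, z n ≤ C * G := by
  rcases le_or_gt θ 0 with hθ0 | hθ0
  · refine ⟨1, one_pos, fun N t ht _ hstep z G hG hz0 _ n hn => ?_⟩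
    have hN : N = 0 := by
      by_contra hN
      exact absurd (div_le_l1Kernel_self hα hκ ht hstep le_rfl (Nat.one_le_iff_ne_zero.2 hN)).1
        (not_lt.2 hθ0)
    obtain rfl : n = 0 := by omega
    linarith
  set lam : ℝ := (1 + θ⁻¹) / 2 with hlam
  have hθi : 1 < θ⁻¹ := (one_lt_inv₀ hθ0).2 hθ
  have hlam1 : 1 < lam := by rw [hlam]; linarith
  have hlamθ : lam * θ < 1 := by
    have : lam * θ = (θ + 1) / 2 := by rw [hlam]; field_simp
    rw [this]; linarith
  obtain ⟨η, hη, hker⟩ := exists_mul_le_l1Kernel hα hκ hθ0 (by linarith) hlamθ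
  set Lam : ℝ := 2 * lam / (lam - 1) with hLam
  have hLam1 : 1 < Lam := by rw [hLam, lt_div_iff₀ (by linarith)]; linarith
  have hμ : 0 < κ * ((lam - 1) / 2) := mul_pos hκ (by linarith)
  refine ⟨(κ * ((lam - 1) / 2))⁻¹ * Lam ^ ⌈T / η⌉₊, by positivity, ?_⟩
  intro N t ht htN hstep z G hG hz0 hz n hn
  set H : ℕ → ℝ := fun j => Lam ^ ⌈t j / η⌉₊ with hH
  have hH1 : ∀ j, 1 ≤ H j := fun j => one_le_pow₀ hLam1.le
  have hmono : ∀ k, 1 ≤ k → k ≤ N → H (k - 1) ≤ H k := by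
    intro k hk hkN
    refine pow_le_pow_right₀ hLam1.le (Nat.ceil_mono ?_)
    have := ht.le_of_le (Nat.sub_le k 1) hkN
    gcongr
  have hDH : ∀ n, 1 ≤ n → n ≤ N →
      κ * H n + κ * ((lam - 1) / 2) ≤ discreteCaputo α t H n := by
    intro n h1 hn
    have htn := ht.pos h1 hn
    obtain ⟨i, hi⟩ : ∃ i, ⌈t n / η⌉₊ = i + 1 :=
      Nat.exists_eq_succ_of_ne_zero (Nat.ceil_pos.2 (by positivity)).ne'
    have hlast : i * η < t n := by
      have : (i : ℝ) < t n / η := Nat.lt_ceil.1 (by omega)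
      rwa [lt_div_iff₀ hη] at this
    have hlast' : t n ≤ (i + 1) * η := by
      have : t n / η ≤ ((i + 1 : ℕ) : ℝ) := Nat.ceil_le.1 hi.le
      rw [div_le_iff₀ hη] at this
      exact_mod_cast this
    -- the first node of the current block of length `η`
    have hex : ∃ k, i * η < t k := ⟨n, hlast⟩
    classical
    set k := Nat.find hex with hkdef
    have hk : i * η < t k := Nat.find_spec hex
    have hkn : k ≤ n := Nat.find_min' hex hlast
    have hk1 : 1 ≤ k := by
      rcases Nat.eq_zero_or_pos k with h | h
      · rw [h, ht.start] at hk
        exact absurd hk (not_lt.2 (by positivity))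
      · exact h
    have hkpred : t (k - 1) ≤ i * η := not_lt.1 (Nat.find_min hex (show k - 1 < k by omega))
    have hHk : H n ≤ H k := by
      refine pow_le_pow_right₀ hLam1.le ?_
      rw [hi]
      exact Nat.lt_ceil.2 (by rwa [lt_div_iff₀ hη])
    have hHk1 : H (k - 1) ≤ Lam⁻¹ * H n := by
      have h1 : H n = Lam ^ (i + 1) := by simp only [hH, hi]
      rw [h1, pow_succ, mul_comm (Lam ^ i), inv_mul_cancel_left₀ (by linarith)]
      refine pow_le_pow_right₀ hLam1.le (Nat.ceil_le.2 ?_)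
      rwa [div_le_iff₀ hη]
    have ha := hker N t ht hstep n k hk1 hkn hn (by linarith)
    have hsum : l1Kernel α t n k * (H k - H (k - 1)) ≤ discreteCaputo α t H n := by
      refine Finset.single_le_sum (f := fun k => l1Kernel α t n k • (H k - H (k - 1)))
        (fun j hj => ?_) (Finset.mem_Icc.2 ⟨hk1, hkn⟩)
      rw [Finset.mem_Icc] at hj
      exact mul_nonneg (l1Kernel_pos hα ht hj.1 hj.2 hn).le
        (sub_nonneg.2 (hmono j hj.1 (hj.2.trans hn)))
    have hcoef : lam * (1 - Lam⁻¹) = (lam + 1) / 2 := by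
      rw [hLam]
      have : lam - 1 ≠ 0 := by linarith
      field_simp
      ring
    have hjump : (1 - Lam⁻¹) * H n ≤ H k - H (k - 1) := by linarith
    have hj0 : 0 ≤ (1 - Lam⁻¹) * H n :=
      mul_nonneg (by have := inv_lt_one_of_one_lt₀ hLam1; linarith) (by linarith [hH1 n])
    calc κ * H n + κ * ((lam - 1) / 2) ≤ κ * H n + κ * ((lam - 1) / 2) * H n := by
          nlinarith [hH1 n]
      _ = κ * (lam * (1 - Lam⁻¹)) * H n := by rw [hcoef]; ring
      _ = κ * lam * ((1 - Lam⁻¹) * H n) := by ring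
      _ ≤ l1Kernel α t n k * (H k - H (k - 1)) := by
          refine mul_le_mul ha hjump hj0 (l1Kernel_pos hα ht hk1 hkn hn).le
      _ ≤ _ := hsum
  have hcmp := nonpos_of_discreteCaputo_le hα ht
    (fun n h1 hn => lt_l1Kernel_self hα hκ hθ ht hstep h1 hn)
    (z := fun j => z j - (κ * ((lam - 1) / 2))⁻¹ * G * H j)
    (by have : 0 ≤ (κ * ((lam - 1) / 2))⁻¹ * G * H 0 := by have := hH1 0; positivity
        linarith)
    (by
      intro n h1 hn
      rw [discreteCaputo_sub, discreteCaputo_const_mul]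
      have h3 := mul_le_mul_of_nonneg_left (hDH n h1 hn)
        (show 0 ≤ (κ * ((lam - 1) / 2))⁻¹ * G by positivity)
      have h4 : (κ * ((lam - 1) / 2))⁻¹ * G * (κ * ((lam - 1) / 2)) = G := by
        rw [mul_right_comm, inv_mul_cancel₀ hμ.ne', one_mul]
      have h5 := hz n h1 hn
      rw [mul_add, h4] at h3
      linarith) n hn
  have hHn : H n ≤ Lam ^ ⌈T / η⌉₊ := by
    refine pow_le_pow_right₀ hLam1.le (Nat.ceil_mono ?_)
    have := (ht.le_of_le hn le_rfl).trans htN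
    gcongr
  have h6 : (κ * ((lam - 1) / 2))⁻¹ * G * H n ≤ (κ * ((lam - 1) / 2))⁻¹ * G * Lam ^ ⌈T / η⌉₊ := by
    gcongr
  linarith

/-- The grid function that jumps to a constant after the initial time is a supersolution for a
constant source. -/
lemma exists_const_barrier (hα : α ∈ Ioo (0 : ℝ) 1) (ht : IsTimeMesh N t) {n : ℕ} (h1 : 1 ≤ n)
    (hn : n ≤ N) {G : ℝ} (hG : 0 ≤ G) :
    ∃ y : ℕ → ℝ, y 0 = 0 ∧ (∀ j, y j ≤ Real.Gamma (1 - α) * t n ^ α * G) ∧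
      ∀ j, 1 ≤ j → j ≤ n → G ≤ discreteCaputo α t y j := by
  have hG1 := gamma_one_sub_pos hα
  have htn := ht.pos h1 hn
  set Y : ℝ := Real.Gamma (1 - α) * t n ^ α * G with hY
  have hY0 : 0 ≤ Y := by positivity
  refine ⟨fun j => if j = 0 then 0 else Y, rfl, fun j => by dsimp only; split_ifs <;> linarith, ?_⟩
  intro j hj hjn
  have e : discreteCaputo α t (fun j => if j = 0 then 0 else Y) j = l1Kernel α t j 1 * Y := by
    rw [discreteCaputo, Finset.sum_eq_single 1]
    · simp
    · intro b hb hb1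
      rw [Finset.mem_Icc] at hb
      simp [show b ≠ 0 by omega, show b - 1 ≠ 0 by omega]
    · intro h; exact absurd (Finset.mem_Icc.2 ⟨le_rfl, hj⟩) h
  rw [e]
  have h2 := l1Kernel_ge hα ht le_rfl hj (hjn.trans hn)
  rw [Nat.sub_self, ht.start, sub_zero] at h2
  have htj := ht.pos hj (hjn.trans hn)
  have h3 : t n ^ (-α) ≤ t j ^ (-α) :=
    Real.rpow_le_rpow_of_nonpos htj (ht.le_of_le hjn hn) (by linarith [hα.1])
  have h4 : t n ^ (-α) / Real.Gamma (1 - α) ≤ l1Kernel α t j 1 := le_trans (by gcongr) h2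
  refine le_trans ?_ (mul_le_mul_of_nonneg_right h4 hY0)
  have h5 : t n ^ (-α) * t n ^ α = 1 := by
    rw [← Real.rpow_add htn]; simp
  have h6 : t n ^ (-α) / Real.Gamma (1 - α) * Y = (t n ^ (-α) * t n ^ α) * G := by
    rw [hY]; field_simp
  rw [h6, h5, one_mul]

/-- A constant source `G` up to level `n` produces at most `C t_n^α G`. -/
lemma le_of_const_source (α κ θ T : ℝ) (hα : α ∈ Ioo (0 : ℝ) 1) (hκ : 0 < κ) (hθ : θ < 1) :
    ∃ C > 0, ∀ (N : ℕ) (t : ℕ → ℝ), IsTimeMesh N t → t N ≤ T →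
      (∀ n, 1 ≤ n → n ≤ N → κ * Real.Gamma (2 - α) * timeStep t n ^ α ≤ θ) →
      ∀ n, 1 ≤ n → n ≤ N → ∀ (z : ℕ → ℝ) (G : ℝ), 0 ≤ G → z 0 ≤ 0 →
      (∀ j, 1 ≤ j → j ≤ n → discreteCaputo α t z j ≤ κ * z j + G) → z n ≤ C * (t n ^ α * G) := by
  obtain ⟨C, hC, hgr⟩ := gronwall_const α κ θ T hα hκ hθ
  have hG1 := gamma_one_sub_pos hα
  refine ⟨Real.Gamma (1 - α) + C * (κ * Real.Gamma (1 - α)), by positivity, ?_⟩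
  intro N t ht htN hstep n h1 hn z G hG hz0 hz
  have htn := ht.pos h1 hn
  obtain ⟨y, hy0, hyY, hDy⟩ := exists_const_barrier hα ht h1 hn hG
  have := hgr n t (ht.mono hn) ((ht.le_of_le hn le_rfl).trans htN)
    (fun j h1 h2 => hstep j h1 (h2.trans hn)) (fun j => z j - y j)
    (κ * (Real.Gamma (1 - α) * t n ^ α * G)) (by positivity)
    (by simpa [hy0] using hz0)
    (fun j hj hjn => by
      rw [discreteCaputo_sub]
      have h2 := hz j hj hjn
      have h3 := hDy j hj hjn
      have h4 := mul_le_mul_of_nonneg_left (hyY j) hκ.le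
      linarith) n le_rfl
  have h2 := hyY n
  linarith

end Gronwall

/-! ### Quadrature error of the L1 scheme on one interval -/

section Interval

variable {X : Type*} [NormedAddCommGroup X]

lemma intervalIntegrable_of_norm_le_Ioo {f : ℝ → X} {g : ℝ → ℝ} {a b : ℝ} (hab : a ≤ b)
    (hf : ContinuousOn f (Ioo a b)) (hg : IntervalIntegrable g volume a b)
    (hfg : ∀ s ∈ Ioo a b, ‖f s‖ ≤ g s) : IntervalIntegrable f volume a b := by
  rw [intervalIntegrable_iff_integrableOn_Ioo_of_le hab] at hg ⊢
  exact hg.mono' (hf.aestronglyMeasurable measurableSet_Ioo)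
    ((ae_restrict_mem measurableSet_Ioo).mono hfg)

variable [NormedSpace ℝ X]

lemma norm_integral_le_of_norm_le_Ioo {f : ℝ → X} {g : ℝ → ℝ} {a b : ℝ} (hab : a ≤ b)
    (hg : IntervalIntegrable g volume a b) (hfg : ∀ s ∈ Ioo a b, ‖f s‖ ≤ g s) :
    ‖∫ s in a..b, f s‖ ≤ ∫ s in a..b, g s := by
  refine intervalIntegral.norm_integral_le_of_norm_le hab ?_ hg
  have : ∀ᵐ s : ℝ, s ≠ b := by simp [ae_iff, measure_singleton]
  filter_upwards [this] with s hs hs2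
  exact hfg s ⟨hs2.1, lt_of_le_of_ne hs2.2 hs⟩

lemma intervalIntegrable_rpow_smul {f : ℝ → X} {α x a b M : ℝ} (hα : α < 1)
    (hab : a ≤ b) (hb : b ≤ x) (hc : ContinuousOn f (Ioo a b)) (hM : ∀ s ∈ Ioo a b, ‖f s‖ ≤ M) :
    IntervalIntegrable (fun s => (x - s) ^ (-α) • f s) volume a b := by
  have hwc : ContinuousOn (fun s => (x - s) ^ (-α)) (Ioo a b) :=
    ContinuousOn.rpow_const (by fun_prop) fun s hs => Or.inl (by linarith [hs.2])
  refine intervalIntegrable_of_norm_le_Ioo hab (hwc.smul hc)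
    (g := fun s => (x - s) ^ (-α) * M) ((intervalIntegrable_sub_rpow_neg hα x a b).mul_const M)
    fun s hs => ?_
  have hw0 : 0 ≤ (x - s) ^ (-α) := Real.rpow_nonneg (by linarith [hs.2]) _
  rw [norm_smul, Real.norm_of_nonneg hw0]
  exact mul_le_mul_of_nonneg_left (hM s hs) hw0

variable [CompleteSpace X]

lemma integral_deriv_eq_sub_Ioo {u : ℝ → X} {a b : ℝ} (hab : a ≤ b)
    (hu : ContinuousOn u (Icc a b)) (hd : DifferentiableOn ℝ u (Ioo a b))
    (hi : IntervalIntegrable (deriv u) volume a b) :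
    ∫ s in a..b, deriv u s = u b - u a :=
  intervalIntegral.integral_eq_sub_of_hasDerivAt_of_le hab hu
    (fun s hs => ((hd s hs).differentiableAt (Ioo_mem_nhds hs.1 hs.2)).hasDerivAt) hi

/-- The quadrature error on an interval does not see the constant parts of the weight and of `u'`. -/
lemma average_smul_sub_integral {u : ℝ → X} {w : ℝ → ℝ} {a b : ℝ} (hab : a < b) (w₀ : ℝ)
    (hu : ContinuousOn u (Icc a b)) (hd : DifferentiableOn ℝ u (Ioo a b))
    (hi : IntervalIntegrable (deriv u) volume a b) (hw : IntervalIntegrable w volume a b)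
    (hwi : IntervalIntegrable (fun s => w s • deriv u s) volume a b) :
    ((∫ s in a..b, w s) / (b - a)) • (u b - u a) - ∫ s in a..b, w s • deriv u s
      = ∫ s in a..b, (w s - w₀) • ((b - a)⁻¹ • (u b - u a) - deriv u s) := by
  have hftc := integral_deriv_eq_sub_Ioo hab.le hu hd hi
  set d := (b - a)⁻¹ • (u b - u a) with hdd
  have e : ∀ s, (w s - w₀) • (d - deriv u s)
      = ((w s • d - w₀ • d) - (w s • deriv u s - w₀ • deriv u s)) := by
    intro s; rw [smul_sub, sub_smul, sub_smul]
  simp only [e]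
  have h1 : IntervalIntegrable (fun s => w s • d) volume a b :=
    ⟨hw.1.smul_const d, hw.2.smul_const d⟩
  have h2 : IntervalIntegrable (fun _ : ℝ => w₀ • d) volume a b := by simp
  have h3 : IntervalIntegrable (fun s => w₀ • deriv u s) volume a b := hi.smul w₀
  rw [intervalIntegral.integral_sub (h1.sub h2) (hwi.sub h3), intervalIntegral.integral_sub h1 h2,
    intervalIntegral.integral_sub hwi h3, intervalIntegral.integral_smul_const,
    intervalIntegral.integral_const, intervalIntegral.integral_smul, hftc]
  have hba : b - a ≠ 0 := (sub_pos.2 hab).ne'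
  have h4 : (b - a) • w₀ • d = w₀ • (u b - u a) := by
    rw [hdd, smul_comm (b - a) w₀, smul_inv_smul₀ hba]
  have h5 : ((∫ s in a..b, w s) / (b - a)) • (u b - u a) = (∫ s in a..b, w s) • d := by
    rw [hdd, smul_smul, div_eq_mul_inv]
  rw [h4, h5]
  abel

/-- If `‖u''‖ ≤ B` on the interval, then `u'` is within `B (b - a)` of its mean value. -/
lemma norm_average_smul_sub_integral_le {u : ℝ → X} {α x a b B : ℝ}
    (hα : α ∈ Ioo (0 : ℝ) 1) (hab : a < b) (hb : b ≤ x)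
    (hu : ContinuousOn u (Icc a b)) (hd : DifferentiableOn ℝ u (Ioo a b))
    (hd2 : DifferentiableOn ℝ (deriv u) (Ioo a b))
    (hB : ∀ s ∈ Ioo a b, ‖deriv (deriv u) s‖ ≤ B) :
    IntervalIntegrable (fun s => (x - s) ^ (-α) • deriv u s) volume a b ∧
    ‖((∫ s in a..b, (x - s) ^ (-α)) / (b - a)) • (u b - u a)
        - ∫ s in a..b, (x - s) ^ (-α) • deriv u s‖
      ≤ B * (b - a) * ((∫ s in a..b, (x - s) ^ (-α)) - (b - a) * (x - a) ^ (-α)) := by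
  have hw := intervalIntegrable_sub_rpow_neg hα.2 x a b
  have hba : 0 < b - a := sub_pos.2 hab
  have hmid : (a + b) / 2 ∈ Ioo a b := ⟨by linarith, by linarith⟩
  have hB0 : 0 ≤ B := (norm_nonneg _).trans (hB _ hmid)
  have hc := hd2.continuousOn
  have hR : ∀ s ∈ Ioo a b, ∀ s' ∈ Ioo a b, ‖deriv u s - deriv u s'‖ ≤ B * (b - a) := by
    intro s hs s' hs'
    refine (Convex.norm_image_sub_le_of_norm_deriv_le (s := Ioo a b) (fun y hy =>
      (hd2 y hy).differentiableAt (Ioo_mem_nhds hy.1 hy.2)) hB (convex_Ioo a b) hs' hs).trans ?_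
    gcongr
    rw [Real.norm_eq_abs, abs_le]
    constructor <;> linarith [hs.1, hs.2, hs'.1, hs'.2]
  set M := ‖deriv u ((a + b) / 2)‖ + B * (b - a) with hM
  have hbd : ∀ s ∈ Ioo a b, ‖deriv u s‖ ≤ M := fun s hs => by
    have h1 := hR s hs _ hmid
    have h2 := norm_sub_norm_le (deriv u s) (deriv u ((a + b) / 2))
    linarith
  have hi : IntervalIntegrable (deriv u) volume a b :=
    intervalIntegrable_of_norm_le_Ioo hab.le hc (g := fun _ => M) (by simp) hbd
  have hwi := intervalIntegrable_rpow_smul hα.2 hab.le hb hc hbd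
  refine ⟨hwi, ?_⟩
  rw [average_smul_sub_integral hab ((x - a) ^ (-α)) hu hd hi hw hwi]
  have hmean : ∀ s ∈ Ioo a b, ‖(b - a)⁻¹ • (u b - u a) - deriv u s‖ ≤ B * (b - a) := by
    intro s hs
    have h1 : (b - a)⁻¹ • (u b - u a) - deriv u s
        = (b - a)⁻¹ • ∫ s' in a..b, (deriv u s' - deriv u s) := by
      rw [intervalIntegral.integral_sub hi (by simp), integral_deriv_eq_sub_Ioo hab.le hu hd hi,
        intervalIntegral.integral_const, smul_sub _ (u b - u a), inv_smul_smul₀ hba.ne']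
    rw [h1, norm_smul, Real.norm_of_nonneg (inv_nonneg.2 hba.le), inv_mul_le_iff₀ hba]
    have h2 := norm_integral_le_of_norm_le_Ioo hab.le (g := fun _ => B * (b - a)) (by simp)
      (fun s' hs' => hR s' hs' s hs)
    rwa [intervalIntegral.integral_const, smul_eq_mul] at h2
  have hw1 : IntervalIntegrable (fun s => (x - s) ^ (-α) - (x - a) ^ (-α)) volume a b :=
    hw.sub (by simp)
  refine (norm_integral_le_of_norm_le_Ioo hab.le
    (g := fun s => B * (b - a) * ((x - s) ^ (-α) - (x - a) ^ (-α))) (hw1.const_mul _) ?_).trans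
    (le_of_eq ?_)
  · intro s hs
    have hpos : 0 ≤ (x - s) ^ (-α) - (x - a) ^ (-α) :=
      sub_nonneg.2 (sub_rpow_neg_mono hα.1.le hs.1.le (by linarith [hs.2]))
    rw [norm_smul, Real.norm_of_nonneg hpos, mul_comm]
    exact mul_le_mul_of_nonneg_right (hmean s hs) hpos
  · rw [intervalIntegral.integral_const_mul, intervalIntegral.integral_sub hw (by simp),
      intervalIntegral.integral_const, smul_eq_mul]

/-- The variant for the first interval, where `u'` is only integrable. -/
lemma norm_average_smul_sub_integral_le_of_integrable {u : ℝ → X} {α x a b J : ℝ} {g : ℝ → ℝ}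
    (hα : α ∈ Ioo (0 : ℝ) 1) (hab : a < b) (hb : b < x)
    (hu : ContinuousOn u (Icc a b)) (hd : DifferentiableOn ℝ u (Ioo a b))
    (hc : ContinuousOn (deriv u) (Ioo a b)) (hg : IntervalIntegrable g volume a b)
    (hug : ∀ s ∈ Ioo a b, ‖deriv u s‖ ≤ g s) (hJ : ∫ s in a..b, g s ≤ J) :
    ‖((∫ s in a..b, (x - s) ^ (-α)) / (b - a)) • (u b - u a)
        - ∫ s in a..b, (x - s) ^ (-α) • deriv u s‖
      ≤ 2 * J * ((x - b) ^ (-α) - (x - a) ^ (-α)) := by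
  have hw := intervalIntegrable_sub_rpow_neg hα.2 x a b
  have hi : IntervalIntegrable (deriv u) volume a b :=
    intervalIntegrable_of_norm_le_Ioo hab.le hc hg hug
  have hwc : ContinuousOn (fun s => (x - s) ^ (-α)) (Ioo a b) :=
    ContinuousOn.rpow_const (by fun_prop) fun s hs => Or.inl (by linarith [hs.2])
  have hw0 : ∀ s ∈ Ioo a b, 0 ≤ (x - s) ^ (-α) := fun s hs =>
    Real.rpow_nonneg (by linarith [hs.2]) _
  have hwb : ∀ s ∈ Ioo a b, (x - s) ^ (-α) ≤ (x - b) ^ (-α) := fun s hs =>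
    sub_rpow_neg_mono hα.1.le hs.2.le hb
  have hwi : IntervalIntegrable (fun s => (x - s) ^ (-α) • deriv u s) volume a b := by
    refine intervalIntegrable_of_norm_le_Ioo hab.le (hwc.smul hc)
      (g := fun s => (x - b) ^ (-α) * g s) (hg.const_mul _) fun s hs => ?_
    rw [norm_smul, Real.norm_of_nonneg (hw0 s hs)]
    exact mul_le_mul (hwb s hs) (hug s hs) (norm_nonneg _) ((hw0 s hs).trans (hwb s hs))
  rw [average_smul_sub_integral hab ((x - a) ^ (-α)) hu hd hi hw hwi]
  have hba : 0 < b - a := sub_pos.2 hab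
  set d := ‖(b - a)⁻¹ • (u b - u a)‖ with hdd
  have hdJ : d * (b - a) ≤ J := by
    rw [hdd, norm_smul, Real.norm_of_nonneg (inv_nonneg.2 hba.le), mul_comm,
      mul_inv_cancel_left₀ hba.ne', ← integral_deriv_eq_sub_Ioo hab.le hu hd hi]
    exact (norm_integral_le_of_norm_le_Ioo hab.le hg hug).trans hJ
  have hpos : 0 ≤ (x - b) ^ (-α) - (x - a) ^ (-α) :=
    sub_nonneg.2 (sub_rpow_neg_mono hα.1.le hab.le hb)
  refine (norm_integral_le_of_norm_le_Ioo hab.le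
    (g := fun s => ((x - b) ^ (-α) - (x - a) ^ (-α)) * (d + g s))
    (IntervalIntegrable.const_mul (IntervalIntegrable.add (by simp) hg) _) ?_).trans ?_
  · intro s hs
    have h1 : 0 ≤ (x - s) ^ (-α) - (x - a) ^ (-α) :=
      sub_nonneg.2 (sub_rpow_neg_mono hα.1.le hs.1.le (by linarith [hs.2]))
    rw [norm_smul, Real.norm_of_nonneg h1]
    refine mul_le_mul (by linarith [hwb s hs]) ?_ (norm_nonneg _) hpos
    exact (norm_sub_le _ _).trans (by linarith [hug s hs])
  · rw [intervalIntegral.integral_const_mul, intervalIntegral.integral_add (by simp) hg,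
      intervalIntegral.integral_const, smul_eq_mul]
    have : (b - a) * d + ∫ s in a..b, g s ≤ 2 * J := by linarith
    nlinarith

end Interval

/-! ### Geometry of graded meshes -/

lemma rpow_le_mul_rpow {x y D : ℝ} (e : ℝ) (hx : 0 < x) (hxy : x ≤ D * y) (hyx : y ≤ D * x)
    (hD : 1 ≤ D) (hy : 0 < y) : x ^ e ≤ D ^ |e| * y ^ e := by
  have hD0 : 0 < D := by linarith
  rcases le_total 0 e with he | he
  · rw [abs_of_nonneg he, ← Real.mul_rpow hD0.le hy.le]
    exact Real.rpow_le_rpow hx.le hxy he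
  · rw [abs_of_nonpos he, Real.rpow_neg hD0.le, ← Real.inv_rpow hD0.le,
      ← Real.mul_rpow (inv_pos.2 hD0).le hy.le]
    refine Real.rpow_le_rpow_of_nonpos (by positivity) ?_ he
    rw [inv_mul_le_iff₀ hD0]
    exact hyx

/-- The bounds `t_k ∼ τ k^r` and `τ_k ∼ τ k^(r-1)` of a graded mesh with smallest scale `τ`, up to
a factor `c`, without reference to the final time. -/
structure HasGrading (r c τ : ℝ) (N : ℕ) (t : ℕ → ℝ) : Prop where
  one_le : 1 ≤ c
  scale_pos : 0 < τ
  start : t 0 = 0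
  node_lower : ∀ k, 1 ≤ k → k ≤ N → τ * (k : ℝ) ^ r ≤ c * t k
  node_upper : ∀ k, 1 ≤ k → k ≤ N → t k ≤ c * (τ * (k : ℝ) ^ r)
  step_lower : ∀ k, 1 ≤ k → k ≤ N → τ * (k : ℝ) ^ (r - 1) ≤ c * timeStep t k
  step_upper : ∀ k, 1 ≤ k → k ≤ N → timeStep t k ≤ c * (τ * (k : ℝ) ^ (r - 1))

lemma IsQuasiGradedMesh.hasGrading {T r c : ℝ} {N : ℕ} {t : ℕ → ℝ} (hT : 0 < T) (hN : 1 ≤ N)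
    (h : IsQuasiGradedMesh T r c N t) : HasGrading r c (gradedScale T r N) N t := by
  have hN0 : (0 : ℝ) < N := by exact_mod_cast hN
  have hc : 1 ≤ c := by
    have h1 := h.node_upper N hN le_rfl
    rw [h.final, div_self hN0.ne', Real.one_rpow, mul_one] at h1
    exact le_of_mul_le_mul_right (by linarith) hT
  have hc0 : 0 < c := by linarith
  have e : ∀ k : ℕ, T * ((k : ℝ) / N) ^ r = gradedScale T r N * (k : ℝ) ^ r := fun k => by
    rw [gradedScale, Real.div_rpow k.cast_nonneg N.cast_nonneg]; ring
  refine ⟨hc, div_pos hT (Real.rpow_pos_of_pos hN0 _), h.start, ?_, ?_, ?_, h.step_upper⟩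
  · intro k h1 h2
    have := h.node_lower k h1 h2
    rwa [e, inv_mul_le_iff₀ hc0] at this
  · intro k h1 h2
    have := h.node_upper k h1 h2
    rwa [e] at this
  · intro k h1 h2
    have := h.step_lower k h1 h2
    rwa [inv_mul_le_iff₀ hc0] at this

namespace HasGrading

variable {r c τ : ℝ} {N : ℕ} {t : ℕ → ℝ}

lemma isTimeMesh (h : HasGrading r c τ N t) : IsTimeMesh N t := by
  refine ⟨h.start, fun k h1 h2 => ?_⟩
  have hk : (0 : ℝ) < k := by exact_mod_cast h1
  have h3 := h.step_lower k h1 h2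
  have h4 : 0 < τ * (k : ℝ) ^ (r - 1) := mul_pos h.scale_pos (Real.rpow_pos_of_pos hk _)
  have hc : 0 < c := by linarith [h.one_le]
  exact (mul_pos_iff_of_pos_left hc).1 (h4.trans_le h3)

lemma step_le (h : HasGrading r c τ N t) {k : ℕ} (h1 : 1 ≤ k) (h2 : k ≤ N) :
    timeStep t k ≤ c ^ 2 * (t k / k) := by
  have hk : (0 : ℝ) < k := by exact_mod_cast h1
  have hc : 0 < c := by linarith [h.one_le]
  have h3 := h.step_upper k h1 h2
  have h4 := h.node_lower k h1 h2
  rw [Real.rpow_sub_one hk.ne'] at h3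
  calc timeStep t k ≤ c * (τ * (k ^ r / k)) := h3
    _ = c * (τ * k ^ r) / k := by ring
    _ ≤ c * (c * t k) / k := by gcongr
    _ = _ := by ring

lemma le_step (h : HasGrading r c τ N t) {k : ℕ} (h1 : 1 ≤ k) (h2 : k ≤ N) :
    t k / k ≤ c ^ 2 * timeStep t k := by
  have hk : (0 : ℝ) < k := by exact_mod_cast h1
  have hc : 0 < c := by linarith [h.one_le]
  have h3 := h.step_lower k h1 h2
  have h4 := h.node_upper k h1 h2
  rw [Real.rpow_sub_one hk.ne'] at h3
  calc t k / k ≤ c * (τ * k ^ r) / k := by gcongr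
    _ = c * (τ * (k ^ r / k)) := by ring
    _ ≤ c * (c * timeStep t k) := by gcongr
    _ = _ := by ring

lemma node_ratio (h : HasGrading r c τ N t) {j k : ℕ} (hj : 1 ≤ j) (hjN : j ≤ N) (hk : 1 ≤ k)
    (hkN : k ≤ N) : t k ≤ c ^ 2 * ((k : ℝ) / j) ^ r * t j := by
  have hj0 : (0 : ℝ) < j := by exact_mod_cast hj
  have hc : 0 < c := by linarith [h.one_le]
  have h3 := h.node_lower j hj hjN
  have h4 := h.node_upper k hk hkN
  have h5 : (0 : ℝ) < (j : ℝ) ^ r := Real.rpow_pos_of_pos hj0 _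
  rw [Real.div_rpow k.cast_nonneg j.cast_nonneg]
  calc t k ≤ c * (τ * k ^ r) := h4
    _ = c * (k ^ r / j ^ r) * (τ * j ^ r) := by field_simp
    _ ≤ c * (k ^ r / j ^ r) * (c * t j) := by gcongr
    _ = _ := by ring

lemma node_le_of_le_two_mul (h : HasGrading r c τ N t) (hr : 0 < r) {j k : ℕ} (hj : 1 ≤ j)
    (hjN : j ≤ N) (hk : 1 ≤ k) (hkN : k ≤ N) (hkj : k ≤ 2 * j) : t k ≤ c ^ 2 * 2 ^ r * t j := by
  have hj0 : (0 : ℝ) < j := by exact_mod_cast hj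
  have hkj' : (k : ℝ) ≤ 2 * j := by exact_mod_cast hkj
  have htj := h.isTimeMesh.pos hj hjN
  have h1 : ((k : ℝ) / j) ^ r ≤ 2 ^ r :=
    Real.rpow_le_rpow (by positivity) ((div_le_iff₀ hj0).2 hkj') hr.le
  refine (h.node_ratio hj hjN hk hkN).trans ?_
  gcongr

lemma one_le_const (h : HasGrading r c τ N t) (hr : 0 < r) : 1 ≤ c ^ 2 * 2 ^ r :=
  one_le_mul_of_one_le_of_one_le (one_le_pow₀ h.one_le)
    (Real.one_le_rpow (by norm_num) hr.le)

/-- A node in the first half of the index range stays away from `t_n`, in proportion to `t_n`: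
each of the at least `n / 2` later steps has length at least a multiple of `τ n^(r-1)`. -/
lemma node_le_sub (h : HasGrading r c τ N t) (hr : 0 < r) {k n : ℕ} (hkn : 2 * k ≤ n)
    (hn1 : 1 ≤ n) (hn : n ≤ N) : t n ≤ c ^ 2 * 2 ^ (r + 1) * (t n - t k) := by
  have hc : 0 < c := by linarith [h.one_le]
  have hτ := h.scale_pos
  have hn0 : (0 : ℝ) < n := by exact_mod_cast hn1
  set s : ℝ := (2 ^ r)⁻¹ * (n : ℝ) ^ (r - 1) with hs
  have hs0 : 0 < s := by positivity
  have hstep : ∀ j, n ≤ 2 * j → j ≤ n → s ≤ (j : ℝ) ^ (r - 1) := by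
    intro j hj hjn
    have hj0 : (0 : ℝ) < j := by exact_mod_cast (show 0 < j by omega)
    have hj' : (n : ℝ) ≤ 2 * j := by exact_mod_cast hj
    have hjn' : (j : ℝ) ≤ n := by exact_mod_cast hjn
    have h2r : (1 : ℝ) ≤ 2 ^ r := Real.one_le_rpow (by norm_num) hr.le
    rcases le_total 0 (r - 1) with h1 | h1
    · have h3 : (n : ℝ) ^ (r - 1) ≤ (2 * j) ^ (r - 1) := Real.rpow_le_rpow hn0.le hj' h1
      rw [Real.mul_rpow (by norm_num) hj0.le] at h3
      have h4 : (2 : ℝ) ^ (r - 1) ≤ 2 ^ r :=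
        Real.rpow_le_rpow_of_exponent_le (by norm_num) (by linarith)
      rw [hs, inv_mul_le_iff₀ (by positivity)]
      refine h3.trans ?_
      gcongr
    · have h3 : (n : ℝ) ^ (r - 1) ≤ (j : ℝ) ^ (r - 1) :=
        Real.rpow_le_rpow_of_nonpos hj0 hjn' h1
      refine le_trans ?_ h3
      rw [hs]
      exact mul_le_of_le_one_left (by positivity) (inv_le_one_of_one_le₀ h2r)
  have hsum : ∀ d : ℕ, k + d ≤ n →
      c⁻¹ * τ * s * (2 * (k + d : ℝ) - n) / 2 ≤ t (k + d) - t k := by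
    have h2 : 0 ≤ c⁻¹ * τ * s := by positivity
    intro d hd
    induction d with
    | zero =>
      have h1 : (2 * (k + (0 : ℕ) : ℝ) - n) ≤ 0 := by
        have : (2 * k : ℝ) ≤ n := by exact_mod_cast hkn
        push_cast; linarith
      rw [Nat.add_zero, sub_self]
      have := mul_nonpos_of_nonneg_of_nonpos h2 h1
      linarith
    | succ d ih =>
      have ih' := ih (by omega)
      rcases le_or_gt n (2 * (k + d + 1)) with h1 | h1
      · have h2 := hstep (k + d + 1) h1 (by omega)
        have h3 := h.step_lower (k + d + 1) (by omega) (by omega)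
        rw [timeStep, Nat.add_sub_cancel] at h3
        have h4 : c⁻¹ * τ * s ≤ t (k + d + 1) - t (k + d) := by
          rw [mul_assoc, inv_mul_le_iff₀ hc]
          exact le_trans (by gcongr) h3
        have h5 : c⁻¹ * τ * s * (2 * (k + (d + 1 : ℕ) : ℝ) - n) / 2
            = c⁻¹ * τ * s * (2 * (k + d : ℝ) - n) / 2 + c⁻¹ * τ * s := by push_cast; ring
        rw [← add_assoc, h5]
        linarith
      · have h5 := h.isTimeMesh.le_of_le (show k ≤ k + (d + 1) by omega) (by omega)
        have h6 : (2 * (k + (d + 1 : ℕ) : ℝ) - n) ≤ 0 := by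
          have : (2 * (k + d + 1 : ℕ) : ℝ) < n := by exact_mod_cast h1
          push_cast at this ⊢
          linarith
        have := mul_nonpos_of_nonneg_of_nonpos h2 h6
        linarith
  have hfin := hsum (n - k) (by omega)
  rw [show k + (n - k) = n by omega, Nat.cast_sub (by omega)] at hfin
  rw [show (2 * (k + (n - k) : ℝ) - n) = n by ring] at hfin
  have hns : s * n = (2 ^ r)⁻¹ * (n : ℝ) ^ r := by
    rw [hs, mul_assoc, ← Real.rpow_add_one hn0.ne', sub_add_cancel]
  have h7 := h.node_upper n hn1 hn
  have h8 : c⁻¹ * τ * s * n / 2 = c⁻¹ * ((2 ^ r)⁻¹ * (τ * (n : ℝ) ^ r)) / 2 := by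
    rw [mul_assoc _ s, hns]; ring
  rw [h8] at hfin
  rw [Real.rpow_add_one (by norm_num)]
  calc t n ≤ c * (τ * (n : ℝ) ^ r) := h7
    _ = c ^ 2 * (2 ^ r * 2) * (c⁻¹ * ((2 ^ r)⁻¹ * (τ * (n : ℝ) ^ r)) / 2) := by
      field_simp
    _ ≤ _ := by gcongr

end HasGrading

/-! ### Summation of the quadrature errors over a graded mesh -/

lemma rpow_neg_sub_le {α x y : ℝ} (hα : α ∈ Ioo (0 : ℝ) 1) (hx : 0 < x) (hxy : x ≤ y) :
    x ^ (-α) - y ^ (-α) ≤ x ^ (-α - 1) * (y - x) := by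
  have hy : 0 < y := hx.trans_le hxy
  have h1 : x / y ≤ (x / y) ^ α := by
    have := Real.rpow_le_rpow_of_exponent_ge (div_pos hx hy) ((div_le_one hy).2 hxy) hα.2.le
    rwa [Real.rpow_one] at this
  rw [Real.div_rpow hx.le hy.le] at h1
  have hxα : 0 < x ^ α := Real.rpow_pos_of_pos hx _
  have hyα : 0 < y ^ α := Real.rpow_pos_of_pos hy _
  rw [Real.rpow_sub_one hx.ne', Real.rpow_neg hx.le, Real.rpow_neg hy.le]
  have h2 : (x ^ α)⁻¹ - (y ^ α)⁻¹ = (x ^ α)⁻¹ * (1 - x ^ α / y ^ α) := by field_simp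
  have h3 : 1 - x ^ α / y ^ α ≤ (y - x) / x := by
    have h4 : 1 - x / y = (y - x) / y := by field_simp
    have h5 : (y - x) / y ≤ (y - x) / x := div_le_div_of_nonneg_left (by linarith) hx hxy
    linarith
  calc _ = (x ^ α)⁻¹ * (1 - x ^ α / y ^ α) := h2
    _ ≤ (x ^ α)⁻¹ * ((y - x) / x) := by gcongr
    _ = _ := by ring

lemma sum_Ico_sub_pred (g : ℕ → ℝ) {m n : ℕ} (hmn : m < n) :
    ∑ k ∈ Finset.Ico (m + 1) n, (g k - g (k - 1)) = g (n - 1) - g m := by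
  induction n, hmn using Nat.le_induction with
  | base => simp
  | succ n hn ih =>
    rw [Finset.sum_Ico_succ_top hn, ih, Nat.add_sub_cancel]
    ring

/-- The bound for the sum of the quadrature errors of a function whose second derivative is of size
`s ^ (-σ)`. Over the later half of the intervals, the differences of the weights telescope to
`τ_n^(-α)`; over the earlier half, they are at most a multiple of `τ_k t_n^(-1-α)`. -/
lemma sum_quadrature_le (α r c σ : ℝ) (hα : α ∈ Ioo (0 : ℝ) 1) (hr : 0 < r) (hc : 1 ≤ c) :
    ∃ C > 0, ∀ (τ : ℝ) (N : ℕ) (t : ℕ → ℝ), HasGrading r c τ N t →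
      ∀ m n, m < n → n ≤ N →
      ∑ k ∈ Finset.Ico (m + 1) n, timeStep t k ^ 2 * t k ^ (-σ)
            * ((t n - t k) ^ (-α) - (t n - t (k - 1)) ^ (-α))
          + timeStep t n ^ (2 - α) * t n ^ (-σ)
        ≤ C * (t n ^ (2 - α - σ) * (n : ℝ) ^ (-(2 - α))
          + t n ^ (-1 - α) * ∑ k ∈ Finset.Ico (m + 1) n, t k ^ (3 - σ) * (k : ℝ) ^ (-3 : ℝ)) := by
  have hc0 : 0 < c := by linarith
  set D : ℝ := c ^ 2 * 2 ^ r with hD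
  set D' : ℝ := c ^ 2 * 2 ^ (r + 1) with hD'
  have hD0 : 0 < D := by positivity
  have hD'0 : 0 < D' := by positivity
  set P : ℝ := (c ^ 2 * 2) ^ 2 * D ^ |-σ| with hP
  set Q : ℝ := c ^ 6 * D' ^ (1 + α) with hQ
  have hP0 : 0 < P := by positivity
  have hQ0 : 0 < Q := by positivity
  refine ⟨P * (c ^ 2) ^ α + (c ^ 2) ^ (2 - α) + Q, by positivity, ?_⟩
  intro τ N t h m n hmn hn
  have ht := h.isTimeMesh
  have hn1 : 1 ≤ n := by omega
  have hn0 : (0 : ℝ) < n := by exact_mod_cast hn1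
  have htn := ht.pos hn1 hn
  set w : ℕ → ℝ := fun k => (t n - t k) ^ (-α) with hw
  have hterm : ∀ k ∈ Finset.Ico (m + 1) n,
      timeStep t k ^ 2 * t k ^ (-σ) * (w k - w (k - 1))
        ≤ P * (t n / n) ^ 2 * t n ^ (-σ) * (w k - w (k - 1))
          + Q * t n ^ (-1 - α) * (t k ^ (3 - σ) * (k : ℝ) ^ (-3 : ℝ)) := by
    intro k hk
    rw [Finset.mem_Ico] at hk
    have hk1 : 1 ≤ k := by omega
    have hkN : k ≤ N := by omega
    have hk0 : (0 : ℝ) < k := by exact_mod_cast hk1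
    have htk := ht.pos hk1 hkN
    have hτk := ht.step_pos k hk1 hkN
    have hle := h.step_le hk1 hkN
    have hpos : 0 < t n - t k := sub_pos.2 (ht.lt_of_lt hk.2 hn)
    have hdiff : (t n - t (k - 1)) - (t n - t k) = timeStep t k := by rw [timeStep]; ring
    have hw0 : 0 ≤ w k - w (k - 1) := by
      refine sub_nonneg.2 (Real.rpow_le_rpow_of_nonpos hpos (by linarith) (by linarith [hα.1]))
    rcases le_total n (2 * k) with h2k | h2k
    · have h2k' : (n : ℝ) ≤ 2 * k := by exact_mod_cast h2k
      have htkn := ht.le_of_le hk.2.le hn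
      have h3 : timeStep t k ≤ c ^ 2 * 2 * (t n / n) := by
        refine hle.trans ?_
        rw [mul_assoc]
        gcongr
        rw [← mul_div_assoc, div_le_div_iff₀ hk0 hn0]
        nlinarith
      have h4 : t k ^ (-σ) ≤ D ^ |-σ| * t n ^ (-σ) :=
        rpow_le_mul_rpow _ htk (htkn.trans (le_mul_of_one_le_left htn.le (h.one_le_const hr)))
          (h.node_le_of_le_two_mul hr hk1 hkN hn1 hn h2k) (h.one_le_const hr) htn
      have h5 : timeStep t k ^ 2 * t k ^ (-σ) ≤ P * (t n / n) ^ 2 * t n ^ (-σ) := by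
        calc _ ≤ (c ^ 2 * 2 * (t n / n)) ^ 2 * (D ^ |-σ| * t n ^ (-σ)) := by gcongr
          _ = _ := by rw [hP]; ring
      have h6 : 0 ≤ Q * t n ^ (-1 - α) * (t k ^ (3 - σ) * (k : ℝ) ^ (-3 : ℝ)) := by positivity
      have h7 := mul_le_mul_of_nonneg_right h5 hw0
      linarith
    · have h3 : w k - w (k - 1) ≤ D' ^ (1 + α) * t n ^ (-1 - α) * timeStep t k := by
        have h4 := rpow_neg_sub_le hα hpos (y := t n - t (k - 1)) (by linarith)
        rw [hdiff] at h4
        refine h4.trans ?_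
        gcongr
        have h5 := h.node_le_sub hr h2k hn1 hn
        have h6 : D'⁻¹ * t n ≤ t n - t k := by rwa [inv_mul_le_iff₀ hD'0]
        have h7 := Real.rpow_le_rpow_of_nonpos (z := -α - 1) (by positivity) h6 (by linarith [hα.1])
        rw [Real.mul_rpow (by positivity) htn.le, Real.inv_rpow hD'0.le,
          ← Real.rpow_neg hD'0.le] at h7
        rwa [show -(-α - 1) = 1 + α by ring, show t n ^ (-α - 1) = t n ^ (-1 - α) by ring_nf] at h7
      have h8 : timeStep t k ^ 3 * t k ^ (-σ) ≤ c ^ 6 * (t k ^ (3 - σ) * (k : ℝ) ^ (-3 : ℝ)) := by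
        calc timeStep t k ^ 3 * t k ^ (-σ) ≤ (c ^ 2 * (t k / k)) ^ 3 * t k ^ (-σ) := by gcongr
          _ = c ^ 6 * ((t k ^ (3 : ℝ) * t k ^ (-σ)) * (k : ℝ) ^ (-3 : ℝ)) := by
            rw [Real.rpow_neg hk0.le]
            norm_cast
            field_simp
            simp
          _ = _ := by rw [← Real.rpow_add htk, ← sub_eq_add_neg]
      have h9 : 0 ≤ P * (t n / n) ^ 2 * t n ^ (-σ) * (w k - w (k - 1)) := by positivity
      calc timeStep t k ^ 2 * t k ^ (-σ) * (w k - w (k - 1))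
          ≤ timeStep t k ^ 2 * t k ^ (-σ)
            * (D' ^ (1 + α) * t n ^ (-1 - α) * timeStep t k) := by gcongr
        _ = D' ^ (1 + α) * t n ^ (-1 - α) * (timeStep t k ^ 3 * t k ^ (-σ)) := by ring
        _ ≤ D' ^ (1 + α) * t n ^ (-1 - α)
            * (c ^ 6 * (t k ^ (3 - σ) * (k : ℝ) ^ (-3 : ℝ))) := by gcongr
        _ = Q * t n ^ (-1 - α) * (t k ^ (3 - σ) * (k : ℝ) ^ (-3 : ℝ)) := by rw [hQ]; ring
        _ ≤ _ := by linarith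
  have hsum := Finset.sum_le_sum hterm
  rw [Finset.sum_add_distrib, ← Finset.mul_sum, ← Finset.mul_sum, sum_Ico_sub_pred w hmn] at hsum
  have hpow : (t n / n) ^ (2 - α) * t n ^ (-σ) = t n ^ (2 - α - σ) * (n : ℝ) ^ (-(2 - α)) := by
    rw [Real.div_rpow htn.le hn0.le, Real.rpow_neg hn0.le, sub_eq_add_neg (2 - α) σ,
      Real.rpow_add htn]
    field_simp
  have hτn := ht.step_pos n hn1 hn
  have hwn : w (n - 1) - w m ≤ (c ^ 2) ^ α * (t n / n) ^ (-α) := by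
    have h1 : w (n - 1) = timeStep t n ^ (-α) := rfl
    have h2 : 0 ≤ w m := Real.rpow_nonneg (sub_nonneg.2 (ht.le_of_le hmn.le hn)) _
    have h3 : (c ^ 2)⁻¹ * (t n / n) ≤ timeStep t n := by
      rw [inv_mul_le_iff₀ (by positivity)]; exact h.le_step hn1 hn
    have h4 := Real.rpow_le_rpow_of_nonpos (z := -α) (by positivity) h3 (by linarith [hα.1])
    rw [Real.mul_rpow (by positivity) (by positivity), Real.inv_rpow (by positivity),
      ← Real.rpow_neg (by positivity), neg_neg] at h4
    linarith
  have hlast : timeStep t n ^ (2 - α) ≤ (c ^ 2) ^ (2 - α) * (t n / n) ^ (2 - α) := by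
    rw [← Real.mul_rpow (by positivity) (by positivity)]
    exact Real.rpow_le_rpow hτn.le (h.step_le hn1 hn) (by linarith [hα.2])
  have hcomb : (t n / n) ^ 2 * (t n / n) ^ (-α) = (t n / n) ^ (2 - α) := by
    have hx : 0 < t n / n := by positivity
    rw [sub_eq_add_neg, Real.rpow_add hx, Real.rpow_two]
  set A := t n ^ (2 - α - σ) * (n : ℝ) ^ (-(2 - α)) with hA
  set S := ∑ k ∈ Finset.Ico (m + 1) n, t k ^ (3 - σ) * (k : ℝ) ^ (-3 : ℝ) with hS
  have hA0 : 0 ≤ A := by positivity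
  have hS0 : 0 ≤ t n ^ (-1 - α) * S := by
    refine mul_nonneg (by positivity) (Finset.sum_nonneg fun k hk => ?_)
    rw [Finset.mem_Ico] at hk
    have := ht.nonneg (show k ≤ N by omega)
    positivity
  have e1 : P * (t n / n) ^ 2 * t n ^ (-σ) * (w (n - 1) - w m) ≤ P * (c ^ 2) ^ α * A := by
    calc _ ≤ P * (t n / n) ^ 2 * t n ^ (-σ) * ((c ^ 2) ^ α * (t n / n) ^ (-α)) := by gcongr
      _ = P * (c ^ 2) ^ α * (((t n / n) ^ 2 * (t n / n) ^ (-α)) * t n ^ (-σ)) := by ring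
      _ = _ := by rw [hcomb, hpow]
  have e2 : timeStep t n ^ (2 - α) * t n ^ (-σ) ≤ (c ^ 2) ^ (2 - α) * A := by
    calc _ ≤ (c ^ 2) ^ (2 - α) * (t n / n) ^ (2 - α) * t n ^ (-σ) := by gcongr
      _ = (c ^ 2) ^ (2 - α) * ((t n / n) ^ (2 - α) * t n ^ (-σ)) := by ring
      _ = _ := by rw [hpow]
  have f1 : 0 ≤ (P * (c ^ 2) ^ α + (c ^ 2) ^ (2 - α)) * (t n ^ (-1 - α) * S) := by positivity
  have f2 : 0 ≤ Q * A := by positivity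
  change ∑ k ∈ Finset.Ico (m + 1) n, timeStep t k ^ 2 * t k ^ (-σ) * (w k - w (k - 1))
    + timeStep t n ^ (2 - α) * t n ^ (-σ) ≤ _
  have goal : (P * (c ^ 2) ^ α + (c ^ 2) ^ (2 - α) + Q) * (A + t n ^ (-1 - α) * S)
    = P * (c ^ 2) ^ α * A + (c ^ 2) ^ (2 - α) * A + Q * t n ^ (-1 - α) * S
      + (P * (c ^ 2) ^ α + (c ^ 2) ^ (2 - α)) * (t n ^ (-1 - α) * S) + Q * A := by ring
  linarith

/-- The total quadrature error after the node `t_m`, `m ≥ 1`, for a function with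
`‖u''(s)‖ ≤ K s^(-σ)`. -/
lemma norm_sum_average_sub_integral_le (α r c σ : ℝ) (hα : α ∈ Ioo (0 : ℝ) 1) (hr : 0 < r)
    (hc : 1 ≤ c) (hσ : 0 ≤ σ) :
    ∃ C > 0, ∀ (X : Type*) [NormedAddCommGroup X] [NormedSpace ℝ X] [CompleteSpace X]
      (τ : ℝ) (N : ℕ) (t : ℕ → ℝ), HasGrading r c τ N t →
      ∀ m n, 1 ≤ m → m < n → n ≤ N → ∀ (u : ℝ → X) (K : ℝ), 0 ≤ K →
      ContinuousOn u (Icc (t m) (t n)) → DifferentiableOn ℝ u (Ioo (t m) (t n)) →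
      DifferentiableOn ℝ (deriv u) (Ioo (t m) (t n)) →
      (∀ s ∈ Ioo (t m) (t n), ‖deriv (deriv u) s‖ ≤ K * s ^ (-σ)) →
      IntervalIntegrable (fun s => (t n - s) ^ (-α) • deriv u s) volume (t m) (t n) ∧
      ‖(∑ k ∈ Finset.Ico (m + 1) (n + 1),
            ((∫ s in (t (k - 1))..(t k), (t n - s) ^ (-α)) / timeStep t k) • (u (t k) - u (t (k - 1))))
          - ∫ s in (t m)..(t n), (t n - s) ^ (-α) • deriv u s‖
        ≤ C * K * (t n ^ (2 - α - σ) * (n : ℝ) ^ (-(2 - α))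
          + t n ^ (-1 - α) * ∑ k ∈ Finset.Ico (m + 1) n, t k ^ (3 - σ) * (k : ℝ) ^ (-3 : ℝ)) := by
  obtain ⟨C, hC, hsumle⟩ := sum_quadrature_le α r c σ hα hr hc
  have h1α : 0 < 1 - α := by linarith [hα.2]
  set D : ℝ := c ^ 2 * 2 ^ r with hD
  have hD0 : 0 < D := by positivity
  refine ⟨C * (D ^ σ * (1 - α)⁻¹), by positivity, ?_⟩
  intro X _ _ _ τ N t h m n hm hmn hn u K hK hu hd hd2 hB
  have ht := h.isTimeMesh
  have hinv : 1 ≤ (1 - α)⁻¹ := (one_le_inv₀ h1α).2 (by linarith [hα.1])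
  have hint : ∀ k, m + 1 ≤ k → k ≤ n →
      IntervalIntegrable (fun s => (t n - s) ^ (-α) • deriv u s) volume (t (k - 1)) (t k) ∧
      ‖((∫ s in (t (k - 1))..(t k), (t n - s) ^ (-α)) / timeStep t k) • (u (t k) - u (t (k - 1)))
        - ∫ s in (t (k - 1))..(t k), (t n - s) ^ (-α) • deriv u s‖
        ≤ K * (D ^ σ * t k ^ (-σ)) * timeStep t k *
          ((∫ s in (t (k - 1))..(t k), (t n - s) ^ (-α))
            - timeStep t k * (t n - t (k - 1)) ^ (-α)) := by
    intro k hk hkn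
    have hkN := hkn.trans hn
    have h1 : t m ≤ t (k - 1) := ht.le_of_le (by omega) (by omega)
    have h2 : t k ≤ t n := ht.le_of_le hkn hn
    have h3 : t (k - 1) < t k := ht.lt_of_lt (by omega) hkN
    have hp : 0 < t (k - 1) := ht.pos (by omega) (by omega)
    have hpk : 0 < t k := ht.pos (by omega) hkN
    have hsub : Ioo (t (k - 1)) (t k) ⊆ Ioo (t m) (t n) := Ioo_subset_Ioo h1 h2
    refine norm_average_smul_sub_integral_le hα h3 h2 (hu.mono (Icc_subset_Icc h1 h2))
      (hd.mono hsub) (hd2.mono hsub) fun s hs => (hB s (hsub hs)).trans ?_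
    gcongr
    have h4 : D⁻¹ * t k ≤ s := by
      refine le_trans ?_ hs.1.le
      rw [inv_mul_le_iff₀ hD0]
      exact h.node_le_of_le_two_mul hr (by omega) (by omega) (by omega) hkN (by omega)
    have h5 := Real.rpow_le_rpow_of_nonpos (z := -σ) (by positivity) h4 (by linarith)
    rwa [Real.mul_rpow (by positivity) hpk.le, Real.inv_rpow hD0.le, ← Real.rpow_neg hD0.le,
      neg_neg] at h5
  have hIco : ∀ k ∈ Ico m n,
      IntervalIntegrable (fun s => (t n - s) ^ (-α) • deriv u s) volume (t k) (t (k + 1)) := by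
    intro k hk
    exact (hint (k + 1) (by have := hk.1; omega) hk.2).1
  refine ⟨IntervalIntegrable.trans_iterate_Ico hmn.le hIco, ?_⟩
  have hsplit : ∫ s in (t m)..(t n), (t n - s) ^ (-α) • deriv u s
      = ∑ k ∈ Finset.Ico (m + 1) (n + 1),
        ∫ s in (t (k - 1))..(t k), (t n - s) ^ (-α) • deriv u s := by
    rw [← intervalIntegral.sum_integral_adjacent_intervals_Ico hmn.le hIco,
      ← Finset.sum_Ico_add_right_sub_eq (c := 1)]
    refine Finset.sum_congr rfl fun k hk => ?_
    rw [Finset.mem_Ico] at hk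
    rw [Nat.sub_add_cancel (by omega)]
  rw [hsplit, ← Finset.sum_sub_distrib]
  refine (norm_sum_le _ _).trans ?_
  rw [Finset.sum_Ico_succ_top hmn]
  have hDσ : 0 < D ^ σ := Real.rpow_pos_of_pos hD0 _
  have hle : ∀ k ∈ Finset.Ico (m + 1) n,
      ‖((∫ s in (t (k - 1))..(t k), (t n - s) ^ (-α)) / timeStep t k) • (u (t k) - u (t (k - 1)))
        - ∫ s in (t (k - 1))..(t k), (t n - s) ^ (-α) • deriv u s‖
      ≤ K * (D ^ σ * (1 - α)⁻¹) * (timeStep t k ^ 2 * t k ^ (-σ)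
            * ((t n - t k) ^ (-α) - (t n - t (k - 1)) ^ (-α))) := by
    intro k hk
    rw [Finset.mem_Ico] at hk
    have hkN : k ≤ N := by omega
    have hpk : 0 < t k := ht.pos (by omega) hkN
    have hτk := ht.step_pos k (by omega) hkN
    have h3 : t (k - 1) < t k := ht.lt_of_lt (by omega) hkN
    have h4 := integral_sub_rpow_neg_le hα.1.le hα.2 h3.le (ht.lt_of_lt hk.2 hn)
    have h6 : 0 ≤ (t n - t k) ^ (-α) - (t n - t (k - 1)) ^ (-α) :=
      sub_nonneg.2 (sub_rpow_neg_mono hα.1.le h3.le (ht.lt_of_lt hk.2 hn))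
    calc _ ≤ _ := (hint k hk.1 hk.2.le).2
      _ ≤ K * (D ^ σ * t k ^ (-σ)) * timeStep t k *
          (timeStep t k * (t n - t k) ^ (-α) - timeStep t k * (t n - t (k - 1)) ^ (-α)) := by
        gcongr
        exact h4
      _ = K * (D ^ σ * 1) * (timeStep t k ^ 2 * t k ^ (-σ)
            * ((t n - t k) ^ (-α) - (t n - t (k - 1)) ^ (-α))) := by ring
      _ ≤ _ := by gcongr
  have hlast : ‖((∫ s in (t (n - 1))..(t n), (t n - s) ^ (-α)) / timeStep t n)
        • (u (t n) - u (t (n - 1))) - ∫ s in (t (n - 1))..(t n), (t n - s) ^ (-α) • deriv u s‖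
      ≤ K * (D ^ σ * (1 - α)⁻¹) * (timeStep t n ^ (2 - α) * t n ^ (-σ)) := by
    have hτ := ht.step_pos n (by omega) hn
    have htn : 0 < t n := ht.pos (by omega) hn
    refine (hint n (by omega) le_rfl).2.trans ?_
    rw [integral_sub_rpow_neg hα.2, sub_self, Real.zero_rpow h1α.ne', sub_zero]
    change K * (D ^ σ * t n ^ (-σ)) * timeStep t n *
      (timeStep t n ^ (1 - α) / (1 - α) - timeStep t n * timeStep t n ^ (-α)) ≤ _
    have h7 : timeStep t n ^ (2 - α) = timeStep t n * timeStep t n ^ (1 - α) := by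
      rw [show 2 - α = 1 - α + 1 by ring, Real.rpow_add_one hτ.ne', mul_comm]
    calc _ ≤ K * (D ^ σ * t n ^ (-σ)) * timeStep t n * (timeStep t n ^ (1 - α) / (1 - α)) := by
          gcongr
          have : 0 ≤ timeStep t n * timeStep t n ^ (-α) := by positivity
          linarith
      _ = _ := by rw [h7]; field_simp
  refine (add_le_add (Finset.sum_le_sum hle) hlast).trans ?_
  rw [← Finset.mul_sum, ← mul_add]
  have := mul_le_mul_of_nonneg_left (hsumle τ N t h m n hmn hn)
    (show 0 ≤ K * (D ^ σ * (1 - α)⁻¹) by positivity)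
  refine this.trans (le_of_eq ?_)
  ring

/-! ### A decaying barrier -/

/-- The profile `s^(α-1) - A s^(α-1-δ)`. The first power lies in the kernel of the Riemann-Liouville
derivative of order `α`; the second one makes the derivative positive. -/
noncomputable def decayProfile (α δ A s : ℝ) : ℝ := s ^ (α - 1) - A * s ^ (α - 1 - δ)

section Profile

variable {α δ A s : ℝ}

lemma hasDerivAt_decayProfile (hs : 0 < s) :
    HasDerivAt (decayProfile α δ A)
      ((α - 1) * s ^ (α - 2) - A * ((α - 1 - δ) * s ^ (α - 2 - δ))) s := by
  have h1 := Real.hasDerivAt_rpow_const (x := s) (p := α - 1) (Or.inl hs.ne')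
  have h2 := (Real.hasDerivAt_rpow_const (x := s) (p := α - 1 - δ) (Or.inl hs.ne')).const_mul A
  rw [show α - 1 - 1 = α - 2 by ring] at h1
  rw [show α - 1 - δ - 1 = α - 2 - δ by ring] at h2
  exact h1.sub h2

lemma deriv_decayProfile (hs : 0 < s) : deriv (decayProfile α δ A) s
    = (α - 1) * s ^ (α - 2) - A * ((α - 1 - δ) * s ^ (α - 2 - δ)) :=
  (hasDerivAt_decayProfile hs).deriv

lemma hasDerivAt_deriv_decayProfile (hs : 0 < s) :
    HasDerivAt (deriv (decayProfile α δ A))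
      ((α - 1) * ((α - 2) * s ^ (α - 3))
        - A * ((α - 1 - δ) * ((α - 2 - δ) * s ^ (α - 3 - δ)))) s := by
  have h1 := (Real.hasDerivAt_rpow_const (x := s) (p := α - 2) (Or.inl hs.ne')).const_mul (α - 1)
  have h2 := ((Real.hasDerivAt_rpow_const (x := s) (p := α - 2 - δ) (Or.inl hs.ne')).const_mul
    (α - 1 - δ)).const_mul A
  rw [show α - 2 - 1 = α - 3 by ring] at h1
  rw [show α - 2 - δ - 1 = α - 3 - δ by ring] at h2
  refine (h1.sub h2).congr_of_eventuallyEq ?_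
  filter_upwards [lt_mem_nhds hs] with y hy
  rw [deriv_decayProfile hy]
  rfl

lemma abs_deriv_deriv_decayProfile_le (hα : α ∈ Ioo (0 : ℝ) 1) (hδ : 0 ≤ δ) (hδ1 : δ ≤ 1)
    (hs : 0 < s) (hA : 0 ≤ A) (hAs : A * s ^ (-δ) ≤ 1 / 2) :
    ‖deriv (deriv (decayProfile α δ A)) s‖ ≤ 5 * s ^ (-(3 - α)) := by
  rw [(hasDerivAt_deriv_decayProfile hs).deriv]
  have e1 : s ^ (α - 3 - δ) = s ^ (α - 3) * s ^ (-δ) := by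
    rw [← Real.rpow_add hs]; ring_nf
  have e2 : (α - 1) * ((α - 2) * s ^ (α - 3))
        - A * ((α - 1 - δ) * ((α - 2 - δ) * s ^ (α - 3 - δ)))
      = ((1 - α) * (2 - α) - (A * s ^ (-δ)) * ((1 - α + δ) * (2 - α + δ))) * s ^ (α - 3) := by
    rw [e1]; ring
  rw [e2, norm_mul, Real.norm_of_nonneg (Real.rpow_nonneg hs.le _), show -(3 - α) = α - 3 by ring]
  refine mul_le_mul_of_nonneg_right ?_ (Real.rpow_nonneg hs.le _)
  obtain ⟨h0, h1⟩ := hα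
  have hq : 0 ≤ A * s ^ (-δ) := by positivity
  have b1 : 0 ≤ (1 - α) * (2 - α) := mul_nonneg (by linarith) (by linarith)
  have b2 : (1 - α) * (2 - α) ≤ 2 := by nlinarith
  have b3 : 0 ≤ (1 - α + δ) * (2 - α + δ) := mul_nonneg (by linarith) (by linarith)
  have b4 : (1 - α + δ) * (2 - α + δ) ≤ 6 := by nlinarith
  have b5 := mul_nonneg hq b3
  have b6 : (A * s ^ (-δ)) * ((1 - α + δ) * (2 - α + δ)) ≤ 1 / 2 * 6 := by gcongr
  rw [Real.norm_eq_abs, abs_le]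
  constructor <;> linarith

/-- The Caputo derivative of the profile frozen at its value on `[0, M]`, up to the factor
`Γ(1 - α)`, is bounded below by a multiple of `M^δ x^(-1-δ)`. This is read off from
`(x-s)^(-α) φ'(s) = d/ds (x⁻¹ (x-s)^(1-α) φ(s)) + A δ x⁻¹ (x-s)^(-α) s^(α-1-δ)`. -/
lemma le_caputo_decayProfile {M x : ℝ} (hα : α ∈ Ioo (0 : ℝ) 1) (hδ : 0 < δ) (hM : 0 < M)
    (hMx : M < x) (hA : A = M ^ δ / 2) :
    min 1 (δ / (1 - α)) / 2 * (M ^ δ * x ^ (-1 - δ))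
      ≤ decayProfile α δ A M * x ^ (-α)
        + ∫ s in M..x, (x - s) ^ (-α) • deriv (decayProfile α δ A) s := by
  have h1α : 0 < 1 - α := by linarith [hα.2]
  have hx : 0 < x := hM.trans hMx
  have hA0 : 0 < A := by rw [hA]; positivity
  have hφM : decayProfile α δ A M = M ^ (α - 1) / 2 := by
    have : M ^ δ * M ^ (α - 1 - δ) = M ^ (α - 1) := by
      rw [← Real.rpow_add hM]; ring_nf
    rw [decayProfile, hA]
    linear_combination (-1 / 2) * this
  have hw := intervalIntegrable_sub_rpow_neg hα.2 x M x
  -- `g` is the derivative of `G`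
  set G : ℝ → ℝ := fun s => x⁻¹ * ((x - s) ^ (1 - α) * decayProfile α δ A s) with hG
  set g : ℝ → ℝ := fun s => (x - s) ^ (-α) * (deriv (decayProfile α δ A) s
    - A * δ * x⁻¹ * s ^ (α - 1 - δ)) with hg
  have hpos : ∀ s ∈ Icc M x, 0 < s := fun s hs => hM.trans_le hs.1
  have hcont : ContinuousOn (decayProfile α δ A) (Icc M x) := fun s hs =>
    (hasDerivAt_decayProfile (hpos s hs)).continuousAt.continuousWithinAt
  have hcont' : ContinuousOn (deriv (decayProfile α δ A)) (Icc M x) := fun s hs =>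
    (hasDerivAt_deriv_decayProfile (hpos s hs)).continuousAt.continuousWithinAt
  have hpc : ContinuousOn (fun s : ℝ => A * δ * x⁻¹ * s ^ (α - 1 - δ)) (Icc M x) :=
    continuousOn_const.mul (continuousOn_id.rpow_const fun s hs => Or.inl (hpos s hs).ne')
  have hu : uIcc M x = Icc M x := uIcc_of_le hMx.le
  have hgi : IntervalIntegrable g volume M x :=
    hw.mul_continuousOn (by rw [hu]; exact hcont'.sub hpc)
  have hφi : IntervalIntegrable (fun s => (x - s) ^ (-α) • deriv (decayProfile α δ A) s)
      volume M x := hw.mul_continuousOn (by rw [hu]; exact hcont')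
  have hderiv : ∀ s ∈ Ioo M x, HasDerivAt G (g s) s := by
    intro s hs
    have hs0 : 0 < s := hM.trans hs.1
    have hxs : 0 < x - s := by linarith [hs.2]
    have h1 : HasDerivAt (fun s => (x - s) ^ (1 - α)) (-((1 - α) * (x - s) ^ (-α))) s := by
      have := ((hasDerivAt_id s).const_sub x).rpow_const (p := 1 - α) (Or.inl hxs.ne')
      rw [show 1 - α - 1 = -α by ring] at this
      refine this.congr_deriv ?_
      simp only [id]
      ring
    have h2 := (h1.mul (hasDerivAt_decayProfile (α := α) (δ := δ) (A := A) hs0)).const_mul x⁻¹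
    refine h2.congr_deriv ?_
    rw [hg]
    dsimp only
    rw [deriv_decayProfile hs0, decayProfile]
    have e1 : (x - s) ^ (1 - α) = (x - s) ^ (-α) * (x - s) := by
      rw [show 1 - α = -α + 1 by ring, Real.rpow_add_one hxs.ne']
    have e2 : s ^ (α - 1) = s ^ (α - 2) * s := by
      rw [show α - 1 = α - 2 + 1 by ring, Real.rpow_add_one hs0.ne']
    have e3 : s ^ (α - 1 - δ) = s ^ (α - 2 - δ) * s := by
      rw [show α - 1 - δ = α - 2 - δ + 1 by ring, Real.rpow_add_one hs0.ne']
    rw [e1, e2, e3]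
    field_simp
    ring
  have hGc : ContinuousOn G (Icc M x) := by
    refine continuousOn_const.mul (ContinuousOn.mul ?_ hcont)
    exact ContinuousOn.rpow_const (by fun_prop) fun s _ => Or.inr h1α.le
  have hFTC := intervalIntegral.integral_eq_sub_of_hasDerivAt_of_le hMx.le hGc hderiv hgi
  have hGx : G x = 0 := by simp [hG, Real.zero_rpow h1α.ne']
  have hlow : ∫ s in M..x, (g s + A * δ * x⁻¹ * x ^ (α - 1 - δ) * (x - s) ^ (-α))
      ≤ ∫ s in M..x, (x - s) ^ (-α) • deriv (decayProfile α δ A) s := by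
    refine intervalIntegral.integral_mono_on_of_le_Ioo hMx.le (hgi.add (hw.const_mul _)) hφi ?_
    intro s hs
    have hs0 : 0 < s := hM.trans hs.1
    have hxs : 0 ≤ (x - s) ^ (-α) := Real.rpow_nonneg (by linarith [hs.2]) _
    have h3 : x ^ (α - 1 - δ) ≤ s ^ (α - 1 - δ) :=
      Real.rpow_le_rpow_of_nonpos hs0 hs.2.le (by linarith)
    have h4 := mul_le_mul_of_nonneg_left h3
      (show 0 ≤ A * δ * x⁻¹ * (x - s) ^ (-α) by positivity)
    rw [hg, smul_eq_mul]
    dsimp only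
    linarith
  rw [intervalIntegral.integral_add hgi (hw.const_mul _), intervalIntegral.integral_const_mul,
    hFTC, hGx, integral_sub_rpow_neg hα.2, sub_self, Real.zero_rpow h1α.ne', sub_zero] at hlow
  set y : ℝ := ((x - M) / x) ^ (1 - α) with hy
  have hxM : 0 < x - M := sub_pos.2 hMx
  have hy0 : 0 ≤ y := by positivity
  have hy1 : y ≤ 1 :=
    Real.rpow_le_one (by positivity) ((div_le_one hx).2 (by linarith)) h1α.le
  have hyx : (x - M) ^ (1 - α) = y * (x ^ (-α) * x) := by
    rw [hy, Real.div_rpow hxM.le hx.le, ← Real.rpow_add_one hx.ne', show -α + 1 = 1 - α by ring,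
      div_mul_cancel₀ _ (Real.rpow_pos_of_pos hx _).ne']
  have hGM : G M = M ^ (α - 1) / 2 * x ^ (-α) * y := by
    simp only [hG]
    rw [hyx, hφM]
    field_simp
  have hB : A * δ * x⁻¹ * x ^ (α - 1 - δ) * ((x - M) ^ (1 - α) / (1 - α))
      = M ^ δ * x ^ (-1 - δ) / 2 * (δ / (1 - α)) * y := by
    have e : x ^ (α - 1 - δ) * x ^ (-α) = x ^ (-1 - δ) := by
      rw [← Real.rpow_add hx]; ring_nf
    rw [hyx, hA, ← e]
    field_simp
  rw [hGM, hB] at hlow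
  rw [hφM]
  set Q : ℝ := M ^ δ * x ^ (-1 - δ) with hQ
  have hQ0 : 0 < Q := by positivity
  have hQle : Q ≤ M ^ (α - 1) * x ^ (-α) := by
    have h5 : x ^ (α - 1 - δ) ≤ M ^ (α - 1 - δ) :=
      Real.rpow_le_rpow_of_nonpos hM hMx.le (by linarith)
    have e1 : M ^ (α - 1) = M ^ δ * M ^ (α - 1 - δ) := by
      rw [← Real.rpow_add hM]; ring_nf
    have e2 : x ^ (-1 - δ) = x ^ (α - 1 - δ) * x ^ (-α) := by
      rw [← Real.rpow_add hx]; ring_nf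
    rw [hQ, e1, e2, ← mul_assoc]
    gcongr
  set μ : ℝ := min 1 (δ / (1 - α)) with hμ
  have hμ1 : μ ≤ 1 := min_le_left _ _
  have hμ2 : μ ≤ δ / (1 - α) := min_le_right _ _
  have f1 : Q * (1 - y) ≤ M ^ (α - 1) * x ^ (-α) * (1 - y) :=
    mul_le_mul_of_nonneg_right hQle (by linarith)
  have f2 : μ * (Q * (1 - y)) ≤ 1 * (Q * (1 - y)) :=
    mul_le_mul_of_nonneg_right hμ1 (mul_nonneg hQ0.le (by linarith))
  have f3 : μ * (Q * y) ≤ δ / (1 - α) * (Q * y) :=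
    mul_le_mul_of_nonneg_right hμ2 (mul_nonneg hQ0.le hy0)
  linarith

end Profile

lemma sum_Ico_rpow_le {p : ℝ} (hp : p < -1) (m n : ℕ) :
    ∑ k ∈ Finset.Ico m n, (k : ℝ) ^ p ≤ ∑' k : ℕ, (k : ℝ) ^ p :=
  (Real.summable_nat_rpow.2 hp).sum_le_tsum _ fun k _ => Real.rpow_nonneg k.cast_nonneg _

section Barrier

/-- The quadrature error of the profile is of the same order as the lower bound for its Caputo
derivative, but with the small factor `m⁻¹`. -/
lemma quadrature_decayProfile_le (α δ r c : ℝ) (hα : α ∈ Ioo (0 : ℝ) 1) (hr : 0 < r)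
    (hc : 1 ≤ c) (hδ : 0 < δ) (hδα : δ ≤ α) (hδr : r * δ ≤ 2 - α) :
    ∃ C > 0, ∀ (τ : ℝ) (N : ℕ) (t : ℕ → ℝ), HasGrading r c τ N t →
      ∀ m n, 1 ≤ m → m < n → n ≤ N → ∀ A, A = t m ^ δ / 2 →
      ‖(∑ k ∈ Finset.Ico (m + 1) (n + 1),
            ((∫ s in (t (k - 1))..(t k), (t n - s) ^ (-α)) / timeStep t k)
              • (decayProfile α δ A (t k) - decayProfile α δ A (t (k - 1))))
          - ∫ s in (t m)..(t n), (t n - s) ^ (-α) • deriv (decayProfile α δ A) s‖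
        ≤ C * (m : ℝ)⁻¹ * (t m ^ δ * t n ^ (-1 - δ)) := by
  obtain ⟨C, hC, hquad⟩ := norm_sum_average_sub_integral_le α r c (3 - α) hα hr hc
    (by linarith [hα.2])
  set Z : ℝ := ∑' k : ℕ, (k : ℝ) ^ (-1 - α) with hZ
  have hZ0 : 0 ≤ Z := tsum_nonneg fun k => Real.rpow_nonneg k.cast_nonneg _
  have hc0 : 0 < c := by linarith
  refine ⟨C * 5 * ((c ^ 2) ^ δ * (1 + Z)), by positivity, ?_⟩
  intro τ N t h m n hm hmn hn A hA
  have ht := h.isTimeMesh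
  have hM : 0 < t m := ht.pos hm (by omega)
  have hx : 0 < t n := ht.pos (by omega) hn
  have hm0 : (0 : ℝ) < m := by exact_mod_cast hm
  have hn0 : (0 : ℝ) < n := by exact_mod_cast (show 0 < n by omega)
  have hA0 : 0 ≤ A := by rw [hA]; positivity
  have hpos : ∀ s ∈ Icc (t m) (t n), 0 < s := fun s hs => hM.trans_le hs.1
  have hpos' : ∀ s ∈ Ioo (t m) (t n), 0 < s := fun s hs => hM.trans hs.1
  have h1 := (hquad ℝ τ N t h m n hm hmn hn (decayProfile α δ A) 5 (by norm_num)
    (fun s hs => (hasDerivAt_decayProfile (hpos s hs)).continuousAt.continuousWithinAt)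
    (fun s hs => (hasDerivAt_decayProfile
      (hpos' s hs)).differentiableAt.differentiableWithinAt)
    (fun s hs => (hasDerivAt_deriv_decayProfile
      (hpos' s hs)).differentiableAt.differentiableWithinAt)
    (fun s hs => abs_deriv_deriv_decayProfile_le hα hδ.le (by linarith [hα.2]) (hpos' s hs) hA0 (by
      have h2 : s ^ (-δ) ≤ t m ^ (-δ) :=
        Real.rpow_le_rpow_of_nonpos hM hs.1.le (by linarith)
      have h3 : t m ^ δ * t m ^ (-δ) = 1 := by rw [← Real.rpow_add hM]; simp
      calc A * s ^ (-δ) ≤ A * t m ^ (-δ) := by gcongr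
        _ = (t m ^ δ * t m ^ (-δ)) / 2 := by rw [hA]; ring
        _ = 1 / 2 := by rw [h3]))).2
  refine h1.trans ?_
  -- `t_k^δ k^(-(2-α))` is essentially decreasing in `k`
  have hgrow : ∀ k, m ≤ k → k ≤ N →
      t k ^ δ * (k : ℝ) ^ (-(2 - α)) ≤ (c ^ 2) ^ δ * (t m ^ δ * (m : ℝ)⁻¹) := by
    intro k hk hkN
    have hk0 : (0 : ℝ) < k := by exact_mod_cast (show 0 < k by omega)
    have htk : 0 < t k := ht.pos (by omega) hkN
    have h2 := Real.rpow_le_rpow htk.le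
      (h.node_ratio hm (by omega) (show 1 ≤ k by omega) hkN) hδ.le
    have h3 : (1 : ℝ) ≤ k / m := (one_le_div hm0).2 (by exact_mod_cast hk)
    have h4 : ((k : ℝ) / m) ^ (r * δ) ≤ (k / m) ^ (2 - α) :=
      Real.rpow_le_rpow_of_exponent_le h3 hδr
    rw [Real.mul_rpow (by positivity) hM.le, Real.mul_rpow (by positivity) (by positivity),
      ← Real.rpow_mul (by positivity)] at h2
    have h5 : (m : ℝ) ^ (-(2 - α)) ≤ (m : ℝ)⁻¹ := by
      rw [← Real.rpow_neg_one]
      exact Real.rpow_le_rpow_of_exponent_le (by exact_mod_cast hm) (by linarith [hα.2])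
    have h6 : ((k : ℝ) / m) ^ (2 - α) * (k : ℝ) ^ (-(2 - α)) = (m : ℝ) ^ (-(2 - α)) := by
      rw [Real.div_rpow hk0.le hm0.le, Real.rpow_neg hk0.le, Real.rpow_neg hm0.le]
      field_simp
    calc t k ^ δ * (k : ℝ) ^ (-(2 - α))
        ≤ ((c ^ 2) ^ δ * (k / m) ^ (2 - α) * t m ^ δ) * (k : ℝ) ^ (-(2 - α)) := by
          gcongr
          exact h2.trans (by gcongr)
      _ = (c ^ 2) ^ δ * (t m ^ δ * (((k : ℝ) / m) ^ (2 - α) * (k : ℝ) ^ (-(2 - α)))) := by ring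
      _ ≤ _ := by rw [h6]; gcongr
  set W : ℝ := (c ^ 2) ^ δ * (t m ^ δ * (m : ℝ)⁻¹) with hW
  have hW0 : 0 ≤ W := by positivity
  have p1 : t n ^ (2 - α - (3 - α)) * (n : ℝ) ^ (-(2 - α)) ≤ t n ^ (-1 - δ) * W := by
    have e : t n ^ (2 - α - (3 - α)) = t n ^ (-1 - δ) * t n ^ δ := by
      rw [← Real.rpow_add hx]; ring_nf
    rw [e, mul_assoc]
    have := hgrow n hmn.le hn
    gcongr
  have p2 : t n ^ (-1 - α) * ∑ k ∈ Finset.Ico (m + 1) n, t k ^ (3 - (3 - α)) * (k : ℝ) ^ (-3 : ℝ)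
      ≤ t n ^ (-1 - δ) * W * Z := by
    have h7 : ∑ k ∈ Finset.Ico (m + 1) n, t k ^ (3 - (3 - α)) * (k : ℝ) ^ (-3 : ℝ)
        ≤ ∑ k ∈ Finset.Ico (m + 1) n, t n ^ (α - δ) * W * (k : ℝ) ^ (-1 - α) := by
      refine Finset.sum_le_sum fun k hk => ?_
      rw [Finset.mem_Ico] at hk
      have hkN : k ≤ N := by omega
      have hk0 : (0 : ℝ) < k := by exact_mod_cast (show 0 < k by omega)
      have htk : 0 < t k := ht.pos (by omega) hkN
      have h8 : t k ^ (α - δ) ≤ t n ^ (α - δ) :=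
        Real.rpow_le_rpow htk.le (ht.le_of_le hk.2.le hn) (by linarith)
      have h9 := hgrow k (by omega) hkN
      calc t k ^ (3 - (3 - α)) * (k : ℝ) ^ (-3 : ℝ)
          = t k ^ (α - δ) * (t k ^ δ * (k : ℝ) ^ (-(2 - α))) * (k : ℝ) ^ (-1 - α) := by
            rw [← mul_assoc, ← Real.rpow_add htk, mul_assoc, ← Real.rpow_add hk0]
            ring_nf
        _ ≤ _ := by gcongr
    rw [← Finset.mul_sum] at h7
    have h10 := sum_Ico_rpow_le (p := -1 - α) (by linarith [hα.1]) (m + 1) n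
    have e : t n ^ (-1 - δ) = t n ^ (-1 - α) * t n ^ (α - δ) := by
      rw [← Real.rpow_add hx]; ring_nf
    calc _ ≤ t n ^ (-1 - α) * (t n ^ (α - δ) * W * Z) := by
          gcongr
          exact h7.trans (by gcongr)
      _ = _ := by rw [e]; ring
  calc _ ≤ C * 5 * (t n ^ (-1 - δ) * W + t n ^ (-1 - δ) * W * Z) := by gcongr
    _ = _ := by rw [hW]; ring

/-- For `m` beyond a fixed index, the profile frozen at its value at `t_m` is a discrete
supersolution. -/
lemma exists_barrier_of_large (α r c : ℝ) (hα : α ∈ Ioo (0 : ℝ) 1) (hr : 0 < r) (hc : 1 ≤ c) :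
    ∃ m₀ : ℕ, ∀ (τ : ℝ) (N : ℕ) (t : ℕ → ℝ), HasGrading r c τ N t →
      ∀ m, 1 ≤ m → m ≤ N → (m₀ ≤ m ∨ m = N) → ∃ V : ℕ → ℝ, V 0 = 0 ∧
        (∀ j, 1 ≤ j → j ≤ N → 0 ≤ discreteCaputo α t V j) ∧
        (∀ j, 1 ≤ j → j ≤ m → 1 ≤ discreteCaputo α t V j) ∧
        ∀ n, 1 ≤ n → n ≤ N → V n ≤ 2 * Real.Gamma (1 - α) * (t m * t n ^ (α - 1)) := by
  set δ : ℝ := min α ((2 - α) / r) with hδdef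
  have h1α : 0 < 1 - α := by linarith [hα.2]
  have hδ : 0 < δ := lt_min hα.1 (div_pos (by linarith) hr)
  have hδα : δ ≤ α := min_le_left _ _
  have hδr : r * δ ≤ 2 - α := by
    have : δ ≤ (2 - α) / r := min_le_right _ _
    rwa [le_div_iff₀ hr, mul_comm] at this
  obtain ⟨C, hC, hquad⟩ := quadrature_decayProfile_le α δ r c hα hr hc hδ hδα hδr
  set μ : ℝ := min 1 (δ / (1 - α)) / 2 with hμ
  have hμ0 : 0 < μ := by
    have : 0 < δ / (1 - α) := div_pos hδ h1α
    have := lt_min one_pos this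
    rw [hμ]; linarith
  have hG := gamma_one_sub_pos hα
  refine ⟨⌈C / μ⌉₊, ?_⟩
  intro τ N t h m hm hmN hlarge
  have ht := h.isTimeMesh
  have hM : 0 < t m := ht.pos hm hmN
  have hm0 : (0 : ℝ) < m := by exact_mod_cast hm
  set A : ℝ := t m ^ δ / 2 with hA
  set φ := decayProfile α δ A with hφ
  set G := Real.Gamma (1 - α) with hGdef
  set v : ℕ → ℝ := fun k => if k = 0 then 0 else φ (t (max k m)) with hv
  have hφM : φ (t m) = t m ^ (α - 1) / 2 := by
    have : t m ^ δ * t m ^ (α - 1 - δ) = t m ^ (α - 1) := by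
      rw [← Real.rpow_add hM]; ring_nf
    rw [hφ, decayProfile, hA]
    linear_combination (-1 / 2) * this
  have hφM0 : 0 < φ (t m) := by rw [hφM]; positivity
  have hv1 : ∀ k, 1 ≤ k → k ≤ m → v k = φ (t m) := fun k h1 h2 => by
    simp only [hv, if_neg (show k ≠ 0 by omega), max_eq_right h2]
  have hv2 : ∀ k, m ≤ k → v k = φ (t k) := fun k h1 => by
    simp only [hv, if_neg (show k ≠ 0 by omega), max_eq_left h1]
  -- the jump at the first step
  have hfirst : ∀ j, 1 ≤ j → j ≤ N → φ (t m) * t j ^ (-α) / G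
      ≤ ∑ k ∈ Finset.Icc 1 (min j m), l1Kernel α t j k • (v k - v (k - 1)) := by
    intro j hj hjN
    rw [Finset.sum_eq_single 1]
    · have h2 := l1Kernel_ge hα ht le_rfl hj hjN
      rw [Nat.sub_self, ht.start, sub_zero] at h2
      rw [Nat.sub_self, hv1 1 le_rfl hm, show v 0 = 0 from rfl, sub_zero, smul_eq_mul,
        mul_div_assoc, mul_comm]
      gcongr
    · intro k hk hk1
      rw [Finset.mem_Icc] at hk
      rw [hv1 k hk.1 (by omega), hv1 (k - 1) (by omega) (by omega), sub_self, smul_zero]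
    · intro hk
      exact absurd (Finset.mem_Icc.2 ⟨le_rfl, by omega⟩) hk
  have hlow : ∀ j, 1 ≤ j → j ≤ m → (t m)⁻¹ / 2 / G ≤ discreteCaputo α t v j := by
    intro j hj hjm
    have h3 := hfirst j hj (hjm.trans hmN)
    rw [min_eq_left hjm] at h3
    refine le_trans ?_ h3
    have htj := ht.pos hj (hjm.trans hmN)
    have h4 : t m ^ (-α) ≤ t j ^ (-α) :=
      Real.rpow_le_rpow_of_nonpos htj (ht.le_of_le hjm hmN) (by linarith [hα.1])
    have h5 : (t m)⁻¹ = t m ^ (α - 1) * t m ^ (-α) := by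
      rw [← Real.rpow_add hM, ← Real.rpow_neg_one]; ring_nf
    have h6 : (t m)⁻¹ / 2 = φ (t m) * t m ^ (-α) := by rw [h5, hφM]; ring
    rw [h6]
    gcongr
  have hhigh : ∀ j, m < j → j ≤ N → 0 ≤ discreteCaputo α t v j := by
    intro j hj hjN
    have hmL : ⌈C / μ⌉₊ ≤ m := hlarge.resolve_right (by omega)
    have h3 := hfirst j (by omega) hjN
    rw [min_eq_right hj.le] at h3
    have hsplit : discreteCaputo α t v j
        = ∑ k ∈ Finset.Icc 1 m, l1Kernel α t j k • (v k - v (k - 1))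
          + (∑ k ∈ Finset.Ico (m + 1) (j + 1),
            ((∫ s in (t (k - 1))..(t k), (t j - s) ^ (-α)) / timeStep t k)
              • (φ (t k) - φ (t (k - 1)))) / G := by
      rw [discreteCaputo, ← Finset.Ico_add_one_right_eq_Icc, ← Finset.Ico_add_one_right_eq_Icc,
        ← Finset.sum_Ico_consecutive _ (show 1 ≤ m + 1 by omega) (show m + 1 ≤ j + 1 by omega),
        Finset.sum_div]
      congr 1
      refine Finset.sum_congr rfl fun k hk => ?_
      rw [Finset.mem_Ico] at hk
      rw [hv2 k (by omega), hv2 (k - 1) (by omega), l1Kernel_eq_integral, smul_eq_mul, smul_eq_mul]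
      ring
    have hq := hquad τ N t h m j hm hj hjN A rfl
    have hcap := le_caputo_decayProfile hα hδ hM (ht.lt_of_lt hj hjN) hA
    rw [Real.norm_eq_abs] at hq
    have hq' := (abs_le.1 hq).1
    rw [← hφ, ← hμ] at hcap
    rw [← hφ] at hq'
    have hsmall : C * (m : ℝ)⁻¹ ≤ μ := by
      rw [← div_eq_mul_inv, div_le_iff₀ hm0]
      have := (Nat.le_ceil (C / μ)).trans (Nat.cast_le.2 hmL)
      rwa [div_le_iff₀ hμ0, mul_comm] at this
    have hx : 0 < t j := ht.pos (by omega) hjN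
    have h7 := mul_le_mul_of_nonneg_right hsmall
      (show 0 ≤ t m ^ δ * t j ^ (-1 - δ) by positivity)
    rw [hsplit]
    have h8 : 0 ≤ (φ (t m) * t j ^ (-α) + ∑ k ∈ Finset.Ico (m + 1) (j + 1),
            ((∫ s in (t (k - 1))..(t k), (t j - s) ^ (-α)) / timeStep t k)
              • (φ (t k) - φ (t (k - 1)))) / G := by
      refine div_nonneg ?_ hG.le
      linarith
    rw [add_div] at h8
    linarith
  refine ⟨fun k => 2 * G * t m * v k, by simp [hv], ?_, ?_, ?_⟩
  · intro j hj hjN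
    rw [discreteCaputo_const_mul]
    refine mul_nonneg (by positivity) ?_
    rcases le_or_gt j m with h1 | h1
    · exact le_trans (by positivity) (hlow j hj h1)
    · exact hhigh j h1 hjN
  · intro j hj hjm
    rw [discreteCaputo_const_mul]
    have h9 := mul_le_mul_of_nonneg_left (hlow j hj hjm) (show 0 ≤ 2 * G * t m by positivity)
    have h10 : 2 * G * t m * ((t m)⁻¹ / 2 / G) = 1 := by field_simp
    linarith
  · intro n hn hnN
    have htn := ht.pos hn hnN
    have hmax : max n m ≤ N := max_le hnN hmN
    have htmax : t n ≤ t (max n m) := ht.le_of_le (le_max_left _ _) hmax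
    have h11 : v n ≤ t n ^ (α - 1) := by
      simp only [hv, if_neg (show n ≠ 0 by omega)]
      have h12 : t (max n m) ^ (α - 1) ≤ t n ^ (α - 1) :=
        Real.rpow_le_rpow_of_nonpos htn htmax (by linarith)
      have h13 : 0 ≤ A * t (max n m) ^ (α - 1 - δ) := by
        have := htn.trans_le htmax
        positivity
      rw [hφ, decayProfile]
      linarith
    have := mul_le_mul_of_nonneg_left h11 (show 0 ≤ 2 * G * t m by positivity)
    linarith

/-- The response to a unit source up to level `m` is at most a multiple of `t_m t_n^(α-1)`. -/
lemma exists_barrier (α r c : ℝ) (hα : α ∈ Ioo (0 : ℝ) 1) (hr : 0 < r) (hc : 1 ≤ c) :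
    ∃ C > 0, ∀ (τ : ℝ) (N : ℕ) (t : ℕ → ℝ), HasGrading r c τ N t →
      ∀ m, 1 ≤ m → m ≤ N → ∃ V : ℕ → ℝ, V 0 = 0 ∧
        (∀ j, 1 ≤ j → j ≤ N → 0 ≤ discreteCaputo α t V j) ∧
        (∀ j, 1 ≤ j → j ≤ m → 1 ≤ discreteCaputo α t V j) ∧
        ∀ n, 1 ≤ n → n ≤ N → V n ≤ C * (t m * t n ^ (α - 1)) := by
  obtain ⟨m₀, hbar⟩ := exists_barrier_of_large α r c hα hr hc
  have hG := gamma_one_sub_pos hα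
  have hc0 : 0 < c := by linarith
  refine ⟨2 * Real.Gamma (1 - α) * (c ^ 2 * ((max m₀ 1 : ℕ) : ℝ) ^ r), ?_, ?_⟩
  · have : (0 : ℝ) < ((max m₀ 1 : ℕ) : ℝ) := by exact_mod_cast (by omega : 0 < max m₀ 1)
    positivity
  intro τ N t h m hm hmN
  have ht := h.isTimeMesh
  have hM : 0 < t m := ht.pos hm hmN
  have hm0 : (0 : ℝ) < m := by exact_mod_cast hm
  set l : ℕ := max m (min m₀ N) with hl
  have hlN : l ≤ N := max_le hmN (min_le_right _ _)
  have hml : m ≤ l := le_max_left _ _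
  obtain ⟨V, hV0, hV1, hV2, hV3⟩ := hbar τ N t h l (hm.trans hml) hlN (by omega)
  refine ⟨V, hV0, hV1, fun j h1 h2 => hV2 j h1 (h2.trans hml), ?_⟩
  intro n hn hnN
  have htn := ht.pos hn hnN
  refine (hV3 n hn hnN).trans ?_
  have h1 := h.node_ratio hm hmN (hm.trans hml) hlN
  have h2 : (l : ℝ) / m ≤ ((max m₀ 1 : ℕ) : ℝ) := by
    rw [div_le_iff₀ hm0]
    have h3 : l ≤ max m₀ 1 * m := by
      refine max_le ?_ ?_
      · exact Nat.le_mul_of_pos_left m (by omega)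
      · calc min m₀ N ≤ m₀ := min_le_left _ _
          _ ≤ max m₀ 1 := le_max_left _ _
          _ ≤ _ := Nat.le_mul_of_pos_right _ (by omega)
    exact_mod_cast h3
  have h4 : ((l : ℝ) / m) ^ r ≤ ((max m₀ 1 : ℕ) : ℝ) ^ r :=
    Real.rpow_le_rpow (by positivity) h2 hr.le
  have h5 : t l ≤ c ^ 2 * ((max m₀ 1 : ℕ) : ℝ) ^ r * t m := h1.trans (by gcongr)
  have h6 := mul_le_mul_of_nonneg_right h5 (Real.rpow_nonneg htn.le (α - 1))
  have h7 := mul_le_mul_of_nonneg_left h6 (show 0 ≤ 2 * Real.Gamma (1 - α) by positivity)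
  linarith

end Barrier

/-! ### Responses to decreasing and to power-type sources -/

lemma sum_Ico_sub_succ (f : ℕ → ℝ) {j n : ℕ} (hjn : j ≤ n) :
    ∑ m ∈ Finset.Ico j n, (f m - f (m + 1)) = f j - f n := by
  induction n, hjn using Nat.le_induction with
  | base => simp
  | succ n hn ih => rw [Finset.sum_Ico_succ_top hn, ih]; ring

lemma sum_Icc_mul_timeStep (f t : ℕ → ℝ) (h0 : t 0 = 0) {n : ℕ} (hn : 1 ≤ n) :
    ∑ m ∈ Finset.Ico 1 n, (f m - f (m + 1)) * t m + f n * t n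
      = ∑ m ∈ Finset.Icc 1 n, f m * timeStep t m := by
  induction n, hn using Nat.le_induction with
  | base => simp [timeStep, h0]
  | succ n hn ih =>
    rw [Finset.sum_Ico_succ_top hn, Finset.sum_Icc_succ_top (by omega), ← ih, timeStep,
      Nat.add_sub_cancel]
    ring

/-- A nonnegative decreasing source is a nonnegative combination of the indicators of initial
segments; superposing their barriers and summing by parts bounds the response by
`C t_n^(α-1) ∑ f_m τ_m`. -/
lemma le_of_antitone_source (α r c : ℝ) (hα : α ∈ Ioo (0 : ℝ) 1) (hr : 0 < r) (hc : 1 ≤ c) :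
    ∃ C > 0, ∀ (τ : ℝ) (N : ℕ) (t : ℕ → ℝ), HasGrading r c τ N t →
      ∀ n, 1 ≤ n → n ≤ N → ∀ f w : ℕ → ℝ, (∀ j, 1 ≤ j → j < n → f (j + 1) ≤ f j) → 0 ≤ f n →
      w 0 ≤ 0 → (∀ j, 1 ≤ j → j ≤ n → discreteCaputo α t w j ≤ f j) →
      w n ≤ C * (t n ^ (α - 1) * ∑ m ∈ Finset.Icc 1 n, f m * timeStep t m) := by
  obtain ⟨C, hC, hbar⟩ := exists_barrier α r c hα hr hc
  refine ⟨C, hC, ?_⟩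
  intro τ N t h n hn hnN f w hf hfn hw0 hw
  have ht := h.isTimeMesh
  choose! V hV0 hV1 hV2 hV3 using hbar τ N t h
  set Z : ℕ → ℝ := fun k => (∑ m ∈ Finset.Ico 1 n, (f m - f (m + 1)) * V m k) + f n * V n k with hZ
  have hcoef : ∀ m ∈ Finset.Ico 1 n, 0 ≤ f m - f (m + 1) := fun m hm => by
    rw [Finset.mem_Ico] at hm
    exact sub_nonneg.2 (hf m hm.1 hm.2)
  have hDZ : ∀ j, discreteCaputo α t Z j = (∑ m ∈ Finset.Ico 1 n, (f m - f (m + 1))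
      * discreteCaputo α t (V m) j) + f n * discreteCaputo α t (V n) j := by
    intro j
    rw [hZ, discreteCaputo_add, discreteCaputo_sum, discreteCaputo_const_mul]
    simp only [discreteCaputo_const_mul]
  have hcmp := le_of_discreteCaputo_le hα (ht.mono hnN) (v := w) (w := Z)
    (by
      have : Z 0 = 0 := by
        simp only [hZ]
        rw [hV0 n hn hnN, mul_zero, add_zero]
        refine Finset.sum_eq_zero fun m hm => ?_
        rw [Finset.mem_Ico] at hm
        rw [hV0 m hm.1 (by omega), mul_zero]
      rw [this]; exact hw0)
    (fun j hj hjn => by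
      refine (hw j hj hjn).trans ?_
      rw [hDZ]
      have h1 : f n ≤ f n * discreteCaputo α t (V n) j :=
        le_mul_of_one_le_right hfn (hV2 n hn hnN j hj hjn)
      have h2 : ∑ m ∈ Finset.Ico j n, (f m - f (m + 1))
          ≤ ∑ m ∈ Finset.Ico j n, (f m - f (m + 1)) * discreteCaputo α t (V m) j := by
        refine Finset.sum_le_sum fun m hm => ?_
        rw [Finset.mem_Ico] at hm
        exact le_mul_of_one_le_right (sub_nonneg.2 (hf m (by omega) hm.2))
          (hV2 m (by omega) (by omega) j hj hm.1)
      have h3 : ∑ m ∈ Finset.Ico j n, (f m - f (m + 1)) * discreteCaputo α t (V m) j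
          ≤ ∑ m ∈ Finset.Ico 1 n, (f m - f (m + 1)) * discreteCaputo α t (V m) j := by
        refine Finset.sum_le_sum_of_subset_of_nonneg (Finset.Ico_subset_Ico_left hj) ?_
        intro m hm _
        have hm' := Finset.mem_Ico.1 hm
        exact mul_nonneg (hcoef m hm) (hV1 m hm'.1 (by omega) j hj (by omega))
      rw [sum_Ico_sub_succ f hjn] at h2
      linarith) n le_rfl
  refine hcmp.trans ?_
  have h4 : Z n ≤ (∑ m ∈ Finset.Ico 1 n, (f m - f (m + 1)) * (C * (t m * t n ^ (α - 1))))
      + f n * (C * (t n * t n ^ (α - 1))) := by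
    refine add_le_add (Finset.sum_le_sum fun m hm => ?_) ?_
    · have hm' := Finset.mem_Ico.1 hm
      exact mul_le_mul_of_nonneg_left (hV3 m hm'.1 (by omega) n hn hnN) (hcoef m hm)
    · exact mul_le_mul_of_nonneg_left (hV3 n hn hnN n hn hnN) hfn
  refine h4.trans (le_of_eq ?_)
  rw [← sum_Icc_mul_timeStep f t h.start hn, mul_add, mul_add, Finset.mul_sum, Finset.mul_sum]
  congr 1
  · exact Finset.sum_congr rfl fun m _ => by ring
  · ring

lemma IsTimeMesh.rpow_neg_antitone {N : ℕ} {t : ℕ → ℝ} (ht : IsTimeMesh N t) {q : ℝ} (hq : 0 ≤ q)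
    {i j : ℕ} (hi : 1 ≤ i) (hij : i ≤ j) (hj : j ≤ N) : t j ^ (-q) ≤ t i ^ (-q) :=
  Real.rpow_le_rpow_of_nonpos (ht.pos hi (hij.trans hj)) (ht.le_of_le hij hj) (by linarith)

/-- The right-endpoint sums of the decreasing function `s^(-q)` are at most its integral; the
integral over one step is compared through the tangent of the concave function `s^(1-q)`. -/
lemma sum_rpow_neg_mul_timeStep_le {N : ℕ} {t : ℕ → ℝ} (ht : IsTimeMesh N t) {q : ℝ} (hq0 : 0 ≤ q)
    (hq : q < 1) {n : ℕ} (hn : n ≤ N) :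
    ∑ m ∈ Finset.Icc 1 n, t m ^ (-q) * timeStep t m ≤ t n ^ (1 - q) / (1 - q) := by
  have h1q : 0 < 1 - q := by linarith
  induction n with
  | zero => simp [ht.start, Real.zero_rpow h1q.ne']
  | succ n ih =>
    rw [Finset.sum_Icc_succ_top (by omega)]
    have hx := ht.pos (show 1 ≤ n + 1 by omega) hn
    have hy := ht.nonneg (show n ≤ N by omega)
    have hstep : timeStep t (n + 1) = t (n + 1) - t n := rfl
    have hb := rpow_one_add_le_one_add_mul_self (s := t n / t (n + 1) - 1) (p := 1 - q)
      (by have : 0 ≤ t n / t (n + 1) := by positivity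
          linarith) h1q.le (by linarith)
    rw [add_sub_cancel, Real.div_rpow hy hx.le] at hb
    have hxp : 0 < t (n + 1) ^ (1 - q) := Real.rpow_pos_of_pos hx _
    have e : t (n + 1) ^ (1 - q) = t (n + 1) ^ (-q) * t (n + 1) := by
      rw [← Real.rpow_add_one hx.ne']; ring_nf
    have h2 : t n ^ (1 - q)
        ≤ t (n + 1) ^ (1 - q) - (1 - q) * (t (n + 1) ^ (-q) * timeStep t (n + 1)) := by
      rw [div_le_iff₀ hxp] at hb
      refine hb.trans (le_of_eq ?_)
      rw [hstep, e]
      field_simp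
      ring
    have h3 := ih (by omega)
    rw [le_div_iff₀ h1q] at h3 ⊢
    linarith

/-- An integrable power source `t_j^(-q)`, `q < 1`, has a response of order `t_n^(α-q)`. -/
lemma le_of_rpow_source_zero (α r c q : ℝ) (hα : α ∈ Ioo (0 : ℝ) 1) (hr : 0 < r) (hc : 1 ≤ c)
    (hq : q < 1) :
    ∃ C > 0, ∀ (τ : ℝ) (N : ℕ) (t : ℕ → ℝ), HasGrading r c τ N t →
      ∀ n, 1 ≤ n → n ≤ N → ∀ w : ℕ → ℝ, w 0 ≤ 0 →
      (∀ j, 1 ≤ j → j ≤ n → discreteCaputo α t w j ≤ t j ^ (-q)) → w n ≤ C * t n ^ (α - q) := by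
  rcases le_or_gt q 0 with hq0 | hq0
  · refine ⟨Real.Gamma (1 - α), gamma_one_sub_pos hα, ?_⟩
    intro τ N t h n hn hnN w hw0 hw
    have ht := h.isTimeMesh
    have htn := ht.pos hn hnN
    obtain ⟨y, hy0, hyY, hDy⟩ := exists_const_barrier hα ht hn hnN
      (Real.rpow_nonneg htn.le (-q))
    have := le_of_discreteCaputo_le hα (ht.mono hnN) (v := w) (w := y) (by rw [hy0]; exact hw0)
      (fun j hj hjn => (hw j hj hjn).trans (le_trans (Real.rpow_le_rpow
        (ht.nonneg (hjn.trans hnN)) (ht.le_of_le hjn hnN) (by linarith)) (hDy j hj hjn))) n le_rfl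
    refine this.trans ((hyY n).trans (le_of_eq ?_))
    rw [sub_eq_add_neg α q, Real.rpow_add htn, mul_assoc]
  · obtain ⟨C, hC, hant⟩ := le_of_antitone_source α r c hα hr hc
    have h1q : 0 < 1 - q := by linarith
    refine ⟨C / (1 - q), by positivity, ?_⟩
    intro τ N t h n hn hnN w hw0 hw
    have ht := h.isTimeMesh
    have htn := ht.pos hn hnN
    refine (hant τ N t h n hn hnN (fun j => t j ^ (-q)) w
      (fun j hj hjn => ht.rpow_neg_antitone hq0.le hj (by omega) (by omega))
      (Real.rpow_nonneg htn.le _) hw0 hw).trans ?_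
    have h1 := sum_rpow_neg_mul_timeStep_le ht hq0.le hq hnN
    have e : t n ^ (α - q) = t n ^ (α - 1) * t n ^ (1 - q) := by
      rw [← Real.rpow_add htn]; ring_nf
    calc _ ≤ C * (t n ^ (α - 1) * (t n ^ (1 - q) / (1 - q))) := by gcongr
      _ = _ := by rw [e]; ring

/-- The same with the reaction term `κ`. Each subtraction of the response for `κ = 0` turns the
source `t_j^(-q)` into `t_j^(α-q)`, so that after finitely many steps the source is bounded and the
discrete Grönwall inequality applies. -/
lemma le_of_rpow_source (α r c κ θ T : ℝ) (hα : α ∈ Ioo (0 : ℝ) 1) (hr : 0 < r) (hc : 1 ≤ c)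
    (hκ : 0 < κ) (hθ : θ < 1) (hT : 0 < T) (q : ℝ) (hq : q < 1) :
    ∃ C > 0, ∀ (τ : ℝ) (N : ℕ) (t : ℕ → ℝ), HasGrading r c τ N t → t N ≤ T →
      (∀ n, 1 ≤ n → n ≤ N → κ * Real.Gamma (2 - α) * timeStep t n ^ α ≤ θ) →
      ∀ n, 1 ≤ n → n ≤ N → ∀ (z : ℕ → ℝ) (A : ℝ), 0 ≤ A → z 0 ≤ 0 →
      (∀ j, 1 ≤ j → j ≤ n → discreteCaputo α t z j ≤ κ * z j + A * t j ^ (-q)) →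
      z n ≤ C * (A * t n ^ (α - q)) := by
  obtain ⟨i, hi⟩ : ∃ i : ℕ, q ≤ i * α := by
    obtain ⟨i, hi⟩ := exists_nat_ge (q / α)
    exact ⟨i, (div_le_iff₀ hα.1).1 hi⟩
  have hbase : ∀ q : ℝ, q ≤ 0 → ∃ C > 0, ∀ (τ : ℝ) (N : ℕ) (t : ℕ → ℝ),
      HasGrading r c τ N t → t N ≤ T →
      (∀ n, 1 ≤ n → n ≤ N → κ * Real.Gamma (2 - α) * timeStep t n ^ α ≤ θ) →
      ∀ n, 1 ≤ n → n ≤ N → ∀ (z : ℕ → ℝ) (A : ℝ), 0 ≤ A → z 0 ≤ 0 →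
      (∀ j, 1 ≤ j → j ≤ n → discreteCaputo α t z j ≤ κ * z j + A * t j ^ (-q)) →
      z n ≤ C * (A * t n ^ (α - q)) := by
    intro q hq
    obtain ⟨C, hC, hconst⟩ := le_of_const_source α κ θ T hα hκ hθ
    refine ⟨C, hC, ?_⟩
    intro τ N t h htN hstep n hn hnN z A hA hz0 hz
    have ht := h.isTimeMesh
    have htn := ht.pos hn hnN
    refine (hconst N t ht htN hstep n hn hnN z (A * t n ^ (-q)) (by positivity) hz0
      fun j hj hjn => (hz j hj hjn).trans ?_).trans (le_of_eq ?_)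
    · have h1 : t j ^ (-q) ≤ t n ^ (-q) := Real.rpow_le_rpow
        (ht.nonneg (hjn.trans hnN)) (ht.le_of_le hjn hnN) (by linarith)
      gcongr
    · rw [sub_eq_add_neg, Real.rpow_add htn]; ring
  induction i generalizing q with
  | zero => exact hbase q (by simpa using hi)
  | succ i ih =>
    rcases le_or_gt q 0 with hq0 | hq0
    · exact hbase q hq0
    obtain ⟨C₁, hC₁, h₁⟩ := le_of_rpow_source_zero α r c q hα hr hc hq
    obtain ⟨C₂, hC₂, h₂⟩ := ih (q - α) (by linarith [hα.1]) (by push_cast at hi; linarith)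
    refine ⟨C₁ + C₂ * (κ * C₁ * T ^ α), by positivity, ?_⟩
    intro τ N t h htN hstep n hn hnN z A hA hz0 hz
    have ht := h.isTimeMesh
    have htn := ht.pos hn hnN
    obtain ⟨B, hB0, hB⟩ := exists_discreteCaputo_eq (α := α) (N := N) (t := t) (κ := 0)
      (fun n h1 h2 => l1Kernel_pos hα ht h1 le_rfl h2) (fun j => t j ^ (-q))
    have hBle : ∀ j, 1 ≤ j → j ≤ N → B j ≤ C₁ * t j ^ (α - q) := fun j hj hjN =>
      h₁ τ N t h j hj hjN B hB0.le fun i hi hij => by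
        rw [hB i hi (hij.trans hjN), zero_mul, zero_add]
    have h3 := h₂ τ N t h htN hstep n hn hnN (fun j => z j - A * B j) (κ * (A * C₁))
      (by positivity) (by simpa [hB0] using hz0) (fun j hj hjn => by
        rw [discreteCaputo_sub, discreteCaputo_const_mul, hB j hj (hjn.trans hnN), neg_sub]
        have h4 := hz j hj hjn
        have h5 := mul_le_mul_of_nonneg_left (hBle j hj (hjn.trans hnN))
          (show 0 ≤ κ * A by positivity)
        linarith)
    have h6 := mul_le_mul_of_nonneg_left (hBle n hn hnN) hA
    have e : t n ^ (α - (q - α)) = t n ^ α * t n ^ (α - q) := by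
      rw [← Real.rpow_add htn]; ring_nf
    have h7 : t n ^ α ≤ T ^ α :=
      Real.rpow_le_rpow htn.le ((ht.le_of_le hnN le_rfl).trans htN) hα.1.le
    rw [e] at h3
    have h8 : C₂ * (κ * (A * C₁) * (t n ^ α * t n ^ (α - q)))
        ≤ C₂ * (κ * (A * C₁) * (T ^ α * t n ^ (α - q))) := by gcongr
    linarith

/-! ### Responses to powers of `τ / t_j` -/

lemma le_of_scale_source_of_lt_one (α r c p : ℝ) (hα : α ∈ Ioo (0 : ℝ) 1) (hr : 0 < r)
    (hc : 1 ≤ c) (hp : p < 1) :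
    ∃ C > 0, ∀ (τ : ℝ) (N : ℕ) (t : ℕ → ℝ), HasGrading r c τ N t →
      ∀ n, 1 ≤ n → n ≤ N → ∀ w : ℕ → ℝ, w 0 ≤ 0 →
      (∀ j, 1 ≤ j → j ≤ n → discreteCaputo α t w j ≤ (τ / t j) ^ p) →
      w n ≤ C * (τ ^ p * t n ^ (-(p - α))) := by
  obtain ⟨C, hC, hpow⟩ := le_of_rpow_source_zero α r c p hα hr hc hp
  refine ⟨C, hC, ?_⟩
  intro τ N t h n hn hnN w hw0 hw
  have hτ : 0 < τ ^ p := Real.rpow_pos_of_pos h.scale_pos _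
  have := hpow τ N t h n hn hnN (fun k => (τ ^ p)⁻¹ * w k)
    (mul_nonpos_of_nonneg_of_nonpos (by positivity) hw0) (fun j hj hjn => by
      rw [discreteCaputo_const_mul, inv_mul_le_iff₀ hτ]
      have htj := h.isTimeMesh.pos hj (hjn.trans hnN)
      refine (hw j hj hjn).trans (le_of_eq ?_)
      rw [Real.div_rpow h.scale_pos.le htj.le, Real.rpow_neg htj.le, div_eq_mul_inv])
  rw [inv_mul_le_iff₀ hτ] at this
  rw [neg_sub]
  linarith

lemma HasGrading.scale_div_antitone {r c τ : ℝ} {N : ℕ} {t : ℕ → ℝ} (h : HasGrading r c τ N t)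
    {p : ℝ} (hp : 0 ≤ p) {j : ℕ} (hj : 1 ≤ j) (hjN : j + 1 ≤ N) :
    (τ / t (j + 1)) ^ p ≤ (τ / t j) ^ p := by
  have h1 := h.isTimeMesh.pos hj (by omega)
  have h2 := h.isTimeMesh.pos (show 1 ≤ j + 1 by omega) hjN
  have h3 := h.isTimeMesh.le_of_le (show j ≤ j + 1 by omega) hjN
  have hτ := h.scale_pos
  refine Real.rpow_le_rpow (by positivity) ?_ hp
  gcongr

lemma le_of_scale_source_one (α r c : ℝ) (hα : α ∈ Ioo (0 : ℝ) 1) (hr : 0 < r) (hc : 1 ≤ c) :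
    ∃ C > 0, ∀ (τ : ℝ) (N : ℕ) (t : ℕ → ℝ), HasGrading r c τ N t →
      ∀ n, 1 ≤ n → n ≤ N → ∀ w : ℕ → ℝ, w 0 ≤ 0 →
      (∀ j, 1 ≤ j → j ≤ n → discreteCaputo α t w j ≤ (τ / t j) ^ (1 : ℝ)) →
      w n ≤ C * (τ * (1 + Real.log n) * t n ^ (-(1 - α))) := by
  obtain ⟨C, hC, hant⟩ := le_of_antitone_source α r c hα hr hc
  have hc0 : 0 < c := by linarith
  refine ⟨C * c ^ 2, by positivity, ?_⟩
  intro τ N t h n hn hnN w hw0 hw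
  have hτ := h.scale_pos
  have htn := h.isTimeMesh.pos hn hnN
  refine (hant τ N t h n hn hnN (fun j => (τ / t j) ^ (1 : ℝ)) w
    (fun j hj hjn => h.scale_div_antitone zero_le_one hj (by omega)) (by positivity) hw0 hw).trans ?_
  have h1 : ∑ m ∈ Finset.Icc 1 n, (τ / t m) ^ (1 : ℝ) * timeStep t m
      ≤ ∑ m ∈ Finset.Icc 1 n, τ * c ^ 2 * (m : ℝ)⁻¹ := by
    refine Finset.sum_le_sum fun m hm => ?_
    rw [Finset.mem_Icc] at hm
    have htm := h.isTimeMesh.pos hm.1 (hm.2.trans hnN)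
    have h2 := h.step_le hm.1 (hm.2.trans hnN)
    rw [Real.rpow_one]
    calc τ / t m * timeStep t m ≤ τ / t m * (c ^ 2 * (t m / m)) := by gcongr
      _ = _ := by field_simp
  have h3 := harmonic_le_one_add_log n
  rw [harmonic_eq_sum_Icc] at h3
  push_cast at h3
  rw [← Finset.mul_sum] at h1
  have h4 : ∑ m ∈ Finset.Icc 1 n, (τ / t m) ^ (1 : ℝ) * timeStep t m
      ≤ τ * c ^ 2 * (1 + Real.log n) := h1.trans (by gcongr)
  rw [neg_sub]
  calc _ ≤ C * (t n ^ (α - 1) * (τ * c ^ 2 * (1 + Real.log n))) := by gcongr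
    _ = _ := by ring

lemma le_of_scale_source_of_one_lt (α r c p : ℝ) (hα : α ∈ Ioo (0 : ℝ) 1) (hr : 0 < r)
    (hc : 1 ≤ c) (hp : 1 < p) :
    ∃ C > 0, ∀ (τ : ℝ) (N : ℕ) (t : ℕ → ℝ), HasGrading r c τ N t →
      ∀ n, 1 ≤ n → n ≤ N → ∀ w : ℕ → ℝ, w 0 ≤ 0 →
      (∀ j, 1 ≤ j → j ≤ n → discreteCaputo α t w j ≤ (τ / t j) ^ p) →
      w n ≤ C * (τ * t n ^ (-(1 - α))) := by
  obtain ⟨C, hC, hant⟩ := le_of_antitone_source α r c hα hr hc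
  have hc0 : 0 < c := by linarith
  set Z : ℝ := ∑' k : ℕ, (k : ℝ) ^ (-1 - r * (p - 1)) with hZ
  have hZ0 : 0 ≤ Z := tsum_nonneg fun k => Real.rpow_nonneg k.cast_nonneg _
  have hrp : 0 < r * (p - 1) := mul_pos hr (by linarith)
  refine ⟨C * (c ^ p * c * (Z + 1)), by positivity, ?_⟩
  intro τ N t h n hn hnN w hw0 hw
  have hτ := h.scale_pos
  have htn := h.isTimeMesh.pos hn hnN
  refine (hant τ N t h n hn hnN (fun j => (τ / t j) ^ p) w
    (fun j hj hjn => h.scale_div_antitone (by linarith) hj (by omega)) (by positivity) hw0 hw).trans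
    ?_
  have h1 : ∑ m ∈ Finset.Icc 1 n, (τ / t m) ^ p * timeStep t m
      ≤ ∑ m ∈ Finset.Icc 1 n, c ^ p * c * τ * (m : ℝ) ^ (-1 - r * (p - 1)) := by
    refine Finset.sum_le_sum fun m hm => ?_
    rw [Finset.mem_Icc] at hm
    have hmN := hm.2.trans hnN
    have hm0 : (0 : ℝ) < m := by exact_mod_cast hm.1
    have htm := h.isTimeMesh.pos hm.1 hmN
    have h2 := h.step_upper m hm.1 hmN
    have h3 : τ / t m ≤ c * (m : ℝ) ^ (-r) := by
      have := h.node_lower m hm.1 hmN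
      have hmr : (0 : ℝ) < (m : ℝ) ^ r := Real.rpow_pos_of_pos hm0 _
      rw [Real.rpow_neg hm0.le, div_le_iff₀ htm, mul_right_comm, ← div_eq_mul_inv, le_div_iff₀ hmr]
      exact this
    have h4 : (τ / t m) ^ p ≤ c ^ p * (m : ℝ) ^ (-r * p) := by
      rw [Real.rpow_mul hm0.le, ← Real.mul_rpow hc0.le (by positivity)]
      exact Real.rpow_le_rpow (by positivity) h3 (by linarith)
    have h5 : 0 ≤ timeStep t m := (h.isTimeMesh.step_pos m hm.1 hmN).le
    calc (τ / t m) ^ p * timeStep t m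
        ≤ (c ^ p * (m : ℝ) ^ (-r * p)) * (c * (τ * (m : ℝ) ^ (r - 1))) := by gcongr
      _ = c ^ p * c * τ * ((m : ℝ) ^ (-r * p) * (m : ℝ) ^ (r - 1)) := by ring
      _ = _ := by rw [← Real.rpow_add hm0]; ring_nf
  have h6 : ∑ m ∈ Finset.Icc 1 n, (m : ℝ) ^ (-1 - r * (p - 1)) ≤ Z + 1 := by
    have := sum_Ico_rpow_le (p := -1 - r * (p - 1)) (by linarith) 1 (n + 1)
    rw [Finset.Ico_add_one_right_eq_Icc] at this
    linarith
  rw [← Finset.mul_sum] at h1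
  have h7 : ∑ m ∈ Finset.Icc 1 n, (τ / t m) ^ p * timeStep t m ≤ c ^ p * c * τ * (Z + 1) :=
    h1.trans (by gcongr)
  rw [neg_sub]
  calc _ ≤ C * (t n ^ (α - 1) * (c ^ p * c * τ * (Z + 1))) := by gcongr
    _ = _ := by ring

/-! ### The temporal truncation error -/

section Truncation

lemma rpow_neg_mul_rpow_le {α β x s : ℝ} (hα : α ∈ Ioo (0 : ℝ) 1) (hβ : 0 < β) (hs : 0 < s)
    (hsx : s < x) : (x - s) ^ (-α) * s ^ (β - 1)
      ≤ 2 * (x ^ (-α) * s ^ (β - 1)) + 2 * (x ^ (β - 1) * (x - s) ^ (-α)) := by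
  have hx : 0 < x := hs.trans hsx
  have hxs : 0 < x - s := by linarith
  have p1 : 0 ≤ x ^ (-α) * s ^ (β - 1) := by positivity
  have p2 : 0 ≤ x ^ (β - 1) * (x - s) ^ (-α) := by positivity
  have hhalf : ∀ y : ℝ, x / 2 ≤ y → ∀ e : ℝ, -1 ≤ e → e ≤ 0 → y ^ e ≤ 2 * x ^ e := by
    intro y hy e he1 he0
    have h1 : y ^ e ≤ (x / 2) ^ e := Real.rpow_le_rpow_of_nonpos (by positivity) hy he0
    rw [Real.div_rpow hx.le (by norm_num), div_eq_mul_inv, ← Real.rpow_neg (by norm_num)] at h1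
    have h2 : (2 : ℝ) ^ (-e) ≤ 2 := by
      have := Real.rpow_le_rpow_of_exponent_le (x := (2 : ℝ)) (by norm_num) (show -e ≤ 1 by linarith)
      rwa [Real.rpow_one] at this
    have h3 : x ^ e * 2 ^ (-e) ≤ x ^ e * 2 := by gcongr
    linarith
  rcases le_total s (x / 2) with h | h
  · have h1 := hhalf (x - s) (by linarith) (-α) (by linarith [hα.2]) (by linarith [hα.1])
    have h2 := mul_le_mul_of_nonneg_right h1 (Real.rpow_nonneg hs.le (β - 1))
    linarith
  · have h1 : s ^ (β - 1) ≤ 2 * x ^ (β - 1) := by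
      rcases le_total (β - 1) 0 with hb | hb
      · exact hhalf s h (β - 1) (by linarith) hb
      · have h2 : s ^ (β - 1) ≤ x ^ (β - 1) := Real.rpow_le_rpow hs.le hsx.le hb
        have h3 : 0 < x ^ (β - 1) := by positivity
        linarith
    have h2 := mul_le_mul_of_nonneg_left h1 (Real.rpow_nonneg hxs.le (-α))
    linarith

lemma integral_const_mul_rpow {β K b : ℝ} (hβ : 0 < β) :
    ∫ s in (0 : ℝ)..b, K * s ^ (β - 1) = K * b ^ β / β := by
  rw [intervalIntegral.integral_const_mul, integral_rpow (Or.inl (by linarith)), sub_add_cancel,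
    Real.zero_rpow hβ.ne', sub_zero, mul_div_assoc]

variable {X : Type*} [NormedAddCommGroup X] [NormedSpace ℝ X]

lemma temporalTruncation_eq (α : ℝ) (t : ℕ → ℝ) (u : ℝ → X) (n : ℕ) :
    temporalTruncation α t u n = (Real.Gamma (1 - α))⁻¹ •
      ((∑ k ∈ Finset.Icc 1 n, ((∫ s in (t (k - 1))..(t k), (t n - s) ^ (-α)) / timeStep t k)
          • (u (t k) - u (t (k - 1))))
        - ∫ s in (0 : ℝ)..(t n), (t n - s) ^ (-α) • deriv u s) := by
  rw [temporalTruncation, discreteCaputo, caputoDeriv, smul_sub, Finset.smul_sum,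
    ← intervalIntegral.integral_smul]
  congr 1
  · refine Finset.sum_congr rfl fun k _ => ?_
    rw [l1Kernel_eq_integral, smul_smul]
    congr 1
    ring
  · refine intervalIntegral.integral_congr fun s _ => ?_
    rw [gelfandShilov_one_sub, smul_smul]
    congr 1
    ring

lemma HasWeakSingularity.intervalIntegrable_smul_deriv {T β K : ℝ} {u : ℝ → X}
    (hu : HasWeakSingularity T β K u) {α x b : ℝ} (hα : α ∈ Ioo (0 : ℝ) 1) (hβ : 0 < β)
    (hb0 : 0 < b) (hbx : b ≤ x) (hxT : x ≤ T) :
    IntervalIntegrable (fun s => (x - s) ^ (-α) • deriv u s) volume 0 b ∧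
    ‖∫ s in (0 : ℝ)..b, (x - s) ^ (-α) • deriv u s‖
      ≤ ∫ s in (0 : ℝ)..b, K * (2 * (x ^ (-α) * s ^ (β - 1)) + 2 * (x ^ (β - 1) * (x - s) ^ (-α))) := by
  have hsub : Ioo 0 b ⊆ Ioo 0 T := Ioo_subset_Ioo le_rfl (hbx.trans hxT)
  have hi : IntervalIntegrable (fun s : ℝ => s ^ (β - 1)) volume 0 b :=
    intervalIntegral.intervalIntegrable_rpow' (by linarith)
  have hg : IntervalIntegrable (fun s : ℝ => K * (2 * (x ^ (-α) * s ^ (β - 1))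
      + 2 * (x ^ (β - 1) * (x - s) ^ (-α)))) volume 0 b :=
    (((hi.const_mul _).const_mul _).add
      (((intervalIntegrable_sub_rpow_neg hα.2 x 0 b).const_mul _).const_mul _)).const_mul _
  have hK : 0 ≤ K := by
    have h1 := (norm_nonneg _).trans (hu.bound_one (b / 2) (hsub ⟨by linarith, by linarith⟩))
    exact nonneg_of_mul_nonneg_left h1 (Real.rpow_pos_of_pos (by linarith) _)
  have hle : ∀ s ∈ Ioo 0 b, ‖(x - s) ^ (-α) • deriv u s‖ ≤ K * (2 * (x ^ (-α) * s ^ (β - 1))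
      + 2 * (x ^ (β - 1) * (x - s) ^ (-α))) := by
    intro s hs
    have hw : 0 ≤ (x - s) ^ (-α) := Real.rpow_nonneg (by linarith [hs.2]) _
    rw [norm_smul, Real.norm_of_nonneg hw]
    have h1 := mul_le_mul_of_nonneg_left (hu.bound_one s (hsub hs)) hw
    have h2 := mul_le_mul_of_nonneg_left
      (rpow_neg_mul_rpow_le hα hβ hs.1 (by linarith [hs.2] : s < x)) hK
    linarith
  refine ⟨intervalIntegrable_of_norm_le_Ioo hb0.le (ContinuousOn.smul ?_
    (hu.diff_two.continuousOn.mono hsub)) hg hle, norm_integral_le_of_norm_le_Ioo hb0.le hg hle⟩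
  exact ContinuousOn.rpow_const (by fun_prop) fun s hs => Or.inl (by linarith [hs.2])

variable [CompleteSpace X]

/-- The quadrature error on the first interval, at level `1` and at the later levels. -/
lemma HasWeakSingularity.first_interval_le {T β K : ℝ} {u : ℝ → X}
    (hu : HasWeakSingularity T β K u) {α x b : ℝ} (hα : α ∈ Ioo (0 : ℝ) 1) (hβ : 0 < β)
    (hb0 : 0 < b) (hbx : b ≤ x) (hxT : x ≤ T) :
    (b < x → ‖((∫ s in (0 : ℝ)..b, (x - s) ^ (-α)) / (b - 0)) • (u b - u 0)
        - ∫ s in (0 : ℝ)..b, (x - s) ^ (-α) • deriv u s‖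
      ≤ 2 * K / β * (b ^ (1 + β) * (x - b) ^ (-α - 1))) ∧
    (b = x → ‖((∫ s in (0 : ℝ)..b, (x - s) ^ (-α)) / (b - 0)) • (u b - u 0)
        - ∫ s in (0 : ℝ)..b, (x - s) ^ (-α) • deriv u s‖
      ≤ K * (1 / (β * (1 - α)) + 2 / β + 2 / (1 - α)) * b ^ (β - α)) := by
  have hbT := hbx.trans hxT
  have hsub : Ioo 0 b ⊆ Ioo 0 T := Ioo_subset_Ioo le_rfl hbT
  have hi : IntervalIntegrable (fun s : ℝ => s ^ (β - 1)) volume 0 b :=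
    intervalIntegral.intervalIntegrable_rpow' (by linarith)
  have hK : 0 ≤ K := by
    have h1 := (norm_nonneg _).trans (hu.bound_one (b / 2) (hsub ⟨by linarith, by linarith⟩))
    exact nonneg_of_mul_nonneg_left h1 (Real.rpow_pos_of_pos (by linarith) _)
  have hcont := hu.cont.mono (Icc_subset_Icc_right hbT)
  have hb1 : ∀ s ∈ Ioo 0 b, ‖deriv u s‖ ≤ K * s ^ (β - 1) := fun s hs => hu.bound_one s (hsub hs)
  have hc2 := hu.diff_two.continuousOn.mono hsub
  have h1α : 0 < 1 - α := by linarith [hα.2]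
  constructor
  · intro hlt
    have h1 := norm_average_smul_sub_integral_le_of_integrable hα hb0 hlt hcont
      (hu.diff_one.mono hsub) hc2 (hi.const_mul K) hb1 (integral_const_mul_rpow hβ).le
    refine h1.trans ?_
    have h2 := rpow_neg_sub_le hα (sub_pos.2 hlt) (show x - b ≤ x - 0 by linarith)
    rw [show x - 0 - (x - b) = b by ring] at h2
    have hbβ : b ^ (1 + β) = b ^ β * b := by rw [add_comm, Real.rpow_add_one hb0.ne']
    calc _ ≤ 2 * (K * b ^ β / β) * ((x - b) ^ (-α - 1) * b) := by gcongr
      _ = _ := by rw [hbβ]; ring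
  · intro heq
    subst heq
    have hd : ‖u b - u 0‖ ≤ K * b ^ β / β := by
      rw [← integral_deriv_eq_sub_Ioo hb0.le hcont (hu.diff_one.mono hsub)
        (intervalIntegrable_of_norm_le_Ioo hb0.le hc2 (hi.const_mul K) hb1),
        ← integral_const_mul_rpow hβ]
      exact norm_integral_le_of_norm_le_Ioo hb0.le (hi.const_mul K) hb1
    have h2 := (hu.intervalIntegrable_smul_deriv hα hβ hb0 le_rfl hbT).2
    have hbα : b ^ (β - α) = b ^ (-α) * b ^ β := by rw [← Real.rpow_add hb0]; ring_nf
    have hb1α : b ^ (1 - α) = b ^ (-α) * b := by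
      rw [← Real.rpow_add_one hb0.ne']; ring_nf
    have hbβ : b ^ β = b ^ (β - 1) * b := by
      rw [← Real.rpow_add_one hb0.ne']; ring_nf
    have hint : ∫ s in (0 : ℝ)..b, (b - s) ^ (-α) = b ^ (1 - α) / (1 - α) := by
      rw [integral_sub_rpow_neg hα.2, sub_self, Real.zero_rpow h1α.ne', sub_zero, sub_zero]
    have h3 : ∫ s in (0 : ℝ)..b, K * (2 * (b ^ (-α) * s ^ (β - 1))
        + 2 * (b ^ (β - 1) * (b - s) ^ (-α))) = K * (2 / β + 2 / (1 - α)) * b ^ (β - α) := by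
      rw [intervalIntegral.integral_const_mul, intervalIntegral.integral_add
        ((hi.const_mul _).const_mul _)
        (((intervalIntegrable_sub_rpow_neg hα.2 b 0 b).const_mul _).const_mul _),
        intervalIntegral.integral_const_mul, intervalIntegral.integral_const_mul,
        intervalIntegral.integral_const_mul, intervalIntegral.integral_const_mul, hint,
        integral_rpow (Or.inl (by linarith)), sub_add_cancel, Real.zero_rpow hβ.ne', hbα, hb1α, hbβ]
      field_simp
      ring
    rw [h3] at h2
    have h4 : ‖((∫ s in (0 : ℝ)..b, (b - s) ^ (-α)) / (b - 0)) • (u b - u 0)‖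
        ≤ K * (1 / (β * (1 - α))) * b ^ (β - α) := by
      rw [hint, sub_zero, norm_smul, Real.norm_of_nonneg (by positivity)]
      calc _ ≤ b ^ (1 - α) / (1 - α) / b * (K * b ^ β / β) := by gcongr
        _ = _ := by rw [hbα, hb1α]; field_simp
    refine (norm_sub_le _ _).trans ((add_le_add h4 h2).trans (le_of_eq ?_))
    ring

end Truncation

lemma HasGrading.rpow_neg_index_le {r c τ : ℝ} {N : ℕ} {t : ℕ → ℝ} (h : HasGrading r c τ N t)
    (hr : 0 < r) {a : ℝ} (ha : 0 ≤ a) {k : ℕ} (hk : 1 ≤ k) (hkN : k ≤ N) :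
    (k : ℝ) ^ (-a) ≤ c ^ (a / r) * (τ ^ (a / r) * t k ^ (-(a / r))) := by
  have hc : 0 < c := by linarith [h.one_le]
  have hτ := h.scale_pos
  have hk0 : (0 : ℝ) < k := by exact_mod_cast hk
  have htk := h.isTimeMesh.pos hk hkN
  have h1 := h.node_upper k hk hkN
  have h2 : ((k : ℝ) ^ r)⁻¹ ≤ c * τ / t k := by
    rw [inv_le_iff_one_le_mul₀ (by positivity), mul_comm, ← mul_div_assoc, one_le_div htk]
    linarith
  have h3 := Real.rpow_le_rpow (by positivity) h2 (show 0 ≤ a / r by positivity)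
  rw [← Real.rpow_neg hk0.le, ← Real.rpow_mul hk0.le, Real.div_rpow (by positivity) htk.le,
    Real.mul_rpow hc.le hτ.le, show -r * (a / r) = -a by field_simp] at h3
  rw [Real.rpow_neg htk.le]
  refine h3.trans (le_of_eq ?_)
  ring

/-- The truncation error consists of the contribution of the first step, of relative size
`(τ / t_n)^(1+α)`, and of the later steps. -/
lemma norm_temporalTruncation_le (α β r c T K : ℝ) (hα : α ∈ Ioo (0 : ℝ) 1) (hβ : 0 < β)
    (hβ2 : β ≤ 2) (hr : 0 < r) (hc : 1 ≤ c) :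
    ∃ C > 0, ∀ (X : Type*) [NormedAddCommGroup X] [NormedSpace ℝ X] [CompleteSpace X]
      (τ : ℝ) (N : ℕ) (t : ℕ → ℝ) (u : ℝ → X), HasGrading r c τ N t → t N ≤ T →
      HasWeakSingularity T β K u → ∀ n, 1 ≤ n → n ≤ N →
      ‖temporalTruncation α t u n‖ ≤ C * (τ ^ (1 + β) * t n ^ (-1 - α)
        + τ ^ ((2 - α) / r) * t n ^ (β - α - (2 - α) / r)) := by
  obtain ⟨C, hC, hquad⟩ := norm_sum_average_sub_integral_le α r c (2 - β) hα hr hc (by linarith)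
  have hG := gamma_one_sub_pos hα
  have h1α : 0 < 1 - α := by linarith [hα.2]
  have hc0 : 0 < c := by linarith
  set ρ : ℝ := (2 - α) / r with hρ
  have hρ0 : 0 < ρ := div_pos (by linarith) hr
  set e : ℝ := 1 + β - ρ with he
  set Z : ℝ := ∑' k : ℕ, (k : ℝ) ^ (-1 - α) with hZ
  have hZ0 : 0 ≤ Z := tsum_nonneg fun k => Real.rpow_nonneg k.cast_nonneg _
  set D' : ℝ := c ^ 2 * 2 ^ (r + 1) with hD'
  have hD'0 : 0 < D' := by positivity
  set C₀ : ℝ := |K| * (1 / (β * (1 - α)) + 2 / β + 2 / (1 - α)) * c ^ (1 + β) with hC₀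
  set C₁ : ℝ := 2 * |K| / β * (c ^ (1 + β) * D' ^ (1 + α)) with hC₁
  set C₂ : ℝ := C * |K| * (c ^ ρ + c ^ ρ * c ^ |e| * Z) with hC₂
  have hC₀' : 0 ≤ C₀ := by positivity
  have hC₁' : 0 ≤ C₁ := by positivity
  have hC₂' : 0 ≤ C₂ := by positivity
  refine ⟨(Real.Gamma (1 - α))⁻¹ * (C₀ + C₁ + C₂ + 1), by positivity, ?_⟩
  intro X _ _ _ τ N t u h htN hu n hn hnN
  have ht := h.isTimeMesh
  have hτ := h.scale_pos
  have htn := ht.pos hn hnN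
  have hn0 : (0 : ℝ) < n := by exact_mod_cast hn
  have htnT : t n ≤ T := (ht.le_of_le hnN le_rfl).trans htN
  have ht1 := ht.pos le_rfl (hn.trans hnN)
  have hK : 0 ≤ K := by
    have h1 := (norm_nonneg _).trans (hu.bound_one (t n / 2) ⟨by linarith, by linarith⟩)
    exact nonneg_of_mul_nonneg_left h1 (Real.rpow_pos_of_pos (by linarith) _)
  have hKabs : |K| = K := abs_of_nonneg hK
  set F₁ : ℝ := τ ^ (1 + β) * t n ^ (-1 - α) with hF₁
  set F₂ : ℝ := τ ^ ρ * t n ^ (β - α - ρ) with hF₂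
  have hF₁0 : 0 < F₁ := by positivity
  have hF₂0 : 0 < F₂ := by positivity
  rw [temporalTruncation_eq, norm_smul, Real.norm_of_nonneg (inv_pos.2 hG).le, mul_assoc]
  refine mul_le_mul_of_nonneg_left ?_ (inv_pos.2 hG).le
  have ht1c : t 1 ≤ c * τ := by
    have := h.node_upper 1 le_rfl (hn.trans hnN)
    simpa using this
  have ht1β : t 1 ^ (1 + β) ≤ c ^ (1 + β) * τ ^ (1 + β) := by
    rw [← Real.mul_rpow hc0.le hτ.le]
    exact Real.rpow_le_rpow ht1.le ht1c (by linarith)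
  have hfirst := hu.first_interval_le hα hβ ht1 (ht.le_of_le hn hnN) htnT
  rcases hn.eq_or_lt with h1 | h1
  · subst h1
    have h2 := hfirst.2 rfl
    rw [Finset.Icc_self, Finset.sum_singleton, Nat.sub_self, h.start]
    rw [show timeStep t 1 = t 1 - 0 by rw [timeStep, Nat.sub_self, h.start]]
    refine h2.trans ?_
    have h3 : t 1 ^ (β - α) ≤ c ^ (1 + β) * F₁ := by
      have e1 : t 1 ^ (β - α) = t 1 ^ (1 + β) * t 1 ^ (-1 - α) := by
        rw [← Real.rpow_add ht1]; ring_nf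
      rw [e1, hF₁, ← mul_assoc]
      gcongr
    have h4 : K * (1 / (β * (1 - α)) + 2 / β + 2 / (1 - α)) * t 1 ^ (β - α) ≤ C₀ * F₁ := by
      calc _ ≤ K * (1 / (β * (1 - α)) + 2 / β + 2 / (1 - α)) * (c ^ (1 + β) * F₁) := by gcongr
        _ = _ := by rw [hC₀, hKabs]; ring
    have h5 : 0 ≤ (C₁ + C₂ + 1) * F₁ := by positivity
    have h6 : 0 ≤ (C₀ + C₁ + C₂ + 1) * F₂ := by positivity
    linarith
  · have hq := hquad X τ N t h 1 n le_rfl h1 hnN u K hK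
      (hu.cont.mono (Icc_subset_Icc ht1.le htnT)) (hu.diff_one.mono (Ioo_subset_Ioo ht1.le htnT))
      (hu.diff_two.mono (Ioo_subset_Ioo ht1.le htnT))
      (fun s hs => by
        rw [neg_sub]
        exact hu.bound_two s ⟨ht1.trans hs.1, hs.2.trans_le htnT⟩)
    have hlt : t 1 < t n := ht.lt_of_lt h1 hnN
    have h2 := hfirst.1 hlt
    have hi1 := (hu.intervalIntegrable_smul_deriv hα hβ ht1 hlt.le htnT).1
    -- the first interval
    have b1 : 2 * K / β * (t 1 ^ (1 + β) * (t n - t 1) ^ (-α - 1)) ≤ C₁ * F₁ := by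
      have h3 := h.node_le_sub hr (show 2 * 1 ≤ n by omega) hn hnN
      have h4 : D'⁻¹ * t n ≤ t n - t 1 := by rwa [inv_mul_le_iff₀ hD'0]
      have h5 := Real.rpow_le_rpow_of_nonpos (z := -α - 1) (by positivity) h4 (by linarith [hα.1])
      rw [Real.mul_rpow (by positivity) htn.le, Real.inv_rpow hD'0.le,
        ← Real.rpow_neg hD'0.le, show -(-α - 1) = 1 + α by ring,
        show t n ^ (-α - 1) = t n ^ (-1 - α) by ring_nf] at h5
      calc _ ≤ 2 * K / β * ((c ^ (1 + β) * τ ^ (1 + β)) * (D' ^ (1 + α) * t n ^ (-1 - α))) := by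
            gcongr
        _ = _ := by rw [hC₁, hKabs, hF₁]; ring
    -- the local contribution of the later intervals
    have b2 : t n ^ (2 - α - (2 - β)) * (n : ℝ) ^ (-(2 - α)) ≤ c ^ ρ * F₂ := by
      have h3 := h.rpow_neg_index_le hr (show 0 ≤ 2 - α by linarith) hn hnN
      have e1 : t n ^ (β - α - ρ) = t n ^ (2 - α - (2 - β)) * t n ^ (-ρ) := by
        rw [← Real.rpow_add htn]; ring_nf
      rw [hF₂, e1]
      calc _ ≤ t n ^ (2 - α - (2 - β)) * (c ^ ρ * (τ ^ ρ * t n ^ (-ρ))) := by gcongr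
        _ = _ := by ring
    -- and their contribution from the past
    have b3 : t n ^ (-1 - α) * ∑ k ∈ Finset.Ico (1 + 1) n, t k ^ (3 - (2 - β)) * (k : ℝ) ^ (-3 : ℝ)
        ≤ c ^ ρ * c ^ |e| * Z * (F₁ + F₂) := by
      have h3 : ∑ k ∈ Finset.Ico (1 + 1) n, t k ^ (3 - (2 - β)) * (k : ℝ) ^ (-3 : ℝ)
          ≤ ∑ k ∈ Finset.Ico (1 + 1) n,
            c ^ ρ * c ^ |e| * (τ ^ ρ * (τ ^ e + t n ^ e)) * (k : ℝ) ^ (-1 - α) := by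
        refine Finset.sum_le_sum fun k hk => ?_
        rw [Finset.mem_Ico] at hk
        have hk1 : 1 ≤ k := by omega
        have hkN : k ≤ N := by omega
        have hk0 : (0 : ℝ) < k := by exact_mod_cast hk1
        have htk := ht.pos hk1 hkN
        have h4 := h.rpow_neg_index_le hr (show 0 ≤ 2 - α by linarith) hk1 hkN
        have hce : 1 ≤ c ^ |e| := Real.one_le_rpow hc (abs_nonneg _)
        have h5 : t k ^ e ≤ c ^ |e| * (τ ^ e + t n ^ e) := by
          have q1 : 0 < τ ^ e := by positivity
          have q2 : 0 < t n ^ e := by positivity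
          rcases le_total 0 e with he0 | he0
          · have h6 : t k ^ e ≤ t n ^ e := Real.rpow_le_rpow htk.le (ht.le_of_le hk.2.le hnN) he0
            calc t k ^ e ≤ 1 * (τ ^ e + t n ^ e) := by linarith
              _ ≤ _ := by gcongr
          · have h7 : c⁻¹ * τ ≤ t k := by
              rw [inv_mul_le_iff₀ hc0]
              refine le_trans ?_ (h.node_lower k hk1 hkN)
              exact le_mul_of_one_le_right hτ.le
                (Real.one_le_rpow (by exact_mod_cast hk1) hr.le)
            have h8 := Real.rpow_le_rpow_of_nonpos (by positivity) h7 he0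
            rw [Real.mul_rpow (by positivity) hτ.le, Real.inv_rpow hc0.le,
              ← Real.rpow_neg hc0.le, ← abs_of_nonpos he0] at h8
            refine h8.trans ?_
            gcongr
            linarith
        have e1 : t k ^ (3 - (2 - β)) * t k ^ (-ρ) = t k ^ e := by
          rw [← Real.rpow_add htk, he]; ring_nf
        have e2 : (k : ℝ) ^ (-3 : ℝ) = (k : ℝ) ^ (-(2 - α)) * (k : ℝ) ^ (-1 - α) := by
          rw [← Real.rpow_add hk0]; ring_nf
        calc t k ^ (3 - (2 - β)) * (k : ℝ) ^ (-3 : ℝ)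
            = t k ^ (3 - (2 - β)) * (k : ℝ) ^ (-(2 - α)) * (k : ℝ) ^ (-1 - α) := by
              rw [e2]; ring
          _ ≤ t k ^ (3 - (2 - β)) * (c ^ ρ * (τ ^ ρ * t k ^ (-ρ))) * (k : ℝ) ^ (-1 - α) := by
              gcongr
          _ = c ^ ρ * τ ^ ρ * (t k ^ (3 - (2 - β)) * t k ^ (-ρ)) * (k : ℝ) ^ (-1 - α) := by ring
          _ = c ^ ρ * τ ^ ρ * t k ^ e * (k : ℝ) ^ (-1 - α) := by rw [e1]
          _ ≤ c ^ ρ * τ ^ ρ * (c ^ |e| * (τ ^ e + t n ^ e)) * (k : ℝ) ^ (-1 - α) := by gcongr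
          _ = _ := by ring
      rw [← Finset.mul_sum] at h3
      have h9 := sum_Ico_rpow_le (p := -1 - α) (by linarith [hα.1]) (1 + 1) n
      have e3 : τ ^ ρ * (τ ^ e + t n ^ e) * t n ^ (-1 - α) = F₁ + F₂ := by
        have e4 : τ ^ ρ * τ ^ e = τ ^ (1 + β) := by rw [← Real.rpow_add hτ, he]; ring_nf
        have e5 : t n ^ e * t n ^ (-1 - α) = t n ^ (β - α - ρ) := by
          rw [← Real.rpow_add htn, he]; ring_nf
        rw [hF₁, hF₂, ← e4, ← e5]; ring
      calc _ ≤ t n ^ (-1 - α) * (c ^ ρ * c ^ |e| * (τ ^ ρ * (τ ^ e + t n ^ e)) * Z) := by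
            gcongr
            exact h3.trans (by gcongr)
        _ = c ^ ρ * c ^ |e| * Z * (τ ^ ρ * (τ ^ e + t n ^ e) * t n ^ (-1 - α)) := by ring
        _ = _ := by rw [e3]
    have hsum : (∑ k ∈ Finset.Icc 1 n, ((∫ s in (t (k - 1))..(t k), (t n - s) ^ (-α))
          / timeStep t k) • (u (t k) - u (t (k - 1))))
        - ∫ s in (0 : ℝ)..(t n), (t n - s) ^ (-α) • deriv u s
        = (((∫ s in (0 : ℝ)..(t 1), (t n - s) ^ (-α)) / (t 1 - 0)) • (u (t 1) - u 0)
          - ∫ s in (0 : ℝ)..(t 1), (t n - s) ^ (-α) • deriv u s)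
        + ((∑ k ∈ Finset.Ico (1 + 1) (n + 1), ((∫ s in (t (k - 1))..(t k), (t n - s) ^ (-α))
          / timeStep t k) • (u (t k) - u (t (k - 1))))
          - ∫ s in (t 1)..(t n), (t n - s) ^ (-α) • deriv u s) := by
      rw [← intervalIntegral.integral_add_adjacent_intervals hi1 hq.1,
        ← Finset.Ico_add_one_right_eq_Icc, Finset.sum_eq_sum_Ico_succ_bot (by omega),
        Nat.sub_self, h.start, show timeStep t 1 = t 1 - 0 by rw [timeStep, Nat.sub_self, h.start]]
      abel
    rw [hsum]
    refine (norm_add_le _ _).trans ((add_le_add (h2.trans b1) (hq.2.trans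
      (mul_le_mul_of_nonneg_left (add_le_add b2 b3) (by positivity)))).trans ?_)
    have g1 : C * K * (c ^ ρ * F₂ + c ^ ρ * c ^ |e| * Z * (F₁ + F₂)) ≤ C₂ * (F₁ + F₂) := by
      have g2 : 0 ≤ C * K * (c ^ ρ * F₁) := by positivity
      rw [hC₂, hKabs]
      linarith
    have g3 : 0 ≤ (C₀ + 1) * F₁ := by positivity
    have g4 : 0 ≤ (C₀ + C₁ + 1) * F₂ := by positivity
    linarith

/-! ### The error bound -/

lemma abs_le_iSup_fin (Th : ℕ → ℝ) {j n : ℕ} (hj : 1 ≤ j) (hjn : j ≤ n) :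
    |Th j| ≤ ⨆ i : Fin n, |Th (i + 1)| := by
  have h := le_ciSup (f := fun i : Fin n => |Th (i + 1)|) (Set.finite_range _).bddAbove
    ⟨j - 1, by omega⟩
  simpa [Nat.sub_add_cancel hj] using h

/-- If the responses for `κ = 0` to the source `(τ / t_j)^p` are bounded by `Φ(τ, n) t_n^(-q)` with
`q < 1`, then solutions of the inequality with reaction term and source `A (τ / t_j)^p` obey the
same bound, up to the contribution of the data. -/
lemma le_add_dataError (α r c κ θ T p q : ℝ) (hα : α ∈ Ioo (0 : ℝ) 1) (hr : 0 < r) (hc : 1 ≤ c)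
    (hκ : 0 < κ) (hθ : θ < 1) (hT : 0 < T) (hq : q < 1) (Φ : ℝ → ℕ → ℝ)
    (hΦ0 : ∀ τ n, 0 < τ → 1 ≤ n → 0 ≤ Φ τ n)
    (hΦ : ∀ τ j n, 0 < τ → 1 ≤ j → j ≤ n → Φ τ j ≤ Φ τ n)
    (hresp : ∃ C > 0, ∀ (τ : ℝ) (N : ℕ) (t : ℕ → ℝ), HasGrading r c τ N t →
      ∀ n, 1 ≤ n → n ≤ N → ∀ w : ℕ → ℝ, w 0 ≤ 0 →
      (∀ j, 1 ≤ j → j ≤ n → discreteCaputo α t w j ≤ (τ / t j) ^ p) →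
      w n ≤ C * (Φ τ n * t n ^ (-q))) :
    ∃ C > 0, ∀ (τ : ℝ) (N : ℕ) (t E Th : ℕ → ℝ) (A : ℝ), HasGrading r c τ N t → t N ≤ T →
      (∀ n, 1 ≤ n → n ≤ N → κ * Real.Gamma (2 - α) * timeStep t n ^ α ≤ θ) →
      0 ≤ A → 0 ≤ E 0 →
      (∀ n, 1 ≤ n → n ≤ N →
        discreteCaputo α t E n ≤ κ * E n + |Th n| + A * (τ / t n) ^ p) →
      ∀ n, 1 ≤ n → n ≤ N → E n ≤ C * (A * (Φ τ n * t n ^ (-q)) + dataError α t E Th n) := by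
  obtain ⟨C₀, hC₀, h₀⟩ := hresp
  obtain ⟨C₁, hC₁, h₁⟩ := le_of_const_source α κ θ T hα hκ hθ
  obtain ⟨C₂, hC₂, h₂⟩ := le_of_rpow_source α r c κ θ T hα hr hc hκ hθ hT q hq
  have hTα : 0 < T ^ α := Real.rpow_pos_of_pos hT _
  refine ⟨1 + C₁ * κ * T ^ α + C₁ + C₀ + C₂ * κ * C₀ * T ^ α, by positivity, ?_⟩
  intro τ N t E Th A h htN hstep hA hE0 hE n hn hnN
  have ht := h.isTimeMesh
  have hτ := h.scale_pos
  have htn := ht.pos hn hnN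
  have htnα : t n ^ α ≤ T ^ α :=
    Real.rpow_le_rpow htn.le ((ht.le_of_le hnN le_rfl).trans htN) hα.1.le
  set g : ℝ := ⨆ i : Fin n, |Th (i + 1)| with hg
  have hg0 : 0 ≤ g := (abs_nonneg _).trans (abs_le_iSup_fin Th le_rfl hn)
  have hdiag : ∀ j, 1 ≤ j → j ≤ n → κ < l1Kernel α t j j := fun j h1 h2 =>
    lt_l1Kernel_self hα hκ hθ ht hstep h1 (h2.trans hnN)
  -- the responses to the truncation error, to the data, and to the feedback of the former
  obtain ⟨B, hB0, hB⟩ := exists_discreteCaputo_eq (α := α) (N := n) (t := t) (κ := 0)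
    (fun j h1 h2 => hκ.trans (hdiag j h1 h2)) (fun j => (τ / t j) ^ p)
  obtain ⟨w₁, hw₁0, hw₁⟩ := exists_discreteCaputo_eq hdiag (fun _ => κ * E 0 + g)
  obtain ⟨w₂, hw₂0, hw₂⟩ := exists_discreteCaputo_eq hdiag (fun j => κ * (A * B j))
  have hBle : ∀ j, 1 ≤ j → j ≤ n → B j ≤ C₀ * (Φ τ n * t j ^ (-q)) := fun j hj hjn => by
    have htj := ht.pos hj (hjn.trans hnN)
    refine (h₀ τ N t h j hj (hjn.trans hnN) B hB0.le fun i hi hij => by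
      rw [hB i hi (hij.trans hjn), zero_mul, zero_add]).trans ?_
    have := hΦ τ j n hτ hj hjn
    gcongr
  have hΦn := hΦ0 τ n hτ hn
  have b₁ := h₁ N t ht htN hstep n hn hnN w₁ (κ * E 0 + g) (by positivity) hw₁0.le
    fun j hj hjn => (hw₁ j hj hjn).le
  have b₂ := h₂ τ N t h htN hstep n hn hnN w₂ (κ * (A * (C₀ * Φ τ n))) (by positivity) hw₂0.le
    fun j hj hjn => by
      rw [hw₂ j hj hjn]
      have := mul_le_mul_of_nonneg_left (hBle j hj hjn) (show 0 ≤ κ * A by positivity)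
      linarith
  have hz := nonpos_of_discreteCaputo_le hα (ht.mono hnN) hdiag
    (z := fun k => E k - (E 0 + (A * B k + (w₁ k + w₂ k)))) (by simp [hB0, hw₁0, hw₂0])
    (fun j hj hjn => by
      rw [discreteCaputo_sub, discreteCaputo_add, discreteCaputo_const, discreteCaputo_add,
        discreteCaputo_const_mul, discreteCaputo_add, hB j hj hjn, hw₁ j hj hjn, hw₂ j hj hjn]
      have h3 := hE j hj (hjn.trans hnN)
      have h4 := abs_le_iSup_fin Th hj hjn
      linarith) n le_rfl
  have hBn := mul_le_mul_of_nonneg_left (hBle n hn le_rfl) hA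
  set S : ℝ := A * (Φ τ n * t n ^ (-q)) with hS
  have hS0 : 0 ≤ S := by positivity
  have c₁ : C₁ * (t n ^ α * (κ * E 0 + g)) ≤ C₁ * κ * T ^ α * E 0 + C₁ * (t n ^ α * g) := by
    have : C₁ * κ * t n ^ α * E 0 ≤ C₁ * κ * T ^ α * E 0 := by gcongr
    linarith
  have c₂ : C₂ * (κ * (A * (C₀ * Φ τ n)) * t n ^ (α - q)) ≤ C₂ * κ * C₀ * T ^ α * S := by
    rw [sub_eq_add_neg, Real.rpow_add htn, hS]
    calc _ = C₂ * κ * C₀ * t n ^ α * (A * (Φ τ n * t n ^ (-q))) := by ring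
      _ ≤ _ := by gcongr
  rw [dataError, ← hg]
  have d₁ : 0 ≤ (C₁ + C₀ + C₂ * κ * C₀ * T ^ α) * E 0 := by positivity
  have d₂ : 0 ≤ (1 + C₁ * κ * T ^ α + C₀ + C₂ * κ * C₀ * T ^ α) * (t n ^ α * g) := by positivity
  have d₃ : 0 ≤ (1 + C₁ * κ * T ^ α + C₁) * S := by positivity
  linarith

lemma scale_div_rpow_le {c x p p' : ℝ} (hx : 0 < x) (hxc : x ≤ c) (hpp' : p ≤ p') :
    x ^ p' ≤ c ^ (p' - p) * x ^ p := by
  have : x ^ p' = x ^ (p' - p) * x ^ p := by rw [← Real.rpow_add hx, sub_add_cancel]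
  rw [this]
  have := Real.rpow_le_rpow hx.le hxc (sub_nonneg.2 hpp')
  gcongr

lemma rpow_mul_div_rpow {x y : ℝ} (hx : 0 < x) (hy : 0 < y) (a p : ℝ) :
    x ^ a * (x / y) ^ p = x ^ (a + p) * y ^ (-p) := by
  rw [Real.div_rpow hx.le hy.le, div_eq_mul_inv (x ^ p), ← Real.rpow_neg hy.le, ← mul_assoc,
    ← Real.rpow_add hx]

/-- The error bound in terms of the response to the leading part `(τ / t_j)^p` of the truncation
error. -/
lemma error_le (α β r T κ θ c K p q : ℝ) (hα : α ∈ Ioo (0 : ℝ) 1) (hβ : 0 < β) (hβ2 : β ≤ 2)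
    (hr : 0 < r) (hT : 0 < T) (hκ : 0 < κ) (hθ : θ < 1) (hc : 1 ≤ c)
    (hp₁ : p ≤ 1 + α) (hp₂ : p ≤ (2 - α) / r - β + α) (hq : q < 1) (Φ : ℝ → ℕ → ℝ)
    (hΦ0 : ∀ τ n, 0 < τ → 1 ≤ n → 0 ≤ Φ τ n)
    (hΦ : ∀ τ j n, 0 < τ → 1 ≤ j → j ≤ n → Φ τ j ≤ Φ τ n)
    (hresp : ∃ C > 0, ∀ (τ : ℝ) (N : ℕ) (t : ℕ → ℝ), HasGrading r c τ N t →
      ∀ n, 1 ≤ n → n ≤ N → ∀ w : ℕ → ℝ, w 0 ≤ 0 →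
      (∀ j, 1 ≤ j → j ≤ n → discreteCaputo α t w j ≤ (τ / t j) ^ p) →
      w n ≤ C * (Φ τ n * t n ^ (-q))) :
    ∃ C : ℝ, 0 < C ∧
      ∀ (X : Type*) [NormedAddCommGroup X] [NormedSpace ℝ X] [CompleteSpace X]
        (N : ℕ) (t : ℕ → ℝ) (u : ℝ → X) (E Th : ℕ → ℝ),
        1 ≤ N →
        IsQuasiGradedMesh T r c N t →
        (∀ n, 1 ≤ n → n ≤ N → κ * Real.Gamma (2 - α) * timeStep t n ^ α ≤ θ) →
        HasWeakSingularity T β K u →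
        (∀ n, n ≤ N → 0 ≤ E n) →
        (∀ n, 1 ≤ n → n ≤ N →
          discreteCaputo α t E n ≤ κ * E n + |Th n| + ‖temporalTruncation α t u n‖) →
        ∀ n, 1 ≤ n → n ≤ N →
          E n ≤ C * (gradedScale T r N ^ (β - α) * (Φ (gradedScale T r N) n * t n ^ (-q))
            + dataError α t E Th n) := by
  obtain ⟨C₁, hC₁, htr⟩ := norm_temporalTruncation_le α β r c T K hα hβ hβ2 hr hc
  obtain ⟨C₂, hC₂, hst⟩ := le_add_dataError α r c κ θ T p q hα hr hc hκ hθ hT hq Φ hΦ0 hΦ hresp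
  have hc0 : 0 < c := by linarith
  set a : ℝ := C₁ * (c ^ (1 + α - p) + c ^ ((2 - α) / r - β + α - p)) with ha
  have ha0 : 0 < a := by positivity
  refine ⟨C₂ * (a + 1), by positivity, ?_⟩
  intro X _ _ _ N t u E Th hN hm hstep hu hE0 hE n hn hnN
  have h := hm.hasGrading hT hN
  set τ := gradedScale T r N with hτdef
  have hτ := h.scale_pos
  have ht := h.isTimeMesh
  have hb := hst τ N t E Th (a * τ ^ (β - α)) h hm.final.le hstep (by positivity)
    (hE0 0 (Nat.zero_le _)) (fun j hj hjN => by
      refine (hE j hj hjN).trans ?_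
      have htj := ht.pos hj hjN
      have h1 := htr X τ N t u h hm.final.le hu j hj hjN
      have hx : 0 < τ / t j := by positivity
      have hxc : τ / t j ≤ c := by
        rw [div_le_iff₀ htj]
        refine le_trans ?_ (h.node_lower j hj hjN)
        exact le_mul_of_one_le_right hτ.le (Real.one_le_rpow (by exact_mod_cast hj) hr.le)
      have e₁ : τ ^ (1 + β) * t j ^ (-1 - α) = τ ^ (β - α) * (τ / t j) ^ (1 + α) := by
        rw [rpow_mul_div_rpow hτ htj]; ring_nf
      have e₂ : τ ^ ((2 - α) / r) * t j ^ (β - α - (2 - α) / r)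
          = τ ^ (β - α) * (τ / t j) ^ ((2 - α) / r - β + α) := by
        rw [rpow_mul_div_rpow hτ htj]; ring_nf
      rw [e₁, e₂] at h1
      have g₁ := scale_div_rpow_le hx hxc hp₁
      have g₂ := scale_div_rpow_le hx hxc hp₂
      have h2 : ‖temporalTruncation α t u j‖ ≤ a * τ ^ (β - α) * (τ / t j) ^ p := by
        calc _ ≤ _ := h1
          _ ≤ C₁ * (τ ^ (β - α) * (c ^ (1 + α - p) * (τ / t j) ^ p)
              + τ ^ (β - α) * (c ^ ((2 - α) / r - β + α - p) * (τ / t j) ^ p)) := by gcongr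
          _ = _ := by rw [ha]; ring
      linarith) n hn hnN
  refine hb.trans ?_
  have htn := ht.pos hn hnN
  have hS : 0 ≤ τ ^ (β - α) * (Φ τ n * t n ^ (-q)) := by
    have := hΦ0 τ n hτ hn
    positivity
  have hd : 0 ≤ dataError α t E Th n := by
    have h1 := hE0 0 (Nat.zero_le _)
    have h2 := (abs_nonneg _).trans (abs_le_iSup_fin Th le_rfl hn)
    rw [dataError]
    positivity
  have k₁ : 0 ≤ C₂ * (τ ^ (β - α) * (Φ τ n * t n ^ (-q))) := by positivity
  have k₂ : 0 ≤ C₂ * a * dataError α t E Th n := by positivity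
  linarith

theorem theorem2 (α β r T κ θ c K : ℝ)
    (hα : α ∈ Set.Ioo (0 : ℝ) 1) (hβ : β ∈ Set.Ioo (0 : ℝ) 1 ∪ Set.Ioc (1 : ℝ) 2)
    (hr : 0 < r) (hT : 0 < T) (hκ : 0 < κ) (hθ : θ < 1) :
    ∃ C : ℝ, 0 < C ∧
      ∀ (X : Type*) [NormedAddCommGroup X] [NormedSpace ℝ X] [CompleteSpace X]
        (N : ℕ) (t : ℕ → ℝ) (u : ℝ → X) (E Th : ℕ → ℝ),
        1 ≤ N →
        IsQuasiGradedMesh T r c N t →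
        (∀ n, 1 ≤ n → n ≤ N → κ * Real.Gamma (2 - α) * timeStep t n ^ α ≤ θ) →
        HasWeakSingularity T β K u →
        (∀ n, n ≤ N → 0 ≤ E n) →
        (∀ n, 1 ≤ n → n ≤ N →
          discreteCaputo α t E n ≤ κ * E n + |Th n| + ‖temporalTruncation α t u n‖) →
        ∀ n, 1 ≤ n → n ≤ N →
          ((2 - α) / (1 + β - α) < r →
            E n ≤ C * (gradedScale T r N ^ ((2 - α) / r) * t n ^ (β - (2 - α) / r)
              + dataError α t E Th n)) ∧
          (r = (2 - α) / (1 + β - α) →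
            E n ≤ C * (gradedScale T r N ^ (1 + β - α) * t n ^ (α - 1) * (1 + Real.log n)
              + dataError α t E Th n)) ∧
          (r < (2 - α) / (1 + β - α) →
            E n ≤ C * (gradedScale T r N ^ (1 + β - α) * t n ^ (α - 1)
              + dataError α t E Th n)) := by
  have hβ0 : 0 < β := by
    rcases hβ with h | h
    · exact h.1
    · linarith [h.1]
  have hβ2 : β ≤ 2 := by
    rcases hβ with h | h
    · linarith [h.2]
    · exact h.2
  by_cases hc : 1 ≤ c
  swap
  -- a mesh whose last node is `T` exists only for `c ≥ 1`
  · refine ⟨1, one_pos, fun X _ _ _ N t u E Th hN hm => ?_⟩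
    exact absurd (hm.hasGrading hT hN).one_le hc
  have hσ : 0 < 1 + β - α := by linarith [hα.2]
  have h1α : 0 < 1 - α := by linarith [hα.2]
  have hlog : ∀ n : ℕ, 0 ≤ Real.log n := fun n => Real.log_natCast_nonneg n
  rcases lt_trichotomy ((2 - α) / (1 + β - α)) r with hcase | hcase | hcase
  · -- the truncation error is dominated by the later steps and has an integrable exponent
    have hρ : (2 - α) / r < 1 + β - α := by
      rw [div_lt_iff₀ hσ] at hcase
      rw [div_lt_iff₀ hr]
      linarith
    have hp : (2 - α) / r - β + α < 1 := by linarith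
    obtain ⟨C, hC, hmain⟩ := error_le α β r T κ θ c K ((2 - α) / r - β + α)
      ((2 - α) / r - β + α - α) hα hβ0 hβ2 hr hT hκ hθ hc (by linarith [hα.1]) le_rfl
      (by linarith [hα.1]) (fun τ _ => τ ^ ((2 - α) / r - β + α))
      (fun τ n hτ _ => Real.rpow_nonneg hτ.le _) (fun τ j n _ _ _ => le_rfl)
      (le_of_scale_source_of_lt_one α r c _ hα hr hc hp)
    refine ⟨C, hC, fun X _ _ _ N t u E Th hN hm hstep hu hE0 hE n hn hnN =>
      ⟨fun _ => ?_, fun h => absurd h hcase.ne', fun h => absurd h hcase.not_gt⟩⟩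
    have hτ := (hm.hasGrading hT hN).scale_pos
    refine (hmain X N t u E Th hN hm hstep hu hE0 hE n hn hnN).trans (le_of_eq ?_)
    rw [← mul_assoc, ← Real.rpow_add hτ]
    ring_nf
  · -- the logarithm of the harmonic sum
    have hρ : (2 - α) / r = 1 + β - α := by
      rw [div_eq_iff hσ.ne'] at hcase
      rw [div_eq_iff hr.ne']
      linarith
    obtain ⟨C, hC, hmain⟩ := error_le α β r T κ θ c K 1
      (1 - α) hα hβ0 hβ2 hr hT hκ hθ hc (by linarith [hα.1]) (by rw [hρ]; linarith)
      (by linarith [hα.1]) (fun τ n => τ * (1 + Real.log n))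
      (fun τ n hτ _ => mul_nonneg hτ.le (by linarith [hlog n]))
      (fun τ j n hτ hj hjn => by
        have : Real.log j ≤ Real.log n :=
          Real.log_le_log (by exact_mod_cast hj) (by exact_mod_cast hjn)
        gcongr)
      (le_of_scale_source_one α r c hα hr hc)
    refine ⟨C, hC, fun X _ _ _ N t u E Th hN hm hstep hu hE0 hE n hn hnN =>
      ⟨fun h => absurd h hcase.not_lt, fun _ => ?_, fun h => absurd h hcase.not_gt⟩⟩
    have hτ := (hm.hasGrading hT hN).scale_pos
    refine (hmain X N t u E Th hN hm hstep hu hE0 hE n hn hnN).trans (le_of_eq ?_)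
    have e : gradedScale T r N ^ (1 + β - α) = gradedScale T r N ^ (β - α) * gradedScale T r N := by
      rw [← Real.rpow_add_one hτ.ne']; ring_nf
    rw [e, neg_sub]
    ring
  · -- the source is summable, and the response is that to a pulse at the start
    have hρ : 1 + β - α < (2 - α) / r := by
      rw [lt_div_iff₀ hσ] at hcase
      rw [lt_div_iff₀ hr]
      linarith
    obtain ⟨C, hC, hmain⟩ := error_le α β r T κ θ c K (min (1 + α) ((2 - α) / r - β + α))
      (1 - α) hα hβ0 hβ2 hr hT hκ hθ hc (min_le_left _ _) (min_le_right _ _)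
      (by linarith [hα.1]) (fun τ _ => τ) (fun τ n hτ _ => hτ.le) (fun τ j n _ _ _ => le_rfl)
      (le_of_scale_source_of_one_lt α r c _ hα hr hc
        (lt_min (by linarith [hα.1]) (by linarith)))
    refine ⟨C, hC, fun X _ _ _ N t u E Th hN hm hstep hu hE0 hE n hn hnN =>
      ⟨fun h => absurd h hcase.not_gt, fun h => absurd h hcase.ne, fun _ => ?_⟩⟩
    have hτ := (hm.hasGrading hT hN).scale_pos
    refine (hmain X N t u E Th hN hm hstep hu hE0 hE n hn hnN).trans (le_of_eq ?_)
    have e : gradedScale T r N ^ (1 + β - α) = gradedScale T r N ^ (β - α) * gradedScale T r N := by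
      rw [← Real.rpow_add_one hτ.ne']; ring_nf
    rw [e, neg_sub]
    ring
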